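/- **Setting.** Let $(\mathcal A,\mathcal H,D)$ be a spectral triple: $\mathcal A\subseteq\mathcal B(\mathcal H)$ is a unital $*$-algebra, $D$ is self-adjoint in $\mathcal H$, and every $a\in\mathcal A$ preserves $\operatorname{dom}D$ and has a bounded commutator $[D,a]$. Suppose that $\mathcal H$ (of dimension $\le\aleph_0$) has an orthonormal basis $\varphi_1,\varphi_2,\dots$ of eigenvectors of $D$ with eigenvalues $\lambda_1,\lambda_2,\dots$. Put $M_N=\operatorname{span}\{|\varphi_i\rangle\langle\varphi_j|: i,j\le N\}$, $H_N=(M_N)_{\rm sa}$ with Lebesgue measure in the coordinates $\operatorname{Re}Q_{ij}$ $(i\le j)$, $\operatorname{Im}Q_{ij}$ $(i<j)$, where $Q_{ij}=\langle\varphi_i,Q\varphi_j\rangle$. Let $f\in C^\infty(\mathbb R)$, with divided differences $f^{[n]}$, and let $N\in\mathbb N$ be such that $(f')^{[1]}(\lambda_i,\lambda_j)>0$ for $i,j\le N$. **The bracket.** $\langle V_1,\dots,V_n\rangle=\sum_{j=1}^n\operatorname{Tr}T_{f^{[n]}}(V_j,\dots,V_n,V_1,\dots,V_{j-1})$, where $$\operatorname{Tr}T_{f^{[n]}}(V_1,\dots,V_n)=\sum_{i_1,\dots,i_n}f^{[n]}(\lambda_{i_1},\dots,\lambda_{i_n},\lambda_{i_1})(V_1)_{i_1i_2}\cdots(V_n)_{i_ni_1}.$$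 **Diagrams and amplitudes.** A noncommutative Feynman diagram is a finite multigraph with external edges marked $1,\dots,n$ and, at each vertex, a cyclic (clockwise) order of the incident edges. Its amplitude $\Gamma^G_N$ is defined as follows. A single vertex with edges marked $1,\dots,n$ in cyclic order has amplitude $\langle V_1,\dots,V_n\rangle$; disjoint unions give products; and joining the external edges $i\ne j$ of $G$ by a propagator gives $$-\frac{\int_{H_N}\Gamma^G_N(V_1,\dots,\overset{i}{Q},\dots,\overset{j}{Q},\dots,V_n)\,e^{-\frac12\langle Q,Q\rangle}\,dQ}{\int_{H_N}e^{-\frac12\langle Q,Q\rangle}\,dQ}.$$ The one-loop bracket is $\langle\!\langle V_1,\dots,V_n\rangle\!\rangle_N^{1L}=\sum_G\Gamma^G_N(V_1,\dots,V_n)$, over the isomorphism classes of planar, one-loop ($1-\#\text{vertices}+\#\text{internal edges}=1$), one-particle-irreducible diagrams $G$ with clockwise vertices of degree $\ge3$ and with external edges outside the loop and marked cyclically. The one-loop quantum effective spectral action is the formal series $\sum_{n\ge1}\frac1n\langle\!\langle V,\dots,V\rangle\!\rangle_N^{1L}$. **Theorem.** 1. The sum defining $\langle\!\langle\cdot\rangle\!\rangle_N^{1L}$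 is finite, and isomorphic diagrams have the same amplitude on $V_1,\dots,V_n\in\bigcup_KM_K$. 2. (Cyclicity) For $n\ge1$ and $V_1,\dots,V_n\in\bigcup_KM_K$, $\langle\!\langle V_1,\dots,V_n\rangle\!\rangle_N^{1L}=\langle\!\langle V_n,V_1,\dots,V_{n-1}\rangle\!\rangle_N^{1L}$. 3. (Quantum Ward identity) For $n\ge1$, $V_1,\dots,V_n\in M_N$ and $a\in\mathcal A$, $$\langle\!\langle aV_1,V_2,\dots,V_n\rangle\!\rangle_N^{1L}-\langle\!\langle V_1,\dots,V_{n-1},V_na\rangle\!\rangle_N^{1L}=\langle\!\langle V_1,\dots,V_n,[D,a]\rangle\!\rangle_N^{1L}.$$ 4. Suppose that $\Omega^1_D(\mathcal A)=\operatorname{span}\{a[D,b]:a,b\in\mathcal A\}\subseteq M_N$. Put $\phi^N_0=0$, $\phi^N_n(a_0,\dots,a_n)=\langle\!\langle a_0[D,a_1],[D,a_2],\dots,[D,a_n]\rangle\!\rangle_N^{1L}$ for $n\ge1$, $\psi^N_{2k-1}=\phi^N_{2k-1}-\frac12B_0\phi^N_{2k}$ with $B_0\phi(a_0,\dots,a_n)=\phi(1,a_0,\dots,a_n)$,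 and $\tilde\psi^N_{2k-1}=(-1)^{k-1}\frac{(k-1)!}{(2k-1)!}\psi^N_{2k-1}$. Then these are multilinear functionals on $\mathcal A$ that vanish if $a_j=1$ for some $j\ge1$; $(\phi^N_2,\phi^N_4,\dots)$ is an even $(b,B)$-cocycle and $(\tilde\psi^N_1,\tilde\psi^N_3,\dots)$ is an odd one, that is, $b\phi^N_{2k}+B\phi^N_{2k+2}=0$ for $k\ge0$, $B\tilde\psi^N_1=0$ and $b\tilde\psi^N_{2k-1}+B\tilde\psi^N_{2k+1}=0$ for $k\ge1$. Here, for $\phi$ of degree $n$ (in the formula for $b$) or $n+1$ (in that for $B$), $$b\phi(a_0,\dots,a_{n+1})=\sum_{j=0}^n(-1)^j\phi(\dots,a_ja_{j+1},\dots)+(-1)^{n+1}\phi(a_{n+1}a_0,a_1,\dots,a_n),$$ $$B\phi(a_0,\dots,a_n)=\sum_{j=0}^n(-1)^{nj}\phi(1,a_j,a_{j+1},\dots,a_{j-1}).$$ Moreover $$\sum_{n\ge1}\tfrac1n\langle\!\langle V,\dots,V\rangle\!\rangle_N^{1L}\sim\sum_{k\ge1}\Big(\int_{\psi^N_{2k-1}}\mathrm{cs}_{2k-1}(A)+\tfrac1{2k}\int_{\phi^N_{2k}}F^k\Big)$$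 for every universal one-form $A=\sum_ja_j\,db_j\in\Omega^1(\mathcal A)$ and $V=\pi_D(A)=\sum_ja_j[D,b_j]$, in the following sense: for every $K$ there are universal forms $\omega_l\in\Omega^l(\mathcal A)$, $K+1\le l\le 2K+1$, depending on $A$ and $K$ but not on $f$ and $N$, such that $$\sum_{n=1}^K\tfrac1n\langle\!\langle V,\dots,V\rangle\!\rangle_N^{1L}-\sum_{k=1}^K\Big(\int_{\psi^N_{2k-1}}\mathrm{cs}_{2k-1}(A)+\tfrac1{2k}\int_{\phi^N_{2k}}F^k\Big)=\sum_{l=K+1}^{2K+1}\int_{\phi^N_l}\omega_l.$$ Here $\Omega^\bullet(\mathcal A)$ is the universal differential graded algebra of $\mathcal A$, $F=dA+A^2$, $\mathrm{cs}_{2k-1}(A)=\int_0^1A\,(t\,dA+t^2A^2)^{k-1}\,dt$, and $\int_\phi a_0\,da_1\cdots da_n=\phi(a_0,\dots,a_n)$. -/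

import Mathlib

open scoped TensorProduct ContDiff

noncomputable section

namespace NCG

/-! ### The universal differential graded algebra of a unital algebra -/

section UniversalForms

variable (A : Type*) [Ring A] [Algebra ℂ A]

/-- Relations of the universal differential graded algebra: the generators `inl a` stand for the
elements of `A`, the generators `inr a` for their differentials `da`. -/
inductive UnivRel : FreeAlgebra ℂ (A ⊕ A) → FreeAlgebra ℂ (A ⊕ A) → Prop
  | of_algebraMap (c : ℂ) : UnivRel (FreeAlgebra.ι ℂ (.inl (algebraMap ℂ A c))) (algebraMap ℂ _ c)
  | of_add (a b : A) : UnivRel (FreeAlgebra.ι ℂ (.inl (a + b)))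
      (FreeAlgebra.ι ℂ (.inl a) + FreeAlgebra.ι ℂ (.inl b))
  | of_mul (a b : A) : UnivRel (FreeAlgebra.ι ℂ (.inl (a * b)))
      (FreeAlgebra.ι ℂ (.inl a) * FreeAlgebra.ι ℂ (.inl b))
  | del_add (a b : A) : UnivRel (FreeAlgebra.ι ℂ (.inr (a + b)))
      (FreeAlgebra.ι ℂ (.inr a) + FreeAlgebra.ι ℂ (.inr b))
  | del_smul (c : ℂ) (a : A) : UnivRel (FreeAlgebra.ι ℂ (.inr (c • a)))
      (c • FreeAlgebra.ι ℂ (.inr a))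
  | del_mul (a b : A) : UnivRel (FreeAlgebra.ι ℂ (.inr (a * b)))
      (FreeAlgebra.ι ℂ (.inr a) * FreeAlgebra.ι ℂ (.inl b)
        + FreeAlgebra.ι ℂ (.inl a) * FreeAlgebra.ι ℂ (.inr b))

/-- The algebra `Ω(A)` of universal differential forms. -/
def UnivForms : Type _ := RingQuot (UnivRel A)

instance : Ring (UnivForms A) := inferInstanceAs (Ring (RingQuot (UnivRel A)))

instance : Algebra ℂ (UnivForms A) := inferInstanceAs (Algebra ℂ (RingQuot (UnivRel A)))

namespace UnivForms

variable {A}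

/-- The quotient map from the free algebra. -/
def mk : FreeAlgebra ℂ (A ⊕ A) →ₐ[ℂ] UnivForms A := RingQuot.mkAlgHom ℂ (UnivRel A)

theorem mk_eq {x y : FreeAlgebra ℂ (A ⊕ A)} (h : UnivRel A x y) : mk x = mk y :=
  RingQuot.mkAlgHom_rel ℂ h

/-- The inclusion of `A` as the forms of degree zero. -/
def of : A →ₐ[ℂ] UnivForms A where
  toFun a := mk (FreeAlgebra.ι ℂ (.inl a))
  map_one' := by
    have h := mk_eq (UnivRel.of_algebraMap (A := A) 1)
    simpa using h
  map_mul' a b := by simpa using mk_eq (UnivRel.of_mul a b)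
  map_zero' := by
    have h := mk_eq (UnivRel.of_algebraMap (A := A) 0)
    simpa using h
  map_add' a b := by simpa using mk_eq (UnivRel.of_add a b)
  commutes' c := by simpa using mk_eq (UnivRel.of_algebraMap (A := A) c)

/-- The differential `a ↦ da` of degree zero elements. -/
def del : A →ₗ[ℂ] UnivForms A where
  toFun a := mk (FreeAlgebra.ι ℂ (.inr a))
  map_add' a b := by simpa using mk_eq (UnivRel.del_add a b)
  map_smul' c a := by simpa using mk_eq (UnivRel.del_smul c a)

theorem del_mul (a b : A) : del (a * b) = del a * of b + of a * del b := by
  simpa [of, del] using mk_eq (UnivRel.del_mul a b)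

section Lift

variable {B : Type*} [Ring B] [Algebra ℂ B] (g : A →ₐ[ℂ] B) (δ : A →ₗ[ℂ] B)
  (h : ∀ a b, δ (a * b) = δ a * g b + g a * δ b)

/-- The universal property of the algebra `Ω(A)`. -/
def lift : UnivForms A →ₐ[ℂ] B :=
  RingQuot.liftAlgHom ℂ ⟨FreeAlgebra.lift ℂ (Sum.elim g δ), by
    intro x y hxy
    cases hxy <;> simp [h]⟩

@[simp] theorem lift_of (a : A) : lift g δ h (of a) = g a := by
  change RingQuot.liftAlgHom ℂ _ (RingQuot.mkAlgHom ℂ (UnivRel A) _) = _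
  rw [RingQuot.liftAlgHom_mkAlgHom_apply]
  simp

@[simp] theorem lift_del (a : A) : lift g δ h (del a) = δ a := by
  change RingQuot.liftAlgHom ℂ _ (RingQuot.mkAlgHom ℂ (UnivRel A) _) = _
  rw [RingQuot.liftAlgHom_mkAlgHom_apply]
  simp

end Lift

variable (A) in
/-- The forms `Ωⁿ(A)` of degree `n`, spanned by `a₀ da₁ ⋯ daₙ`. -/
def degree (n : ℕ) : Submodule ℂ (UnivForms A) :=
  Submodule.span ℂ {η | ∃ (a₀ : A) (a : Fin n → A),
    η = of a₀ * (List.ofFn fun i => del (a i)).prod}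

/-- Encodes a form `η` as the matrix `(±η, dη; 0, η)`, where the sign is the parity of `η`. That
this is multiplicative is the graded Leibniz rule. -/
def diffMatrix : UnivForms A →ₐ[ℂ] Matrix (Fin 2) (Fin 2) (UnivForms A) :=
  lift
    { toFun := fun a => !![of a, del a; 0, of a]
      map_one' := by
        have h1 : (del (1 : A)) = 0 := by simpa using del_mul (1 : A) 1
        ext i j; fin_cases i <;> fin_cases j <;> simp [h1]
      map_mul' := fun a b => by
        ext i j; fin_cases i <;> fin_cases j <;>
          simp [Matrix.mul_apply, Fin.sum_univ_two, del_mul, add_comm]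
      map_zero' := by ext i j; fin_cases i <;> fin_cases j <;> simp
      map_add' := fun a b => by ext i j; fin_cases i <;> fin_cases j <;> simp
      commutes' := fun c => by
        have h1 : (del (1 : A)) = 0 := by simpa using del_mul (1 : A) 1
        ext i j; fin_cases i <;> fin_cases j <;>
          simp [Matrix.algebraMap_matrix_apply, Algebra.algebraMap_eq_smul_one, h1] }
    { toFun := fun a => !![-del a, 0; 0, del a]
      map_add' := fun a b => by
        ext i j; fin_cases i <;> fin_cases j <;> simp [add_comm]
      map_smul' := fun c a => by ext i j; fin_cases i <;> fin_cases j <;> simp }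
    (fun a b => by
      ext i j; fin_cases i <;> fin_cases j <;>
        simp [del_mul, add_comm])

/-- The differential of the universal differential graded algebra. -/
def d : UnivForms A →ₗ[ℂ] UnivForms A where
  toFun η := diffMatrix η 0 1
  map_add' x y := by simp
  map_smul' c x := by simp

@[simp] theorem d_of (a : A) : d (of a) = del a := by simp [d, diffMatrix]

@[simp] theorem d_del (a : A) : d (del a) = 0 := by simp [d, diffMatrix]

/-- On one-forms, `d(a db) = da db`. -/
theorem d_of_mul_del (a b : A) : d (of a * del b) = del a * del b := by
  simp [d, diffMatrix, Matrix.mul_apply, Fin.sum_univ_two]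

/-- The curvature `F = dα + α²` of a one-form. -/
def curvature (α : UnivForms A) : UnivForms A := d α + α ^ 2

/-- Integration from `0` to `1` of a polynomial in `t` with coefficients in `Ω(A)`. -/
def intPoly (p : Polynomial (UnivForms A)) : UnivForms A :=
  p.sum fun n c => ((n : ℂ) + 1)⁻¹ • c

open Polynomial in
/-- The Chern–Simons form `cs_{2k+1}(α) = ∫₀¹ α (t dα + t² α²)ᵏ dt` of degree `2k + 1`. -/
def chernSimons (k : ℕ) (α : UnivForms A) : UnivForms A :=
  intPoly (C α * (X * C (d α) + X ^ 2 * C (α ^ 2)) ^ k)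

end UnivForms

end UniversalForms

/-! ### Cochains, the `(b, B)`-complex, and integration of universal forms -/

section Cochains

variable {A : Type*} [Ring A] [Algebra ℂ A]

variable (A) in
/-- Multilinear functionals of `n + 1` variables. -/
abbrev Cochain (n : ℕ) : Type _ := MultilinearMap ℂ (fun _ : Fin (n + 1) => A) ℂ

/-- The normalisation required of Hochschild cochains: `φ (a₀, …, aₙ) = 0` as soon as `aⱼ = 1` for
some `j ≥ 1`. -/
def Cochain.IsNormalized {n : ℕ} (φ : Cochain A n) : Prop :=
  ∀ (a : Fin (n + 1) → A) (j : Fin (n + 1)), j ≠ 0 → a j = 1 → φ a = 0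

/-- The Hochschild coboundary `bφ`. -/
def hochschildB {n : ℕ} (φ : Cochain A n) (a : Fin (n + 2) → A) : ℂ :=
  ∑ j : Fin (n + 1), (-1) ^ (j : ℕ) * φ (Fin.contractNth j.castSucc (· * ·) a)
    + (-1) ^ (n + 1) * φ (Fin.cons (a (Fin.last (n + 1)) * a 0) fun i : Fin n => a i.succ.castSucc)

/-- Connes' operator `(Bφ)(a₀, …, aₙ) = ∑ⱼ (-1)^{nj} φ(1, aⱼ, aⱼ₊₁, …, aⱼ₋₁)`. -/
def connesB {n : ℕ} (φ : Cochain A (n + 1)) (a : Fin (n + 1) → A) : ℂ :=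
  ∑ j : Fin (n + 1), (-1) ^ (n * (j : ℕ)) * φ (Fin.cons 1 fun i => a (j + i))

/-- `(B₀φ)(a₀, …, aₙ) = φ(1, a₀, …, aₙ)`. -/
def connesB₀ {n : ℕ} (φ : Cochain A (n + 1)) : Cochain A n := φ.curryLeft 1

/-- An even `(b, B)`-cocycle `(φ₀, φ₂, φ₄, …)`; the `k`-th entry is `φ_{2k}`. -/
def IsEvenCocycle (φ : (k : ℕ) → Cochain A (2 * k)) : Prop :=
  (∀ k, (φ k).IsNormalized) ∧
    ∀ k (a : Fin (2 * k + 2) → A), hochschildB (φ k) a + connesB (φ (k + 1)) a = 0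

/-- An odd `(b, B)`-cocycle `(ψ₁, ψ₃, ψ₅, …)`; the `k`-th entry is `ψ_{2k+1}`. -/
def IsOddCocycle (ψ : (k : ℕ) → Cochain A (2 * k + 1)) : Prop :=
  (∀ k, (ψ k).IsNormalized) ∧ (∀ a, connesB (ψ 0) a = 0) ∧
    ∀ k (a : Fin (2 * k + 3) → A), hochschildB (ψ k) a + connesB (ψ (k + 1)) a = 0

/-- The linear functional `a₀ ⊗ (a₁ ⋯ aₙ) ↦ φ(a₀, …, aₙ)` on `A ⊗ T(A)`, zero on the components
of the wrong tensor degree. -/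
def tensorEval {n : ℕ} (φ : Cochain A n) : A ⊗[ℂ] TensorAlgebra ℂ A →ₗ[ℂ] ℂ :=
  TensorProduct.lift <|
    (LinearMap.lcomp ℂ ℂ
      ((DirectSum.component ℂ ℕ (fun n => ⨂[ℂ]^n A) n) ∘ₗ
        (TensorAlgebra.toDirectSum (R := ℂ) (M := A)).toLinearMap)) ∘ₗ
    (PiTensorProduct.lift (R := ℂ) (s := fun _ : Fin n => A) (E := ℂ)).toLinearMap ∘ₗ
    (MultilinearMap.curryLeft φ)

/-- The map `a ⊗ t ↦ 1 ⊗ (a t)` on `A ⊗ T(A)`. -/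
def tensorShift : Module.End ℂ (A ⊗[ℂ] TensorAlgebra ℂ A) :=
  (TensorProduct.mk ℂ A (TensorAlgebra ℂ A) 1) ∘ₗ
    (LinearMap.mul' ℂ (TensorAlgebra ℂ A)) ∘ₗ
    (TensorProduct.map (TensorAlgebra.ι ℂ) LinearMap.id)

/-- The action of universal forms on `A ⊗ T(A)` in which `A` acts by left multiplication and `da`
as the commutator of `tensorShift` with `a`. -/
def formAction : UnivForms A →ₐ[ℂ] Module.End ℂ (A ⊗[ℂ] TensorAlgebra ℂ A) :=
  UnivForms.lift (Algebra.lsmul ℂ ℂ (A ⊗[ℂ] TensorAlgebra ℂ A))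
    ((LinearMap.mulLeft ℂ tensorShift - LinearMap.mulRight ℂ tensorShift) ∘ₗ
      (Algebra.lsmul ℂ ℂ (A ⊗[ℂ] TensorAlgebra ℂ A)).toLinearMap)
    (fun a b => by
      simp only [LinearMap.comp_apply, LinearMap.sub_apply, AlgHom.toLinearMap_apply, map_mul,
        LinearMap.mulLeft_apply, LinearMap.mulRight_apply]
      simp only [sub_mul, mul_sub, mul_assoc]
      abel)

/-- The integral `∫_φ`: the linear functional on universal forms with
`∫_φ a₀ da₁ ⋯ daₙ = φ(a₀, …, aₙ)` for a normalised cochain `φ` (see `integral_apply`). -/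
def integral {n : ℕ} (φ : Cochain A n) : UnivForms A →ₗ[ℂ] ℂ :=
  tensorEval φ ∘ₗ LinearMap.applyₗ (1 ⊗ₜ[ℂ] 1) ∘ₗ formAction.toLinearMap

theorem formAction_del_one_tmul (a : A) (t : TensorAlgebra ℂ A) :
    formAction (UnivForms.del a) (1 ⊗ₜ[ℂ] t) =
      1 ⊗ₜ[ℂ] (TensorAlgebra.ι ℂ a * t) - a ⊗ₜ[ℂ] (TensorAlgebra.ι ℂ 1 * t) := by
  simp [formAction, tensorShift, TensorProduct.smul_tmul']

theorem formAction_of_tmul (a b : A) (t : TensorAlgebra ℂ A) :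
    formAction (UnivForms.of a) (b ⊗ₜ[ℂ] t) = (a * b) ⊗ₜ[ℂ] t := by
  simp [formAction, TensorProduct.smul_tmul']

theorem formAction_del_tmul (a b : A) (t : TensorAlgebra ℂ A) :
    formAction (UnivForms.del a) (b ⊗ₜ[ℂ] t) =
      1 ⊗ₜ[ℂ] (TensorAlgebra.ι ℂ (a * b) * t) - a ⊗ₜ[ℂ] (TensorAlgebra.ι ℂ b * t) := by
  simp [formAction, tensorShift, TensorProduct.smul_tmul']

theorem tensorEval_tprod {n : ℕ} (φ : Cochain A n) (a₀ : A) (m : ℕ) (a : Fin m → A) :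
    tensorEval φ (a₀ ⊗ₜ[ℂ] TensorAlgebra.tprod ℂ A m a) =
      if h : m = n then φ (Fin.cons a₀ (fun i => a (Fin.cast h.symm i))) else 0 := by
  have h0 := TensorAlgebra.toDirectSum_tensorPower_tprod (R := ℂ) (M := A) a
  simp only [tensorEval, TensorProduct.lift.tmul, LinearMap.comp_apply, LinearMap.lcomp_apply,
    AlgHom.toLinearMap_apply, h0]
  rw [← DirectSum.lof_eq_of ℂ, DirectSum.component.of]
  split_ifs with h
  · subst h
    simp
  · simp

theorem ι_mul_tprod (x : A) (m : ℕ) (a : Fin m → A) :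
    TensorAlgebra.ι ℂ x * TensorAlgebra.tprod ℂ A m a
      = TensorAlgebra.tprod ℂ A (m + 1) (Fin.cons x a) := by
  simp [TensorAlgebra.tprod_apply, List.ofFn_succ]

variable (A) in
/-- The span of the elementary tensors in `A ⊗ T(A)` with a `1` in some tensor slot. -/
def unitSpan : Submodule ℂ (A ⊗[ℂ] TensorAlgebra ℂ A) :=
  Submodule.span ℂ {x | ∃ (a₀ : A) (m : ℕ) (a : Fin m → A), (∃ j, a j = 1) ∧
    x = a₀ ⊗ₜ[ℂ] TensorAlgebra.tprod ℂ A m a}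

theorem tensorEval_unitSpan {n : ℕ} {φ : Cochain A n} (hφ : φ.IsNormalized)
    {x : A ⊗[ℂ] TensorAlgebra ℂ A} (hx : x ∈ unitSpan A) : tensorEval φ x = 0 := by
  suffices h : unitSpan A ≤ LinearMap.ker (tensorEval φ) from h hx
  rw [unitSpan, Submodule.span_le]
  rintro _ ⟨a₀, m, a, ⟨j, hj⟩, rfl⟩
  simp only [SetLike.mem_coe, LinearMap.mem_ker, tensorEval_tprod]
  split_ifs with h
  · subst h
    exact hφ _ j.succ (Fin.succ_ne_zero j) (by simpa using hj)
  · rfl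

theorem formAction_del_unitSpan (b : A) {x : A ⊗[ℂ] TensorAlgebra ℂ A} (hx : x ∈ unitSpan A) :
    formAction (UnivForms.del b) x ∈ unitSpan A := by
  suffices h : unitSpan A ≤ (unitSpan A).comap (formAction (UnivForms.del b)) from h hx
  conv_lhs => rw [unitSpan]
  rw [Submodule.span_le]
  rintro _ ⟨a₀, m, a, ⟨j, hj⟩, rfl⟩
  simp only [SetLike.mem_coe, Submodule.mem_comap, formAction_del_tmul, ι_mul_tprod]
  exact Submodule.sub_mem _
    (Submodule.subset_span ⟨_, _, _, ⟨j.succ, by simpa using hj⟩, rfl⟩)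
    (Submodule.subset_span ⟨_, _, _, ⟨j.succ, by simpa using hj⟩, rfl⟩)

theorem formAction_prod_del (n : ℕ) (a : Fin n → A) :
    formAction (List.ofFn fun i => UnivForms.del (a i)).prod (1 ⊗ₜ[ℂ] 1)
      - 1 ⊗ₜ[ℂ] TensorAlgebra.tprod ℂ A n a ∈ unitSpan A := by
  induction n with
  | zero => simp [TensorAlgebra.tprod_apply]
  | succ n ih =>
    have h1 := formAction_del_unitSpan (a 0) (ih fun i => a i.succ)
    have h2 : a 0 ⊗ₜ[ℂ] TensorAlgebra.tprod ℂ A (n + 1) (Fin.cons 1 fun i => a i.succ)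
        ∈ unitSpan A := Submodule.subset_span ⟨_, _, _, ⟨0, by simp⟩, rfl⟩
    have h3 := Submodule.sub_mem _ h1 h2
    rw [map_sub, formAction_del_one_tmul, ι_mul_tprod, ι_mul_tprod] at h3
    have h4 : (Fin.cons (a 0) fun i => a i.succ : Fin (n + 1) → A) = a := Fin.cons_self_tail a
    rw [h4] at h3
    rw [List.ofFn_succ, List.prod_cons, map_mul, Module.End.mul_apply]
    convert h3 using 1
    abel

/-- The defining property of the integral of universal forms. -/
theorem integral_apply {n : ℕ} {φ : Cochain A n} (hφ : φ.IsNormalized) (a₀ : A) (a : Fin n → A) :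
    integral φ (UnivForms.of a₀ * (List.ofFn fun i => UnivForms.del (a i)).prod)
      = φ (Fin.cons a₀ a) := by
  have h := formAction_prod_del n a
  have h1 : formAction (UnivForms.of a₀)
      (formAction (List.ofFn fun i => UnivForms.del (a i)).prod (1 ⊗ₜ[ℂ] 1)
        - 1 ⊗ₜ[ℂ] TensorAlgebra.tprod ℂ A n a) ∈ unitSpan A := by
    suffices h : unitSpan A ≤ (unitSpan A).comap (formAction (UnivForms.of a₀)) from h ‹_›
    conv_lhs => rw [unitSpan]
    rw [Submodule.span_le]
    rintro _ ⟨b, m, c, hc, rfl⟩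
    simp only [SetLike.mem_coe, Submodule.mem_comap, formAction_of_tmul]
    exact Submodule.subset_span ⟨_, _, _, hc, rfl⟩
  have h2 := tensorEval_unitSpan hφ h1
  rw [map_sub, map_sub, formAction_of_tmul, tensorEval_tprod, sub_eq_zero] at h2
  simpa [integral] using h2

end Cochains

/-! ### Spectral triples and the noncommutative vertex -/

section SpectralTriples

/-- A spectral triple `(𝒜, H, D)`: a unital *-algebra of bounded operators on `H` and a (possibly
unbounded) self-adjoint operator `D` in `H`, with bounded commutators. -/
structure SpectralTriple (H : Type*) [NormedAddCommGroup H] [InnerProductSpace ℂ H]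
    [CompleteSpace H] where
  algebra : StarSubalgebra ℂ (H →L[ℂ] H)
  D : H →ₗ.[ℂ] H
  selfAdjoint : IsSelfAdjoint D
  apply_mem : ∀ a ∈ algebra, ∀ x ∈ D.domain, a x ∈ D.domain
  bounded_comm : ∀ a (ha : a ∈ algebra), ∃ T : H →L[ℂ] H, ∀ x (hx : x ∈ D.domain),
    T x = D ⟨a x, apply_mem a ha x hx⟩ - a (D ⟨x, hx⟩)

variable {H : Type*} [NormedAddCommGroup H] [InnerProductSpace ℂ H] [CompleteSpace H]

namespace SpectralTriple

variable (T : SpectralTriple H)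

/-- The bounded extension of `[D, a]`. -/
def commFun (a : T.algebra) : H →L[ℂ] H := (T.bounded_comm a a.2).choose

theorem commFun_apply (a : T.algebra) (x : H) (hx : x ∈ T.D.domain) :
    T.commFun a x = T.D ⟨(a : H →L[ℂ] H) x, T.apply_mem a a.2 x hx⟩
      - (a : H →L[ℂ] H) (T.D ⟨x, hx⟩) :=
  (T.bounded_comm a a.2).choose_spec x hx

theorem ext_on_domain {S S' : H →L[ℂ] H} (h : ∀ x ∈ T.D.domain, S x = S' x) : S = S' :=
  ContinuousLinearMap.ext fun x =>
    congrFun (S.continuous.ext_on T.selfAdjoint.dense_domain S'.continuous h) x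

/-- The derivation `a ↦ [D, a]` from `𝒜` to the bounded operators on `H`. -/
def comm : T.algebra →ₗ[ℂ] (H →L[ℂ] H) where
  toFun := T.commFun
  map_add' a b := T.ext_on_domain fun x hx => by
    have h : T.D ⟨((a + b : T.algebra) : H →L[ℂ] H) x, T.apply_mem _ (a + b).2 x hx⟩
        = T.D (⟨(a : H →L[ℂ] H) x, T.apply_mem a a.2 x hx⟩
          + ⟨(b : H →L[ℂ] H) x, T.apply_mem b b.2 x hx⟩) := by
      congr 1
    rw [T.commFun_apply _ x hx, h, T.D.map_add]
    simp only [add_apply, T.commFun_apply _ x hx, AddMemClass.coe_add]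
    abel
  map_smul' c a := T.ext_on_domain fun x hx => by
    have h : T.D ⟨((c • a : T.algebra) : H →L[ℂ] H) x, T.apply_mem _ (c • a).2 x hx⟩
        = T.D (c • ⟨(a : H →L[ℂ] H) x, T.apply_mem a a.2 x hx⟩) := by
      congr 1
    rw [T.commFun_apply _ x hx, h, T.D.map_smul]
    simp only [RingHom.id_apply, smul_apply, T.commFun_apply _ x hx, smul_sub]
    rfl

theorem comm_apply (a : T.algebra) (x : H) (hx : x ∈ T.D.domain) :
    T.comm a x = T.D ⟨(a : H →L[ℂ] H) x, T.apply_mem a a.2 x hx⟩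
      - (a : H →L[ℂ] H) (T.D ⟨x, hx⟩) := T.commFun_apply a x hx

theorem comm_mul (a b : T.algebra) :
    T.comm (a * b) = T.comm a * (b : H →L[ℂ] H) + (a : H →L[ℂ] H) * T.comm b :=
  T.ext_on_domain fun x hx => by
    have hb := T.apply_mem b b.2 x hx
    have h1 : (T.comm a * (b : H →L[ℂ] H)) x = T.comm a ((b : H →L[ℂ] H) x) := rfl
    have h2 : ((a : H →L[ℂ] H) * T.comm b) x = (a : H →L[ℂ] H) (T.comm b x) := rfl
    have h3 : ((a * b : T.algebra) : H →L[ℂ] H) x = (a : H →L[ℂ] H) ((b : H →L[ℂ] H) x) := rfl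
    rw [add_apply, h1, h2, T.comm_apply _ x hx, T.comm_apply _ _ hb, T.comm_apply _ x hx, map_sub]
    simp only [h3]
    exact (sub_add_sub_cancel _ _ _).symm

/-- The representation of universal forms with `π_D(a₀ da₁ ⋯ daₙ) = a₀ [D, a₁] ⋯ [D, aₙ]`; on
one-forms, `π_D(a db) = a [D, b]`. -/
def rep : UnivForms T.algebra →ₐ[ℂ] (H →L[ℂ] H) :=
  UnivForms.lift T.algebra.subtype.toAlgHom T.comm T.comm_mul

end SpectralTriple

/-- The index set `{i : i < d}` of an orthonormal basis of a `d`-dimensional space, `d ≤ ∞`. -/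
abbrev Modes (d : ℕ∞) : Type := {i : ℕ // (i : ℕ∞) < d}

/-- The first `N` modes. -/
def Modes.below (d : ℕ∞) (N : ℕ) : Finset (Modes d) :=
  (Finset.range N).subtype fun i : ℕ => (i : ℕ∞) < d

/-- An enumerated orthonormal basis of eigenvectors of `D`, with its eigenvalues. -/
structure SpectralTriple.Eigenbasis (T : SpectralTriple H) (d : ℕ∞) where
  vec : HilbertBasis (Modes d) ℂ H
  val : Modes d → ℝ
  vec_mem : ∀ i, vec i ∈ T.D.domain
  apply_vec : ∀ i, T.D ⟨vec i, vec_mem i⟩ = (val i : ℂ) • vec i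

/-- The divided difference: for the list `l = [xₙ₋₁, …, x₀]`, `divDiff f l xₙ` is
`f^{[n]}(x₀, …, xₙ)`, which is the slope of `f^{[n-1]}(x₀, …, xₙ₋₂, ·)` between `xₙ₋₁` and `xₙ`, or
its derivative at `xₙ₋₁` if `xₙ = xₙ₋₁`. -/
def divDiff (f : ℝ → ℂ) : List ℝ → ℝ → ℂ
  | [], x => f x
  | y :: l, x => dslope (divDiff f l) y x

namespace SpectralTriple.Eigenbasis

variable {T : SpectralTriple H} {d : ℕ∞} (E : T.Eigenbasis d)

/-- The matrix element `V_{kl} = ⟨φ_k, V φ_l⟩`. -/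
def elt (V : H →L[ℂ] H) (k l : Modes d) : ℂ := inner ℂ (E.vec k) (V (E.vec l))

/-- `M_N`, the span of the `|φ_i⟩⟨φ_j|` with `i, j` among the first `N` modes. -/
def matrices (N : ℕ) : Submodule ℂ (H →L[ℂ] H) :=
  Submodule.span ℂ {S | ∃ i ∈ Modes.below d N, ∃ j ∈ Modes.below d N,
    S = InnerProductSpace.rankOne ℂ (E.vec i) (E.vec j)}

/-- The trace of the multiple operator integral,
`Tr T^D_{f^{[n]}}(V₁, …, Vₙ) = ∑ f^{[n]}(λ_{i₁}, …, λ_{iₙ}, λ_{i₁}) (V₁)_{i₁i₂} ⋯ (Vₙ)_{iₙi₁}`,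
a finite sum for `V₁, …, Vₙ ∈ ⋃_K M_K`. -/
def moiTrace (f : ℝ → ℂ) {n : ℕ} (V : Fin (n + 1) → H →L[ℂ] H) : ℂ :=
  ∑ᶠ i : Fin (n + 1) → Modes d,
    divDiff f (List.ofFn fun k => E.val (i k)).reverse (E.val (i 0)) *
      ∏ k, E.elt (V k) (i k) (i (k + 1))

/-- The bracket `⟨V₁, …, Vₙ⟩ = ∑ⱼ Tr T^D_{f^{[n]}}(Vⱼ, …, Vₙ, V₁, …, Vⱼ₋₁)`, the value of the
noncommutative vertex. -/
def bracket (f : ℝ → ℂ) : {n : ℕ} → (Fin n → H →L[ℂ] H) → ℂ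
  | 0, _ => 0
  | n + 1, V => ∑ j : Fin (n + 1), E.moiTrace f fun k => V (j + k)

/-! ### The Gaussian random matrix -/

/-- The coordinates `Re Q_{ij}` (`i ≤ j`) and `Im Q_{ij}` (`i < j`) on the space `H_N` of
self-adjoint elements of `M_N`. -/
abbrev Coord (d : ℕ∞) (N : ℕ) : Type :=
  ({p : Modes.below d N × Modes.below d N // p.1 ≤ p.2} → ℝ) ×
    ({p : Modes.below d N × Modes.below d N // p.1 < p.2} → ℝ)

/-- The matrix elements `Q_{ij}` of the self-adjoint matrix with the given coordinates. -/
def hermEntry {N : ℕ} (c : Coord d N) (i j : Modes.below d N) : ℂ :=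
  if h : i < j then c.1 ⟨(i, j), h.le⟩ + c.2 ⟨(i, j), h⟩ * Complex.I
  else if h' : j < i then c.1 ⟨(j, i), h'.le⟩ - c.2 ⟨(j, i), h'⟩ * Complex.I
  else c.1 ⟨(i, j), not_lt.mp h'⟩

/-- The self-adjoint operator `Q ∈ H_N` with the given coordinates. -/
def herm {N : ℕ} (c : Coord d N) : H →L[ℂ] H :=
  ∑ i : Modes.below d N, ∑ j : Modes.below d N,
    hermEntry c i j • InnerProductSpace.rankOne ℂ (E.vec i) (E.vec j)

/-- The density `exp(-½⟨Q, Q⟩)`. -/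
def weight (f : ℝ → ℂ) {N : ℕ} (c : Coord d N) : ℂ :=
  Complex.exp (-(1 / 2) * E.bracket f ![E.herm c, E.herm c])

/-- The Gaussian mean `∫_{H_N} F(Q) exp(-½⟨Q, Q⟩) dQ / ∫_{H_N} exp(-½⟨Q, Q⟩) dQ`. -/
def gaussMean (f : ℝ → ℂ) (N : ℕ) (F : (H →L[ℂ] H) → ℂ) : ℂ :=
  (∫ c : Coord d N, F (E.herm c) * E.weight f c) / ∫ c : Coord d N, E.weight f c

end SpectralTriple.Eigenbasis

end SpectralTriples

/-! ### Noncommutative Feynman diagrams -/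

section Diagrams

/-- A noncommutative Feynman diagram with `n` external edges marked by `Fin n`. The vertices are
`Fin numVert`; the half-edges at the vertex `v` are the `⟨v, k⟩` with `k : Fin (deg v)`, in the
(clockwise) cyclic order of `Fin (deg v)`. The involution `glue` joins half-edges to internal edges;
its fixed points are the external edges. -/
structure NCDiagram (n : ℕ) where
  numVert : ℕ
  deg : Fin numVert → ℕ
  glue : ((v : Fin numVert) × Fin (deg v)) → ((v : Fin numVert) × Fin (deg v))
  glue_glue : ∀ h, glue (glue h) = h
  ext : Fin n ≃ {h // glue h = h}

namespace NCDiagram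

variable {n : ℕ} (G : NCDiagram n)

/-- The half-edges of a diagram. -/
abbrev HalfEdge : Type := (v : Fin G.numVert) × Fin (G.deg v)

/-- The next half-edge at the same vertex, clockwise. -/
def rot : Equiv.Perm G.HalfEdge := Equiv.sigmaCongrRight fun v => finRotate (G.deg v)

/-- The gluing as a permutation. -/
def gluePerm : Equiv.Perm G.HalfEdge := ⟨G.glue, G.glue, G.glue_glue, G.glue_glue⟩

/-- One step along the boundary of a face: follow the edge (turning back at the end of an external
edge) and take the next half-edge. The faces are the orbits. -/
def faceStep : Equiv.Perm G.HalfEdge := G.rot * G.gluePerm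

/-- The list of internal edges, each represented by one of its two half-edges. -/
def propagators : List G.HalfEdge :=
  ((List.finRange (∑ v, G.deg v)).map finSigmaFinEquiv.symm).filter fun h =>
    finSigmaFinEquiv h < finSigmaFinEquiv (G.glue h)

/-- The number of faces. -/
def numFaces : ℕ := Nat.card (Quotient (Equiv.Perm.SameCycle.setoid G.faceStep))

/-- The loop order `1 - V + E`. -/
def loopOrder : ℤ := 1 - G.numVert + G.propagators.length

/-- The multigraph that is left when the edges in the set `R` of half-edges are removed is
connected. -/
def ConnectedWithout (R : Set G.HalfEdge) : Prop :=
  0 < G.numVert ∧ ∀ v w, Relation.ReflTransGen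
    (fun v w => ∃ h : G.HalfEdge, h ∉ R ∧ h.1 = v ∧ (G.glue h).1 = w) v w

/-- Removing any one internal edge leaves the diagram connected. -/
def OneParticleIrreducible : Prop :=
  ∀ h, G.glue h ≠ h → G.ConnectedWithout {h, G.glue h}

/-- The connected diagrams that can be drawn in the plane with all vertices oriented clockwise,
by Euler's formula `V - E + F = 2`. -/
def Planar : Prop :=
  G.ConnectedWithout ∅ ∧ (G.numVert : ℤ) - G.propagators.length + G.numFaces = 2

/-- There is a face (the inside of the loop) with no external edge. -/
def ExternalOutside : Prop :=
  ∃ h₀ : G.HalfEdge, ∀ i, ¬ G.faceStep.SameCycle h₀ (G.ext i)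

/-- The external edges are marked cyclically: walking along the boundary of the face from the `i`-th
external edge, the first external edge that is met is the one marked by the successor of `i`. -/
def MarkedCyclically : Prop :=
  ∀ i, ∃ m, 0 < m ∧ (G.faceStep ^ m) (G.ext i) = G.ext (finRotate n i) ∧
    ∀ l, 0 < l → l < m → G.glue ((G.faceStep ^ l) (G.ext i)) ≠ (G.faceStep ^ l) (G.ext i)

/-- The planar one-loop one-particle-irreducible diagrams with clockwise vertices of degree at
least three and external edges outside the loop and marked cyclically. -/
structure Relevant : Prop where
  planar : G.Planar
  oneLoop : G.loopOrder = 1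
  irreducible : G.OneParticleIrreducible
  three_le_deg : ∀ v, 3 ≤ G.deg v
  externalOutside : G.ExternalOutside
  markedCyclically : G.MarkedCyclically

/-- Isomorphism of diagrams. -/
def Isomorphic (G G' : NCDiagram n) : Prop :=
  ∃ (v : Fin G.numVert ≃ Fin G'.numVert) (e : G.HalfEdge ≃ G'.HalfEdge),
    (∀ h, (e h).1 = v h.1) ∧ (∀ h, e (G.rot h) = G'.rot (e h)) ∧
    (∀ h, e (G.glue h) = G'.glue (e h)) ∧ ∀ i, e (G.ext i) = G'.ext i

/-- Isomorphism of relevant diagrams, as an equivalence relation. -/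
instance relevantSetoid (n : ℕ) : Setoid {G : NCDiagram n // G.Relevant} where
  r G G' := Isomorphic G.1 G'.1
  iseqv :=
    { refl := fun _ => ⟨Equiv.refl _, Equiv.refl _, by simp⟩
      symm := by
        rintro G G' ⟨v, e, h1, h2, h3, h4⟩
        refine ⟨v.symm, e.symm, fun h => ?_, fun h => ?_, fun h => ?_, fun i => ?_⟩
        · rw [Equiv.eq_symm_apply, ← h1, Equiv.apply_symm_apply]
        · rw [Equiv.symm_apply_eq, h2, Equiv.apply_symm_apply]
        · rw [Equiv.symm_apply_eq, h3, Equiv.apply_symm_apply]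
        · rw [Equiv.symm_apply_eq, h4]
      trans := by
        rintro G G' G'' ⟨v, e, h1, h2, h3, h4⟩ ⟨v', e', h1', h2', h3', h4'⟩
        exact ⟨v.trans v', e.trans e', by simp [h1, h1'], by simp [h2, h2'], by simp [h3, h3'],
          by simp [h4, h4']⟩ }

/-- Isomorphism classes of relevant diagrams with `n` external edges. -/
abbrev RelevantClass (n : ℕ) : Type := Quotient (relevantSetoid n)

end NCDiagram

variable {H : Type*} [NormedAddCommGroup H] [InnerProductSpace ℂ H] [CompleteSpace H]

namespace SpectralTriple.Eigenbasis

variable {T : SpectralTriple H} {d : ℕ∞} (E : T.Eigenbasis d)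

/-- The effect on amplitudes of joining the two external edges `h`, `h'` by a propagator. -/
def contract (f : ℝ → ℂ) (N : ℕ) {X : Type} [DecidableEq X] (h h' : X) (Γ : (X → H →L[ℂ] H) → ℂ) :
    (X → H →L[ℂ] H) → ℂ :=
  fun W => - E.gaussMean f N fun Q => Γ (Function.update (Function.update W h Q) h' Q)

/-- The amplitude `Γ_N^G(V₁, …, Vₙ)`: the disjoint union of the vertices has the product of the
brackets as its amplitude, and then the internal edges are joined one after the other. -/
def amplitude (f : ℝ → ℂ) (N : ℕ) {n : ℕ} (G : NCDiagram n) (V : Fin n → H →L[ℂ] H) : ℂ :=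
  G.propagators.foldr (fun h Γ => E.contract f N h (G.glue h) Γ)
    (fun W => ∏ v, E.bracket f fun k : Fin (G.deg v) => W ⟨v, k⟩)
    (fun h => if hh : G.glue h = h then V (G.ext.symm ⟨h, hh⟩) else 0)

/-- The one-loop bracket `⟨⟨V₁, …, Vₙ⟩⟩_N^{1L}`, the sum of the amplitudes of the relevant diagrams
up to isomorphism. -/
def oneLoopBracket (f : ℝ → ℂ) (N : ℕ) {n : ℕ} (V : Fin n → H →L[ℂ] H) : ℂ :=
  ∑ᶠ G : NCDiagram.RelevantClass n, E.amplitude f N G.out.1 V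

end SpectralTriple.Eigenbasis

/-- `ψ_{2k+1} = φ_{2k+1} - ½ B₀ φ_{2k+2}`. -/
def psi {A : Type*} [Ring A] [Algebra ℂ A] (φ : (n : ℕ) → Cochain A n) (k : ℕ) :
    Cochain A (2 * k + 1) :=
  φ (2 * k + 1) - (1 / 2 : ℂ) • connesB₀ (φ (2 * k + 2))

/-- `ψ̃_{2k+1} = (-1)ᵏ (k! / (2k+1)!) ψ_{2k+1}`. -/
def psiTilde {A : Type*} [Ring A] [Algebra ℂ A] (φ : (n : ℕ) → Cochain A n) (k : ℕ) :
    Cochain A (2 * k + 1) :=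
  ((-1) ^ k * (k.factorial / (2 * k + 1).factorial : ℂ)) • psi φ k

end Diagrams

end NCG

end

/-! Everything is first reduced to finite sums over eigenvalue indices. Cyclic rotation of the
arguments of `moiTrace` only changes which eigenvalue is repeated in `f^{[n]}`, and the sum over all
ways to repeat an argument is a divided difference of `f'` (`sum_divDiffMultiset_cons`). Hence a
vertex of degree `n` carries the symmetric weight `f'[λ_{i₁}, …, λ_{iₙ}]` (`bracket_eq_sum`). The
Gaussian measure is a product measure with covariance `E(Q_{ij} Q_{kl}) = δ_{il} δ_{jk} / f'[λ_i,
λ_j]` (`gaussMean_sum`), so an amplitude is a sum over indices attached to half-edges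
(`amplitude_eq_indexSum`), which depends on the isomorphism class only.

One loop means as many internal edges as vertices. Together with one-particle irreducibility this
forces exactly two internal half-edges at every vertex, and the face without external edges makes
them adjacent. So a relevant diagram is a single cycle of vertices with all legs outside. It is
determined by its cuts, the legs that come first at their vertex (`Relevant.isomorphic`), and every
nonempty set of cuts occurs (`CyclicBlocks.relevant`). This gives finiteness. The one-loop bracket
becomes a sum over the index `a` of the inner face, the indices `x` of the outer face and the set
`S` of cuts, with summand `∏_{s ∈ S} u(x_s) f'[a, x_s, block before s]`, where `u(x) = -1/f'[x, a]`.
Rotation of the legs permutes the sets of cuts, whence cyclicity.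

Since `[D, a]_{ij} = (λ_i - λ_j) a_{ij}`, the Ward identity says that `λ_x - λ_y` times the kernel
at `(x, r, y)`, where `x` and `y` are cyclically adjacent, is the kernel at `(x, r)` minus that at
`(y, r)`. Each of the four choices of cutting or not cutting at `x` and at `y` has a vertex whose
weight contains both, to which the recursion for divided differences applies. The superfluous terms
cancel because `u(x) f'[a, x] = -1`: up to sign the propagator inverts the vertex of degree two
(`markedWeight_ward`).

The last part uses cyclicity and the Ward identity only, and is carried out for an abstract
`CyclicBracket`. The functional `∫ a₀ da₁ ⋯ daₙ = ⟨a₀ δa₁, δa₂, …, δaₙ⟩` satisfies `∫ θ a = ∫ a θ`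
for even `θ`, `∫ θ a = ∫ a θ - ∫ θ da` for odd `θ`, and `∫ θ da = ∫ da θ + ∫ dθ da`. The cocycle
identities are direct consequences. For the expansion, absorbing the copies of `V = π_D(α)` one by
one turns `⟨V, …, V⟩` into integrals of universal forms whose generating series in `t` are `∑ₖ α
F_tᵏ` and `∑ₖ t α F_tᵏ α`, with `F_t = t dα + t² α²`; the factors `1/n` become integration over `t ∈
[0, 1]`. The first series gives Chern–Simons forms. The second is rewritten by the transgression
formula `∫ t α F_tᵏ α = (2(k+1))⁻¹ (d/dt) ∫ F_t^{k+1} - ½ ∫ d(α F_tᵏ)`, which yields the Yang–Mills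
terms and the correction `-½ B₀` in `ψ`. The remainder compares truncation in powers of `t` with
truncation in form degree. -/

open scoped TensorProduct ContDiff

noncomputable section

namespace NCG

/-! ### Divided differences of smooth functions -/

section DividedDifferences

open MeasureTheory Filter Topology

/-- The moments `∫₀¹ tᵏ g(a + t (x - a)) dt`. -/
def segmentMoment (a : ℝ) (k : ℕ) (g : ℝ → ℂ) (x : ℝ) : ℂ :=
  ∫ t in (0 : ℝ)..1, ((t : ℂ) ^ k) * g (a + t * (x - a))

/-- Differentiation under the integral sign produces a moment of the next order of `deriv g`. The
family of all moments is therefore closed under derivatives, which is why the factor `tᵏ` is carried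
along. -/
theorem hasDerivAt_segmentMoment (a : ℝ) (k : ℕ) {g : ℝ → ℂ} (hg : ContDiff ℝ 1 g) (x : ℝ) :
    HasDerivAt (segmentMoment a k g) (segmentMoment a (k + 1) (deriv g) x) x := by
  have hg' : Continuous (deriv g) := hg.continuous_deriv le_rfl
  have hgc : Continuous g := hg.continuous
  have hd : Differentiable ℝ g := hg.differentiable (by simp)
  -- Compactness of a ball times the unit interval provides the constant that dominates the
  -- differentiated integrand.
  have hcont : Continuous fun p : ℝ × ℝ =>
      ‖((p.2 : ℂ) ^ (k + 1)) * deriv g (a + p.2 * (p.1 - a))‖ := by fun_prop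
  obtain ⟨C, hC⟩ := ((isCompact_closedBall x 1).prod (isCompact_Icc (a := (0 : ℝ)) (b := 1))
    |>.bddAbove_image hcont.continuousOn)
  refine (intervalIntegral.hasDerivAt_integral_of_dominated_loc_of_deriv_le
    (F := fun y t => ((t : ℂ) ^ k) * g (a + t * (y - a)))
    (F' := fun y t => ((t : ℂ) ^ (k + 1)) * deriv g (a + t * (y - a)))
    (bound := fun _ => C) (Metric.closedBall_mem_nhds x one_pos) ?_ ?_ ?_ ?_ ?_ ?_).2
  · exact Eventually.of_forall fun y => (by fun_prop : Continuous fun t : ℝ =>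
      ((t : ℂ) ^ k) * g (a + t * (y - a))).aestronglyMeasurable
  · exact (by fun_prop : Continuous fun t : ℝ =>
      ((t : ℂ) ^ k) * g (a + t * (x - a))).intervalIntegrable _ _
  · exact (by fun_prop : Continuous fun t : ℝ =>
      ((t : ℂ) ^ (k + 1)) * deriv g (a + t * (x - a))).aestronglyMeasurable
  · refine Eventually.of_forall fun t ht y hy => hC ⟨(y, t), ⟨hy, ?_⟩, rfl⟩
    rw [Set.uIoc_of_le zero_le_one] at ht
    exact ⟨ht.1.le, ht.2⟩
  · exact intervalIntegrable_const
  · refine Eventually.of_forall fun t _ y _ => ?_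
    have h1 : HasDerivAt (fun y : ℝ => a + t * (y - a)) t y := by
      simpa using (((hasDerivAt_id y).sub_const a).const_mul t).const_add a
    have h2 := ((hd (a + t * (y - a))).hasDerivAt.scomp y h1).const_mul ((t : ℂ) ^ k)
    rw [show ((t : ℂ) ^ k) * t • deriv g (a + t * (y - a))
      = ((t : ℂ) ^ (k + 1)) * deriv g (a + t * (y - a)) by rw [Complex.real_smul]; ring] at h2
    exact h2

theorem contDiff_segmentMoment (a : ℝ) (n : ℕ) : ∀ (k : ℕ) {g : ℝ → ℂ}, ContDiff ℝ ∞ g →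
    ContDiff ℝ n (segmentMoment a k g) := by
  induction n with
  | zero =>
    intro k g hg
    refine contDiff_zero.mpr (continuous_iff_continuousAt.mpr fun x => ?_)
    exact (hasDerivAt_segmentMoment a k (hg.of_le (by norm_cast)) x).continuousAt
  | succ n ih =>
    intro k g hg
    have h1 : ContDiff ℝ 1 g := hg.of_le (by norm_cast)
    push_cast
    rw [contDiff_succ_iff_deriv]
    refine ⟨fun x => (hasDerivAt_segmentMoment a k h1 x).differentiableAt, by simp, ?_⟩
    rw [show deriv (segmentMoment a k g) = segmentMoment a (k + 1) (deriv g) from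
      funext fun x => (hasDerivAt_segmentMoment a k h1 x).deriv]
    exact ih (k + 1) (contDiff_infty_iff_deriv.mp hg).2

/-- The fundamental theorem of calculus along the segment from `a` to `x`. The integral stays smooth
across the coincidence `x = a`, where the quotient is not visibly so. -/
theorem dslope_eq_segmentMoment {f : ℝ → ℂ} (hf : ContDiff ℝ 1 f) (a : ℝ) :
    dslope f a = segmentMoment a 0 (deriv f) := by
  have hd : Differentiable ℝ f := hf.differentiable (by simp)
  have hf' : Continuous (deriv f) := hf.continuous_deriv le_rfl
  funext x
  rcases eq_or_ne x a with rfl | hx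
  · simp [segmentMoment]
  · have h : ∫ t in (0 : ℝ)..1, (x - a) • deriv f (a + t * (x - a)) = f x - f a := by
      have := intervalIntegral.integral_eq_sub_of_hasDerivAt (a := 0) (b := 1)
        (f := fun t : ℝ => f (a + t * (x - a)))
        (f' := fun t => (x - a) • deriv f (a + t * (x - a))) (fun t _ => ?_)
        ((by fun_prop : Continuous fun t : ℝ =>
          (x - a) • deriv f (a + t * (x - a))).intervalIntegrable _ _)
      · simpa using this
      · have h1 : HasDerivAt (fun t : ℝ => a + t * (x - a)) (x - a) t := by
          simpa using ((hasDerivAt_id t).mul_const (x - a)).const_add a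
        exact (hd (a + t * (x - a))).hasDerivAt.scomp t h1
    rw [intervalIntegral.integral_smul] at h
    rw [dslope_of_ne _ hx, slope_def_module, ← h, smul_smul,
      inv_mul_cancel₀ (sub_ne_zero.mpr hx), one_smul]
    simp [segmentMoment]

theorem contDiff_dslope {f : ℝ → ℂ} (hf : ContDiff ℝ ∞ f) (a : ℝ) :
    ContDiff ℝ ∞ (dslope f a) := by
  rw [dslope_eq_segmentMoment (hf.of_le (by norm_cast)) a, contDiff_infty]
  exact fun n => contDiff_segmentMoment a n 0 (contDiff_infty_iff_deriv.mp hf).2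

theorem contDiff_divDiff {f : ℝ → ℂ} (hf : ContDiff ℝ ∞ f) : ∀ l, ContDiff ℝ ∞ (divDiff f l)
  | [] => hf
  | y :: l => contDiff_dslope (contDiff_divDiff hf l) y

theorem dslope_symm (f : ℝ → ℂ) (x y : ℝ) : dslope f x y = dslope f y x := by
  rcases eq_or_ne x y with rfl | h
  · rfl
  · rw [dslope_of_ne _ h, dslope_of_ne _ h.symm, slope_comm]

theorem deriv_dslope_of_ne {f : ℝ → ℂ} (hf : Differentiable ℝ f) {x y : ℝ} (h : x ≠ y) :
    deriv (dslope f y) x = (x - y : ℂ)⁻¹ * (deriv f x - dslope f y x) := by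
  have hxy : (x - y : ℂ) ≠ 0 := by exact_mod_cast sub_ne_zero.mpr h
  have h1 : HasDerivAt (dslope f y) (deriv (dslope f y) x) x :=
    ((differentiableAt_dslope_of_ne h).mpr (hf x)).hasDerivAt
  have h2 : HasDerivAt (fun z : ℝ => (z - y) • dslope f y z)
      ((x - y) • deriv (dslope f y) x + (1 : ℝ) • dslope f y x) x :=
    ((hasDerivAt_id x).sub_const y).smul h1
  have h3 : (fun z : ℝ => (z - y) • dslope f y z) = fun z => f z - f y :=
    funext fun z => sub_smul_dslope f y z
  rw [h3] at h2
  have h4 := h2.unique ((hf x).hasDerivAt.sub_const (f y))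
  rw [← h4, Complex.real_smul, one_smul, add_sub_cancel_right]
  push_cast
  rw [inv_mul_cancel_left₀ hxy]

/-- For three distinct points this is algebra. At coincidences a derivative of a slope has to be
compared with a slope of slopes. -/
theorem dslope_dslope_comm {f : ℝ → ℂ} (hf : Differentiable ℝ f) (x y z : ℝ) :
    dslope (dslope f x) y z = dslope (dslope f y) x z := by
  rcases eq_or_ne x y with rfl | hxy
  · rfl
  have key : ∀ {x y : ℝ}, x ≠ y → dslope (dslope f x) y x = dslope (dslope f y) x x := by
    intro x y hxy
    rw [dslope_same, deriv_dslope_of_ne hf hxy, dslope_of_ne _ hxy, slope_def_module, dslope_same,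
      dslope_symm f x y, Complex.real_smul]
    push_cast
    rfl
  rcases eq_or_ne z x with rfl | hzx
  · exact key hxy
  rcases eq_or_ne z y with rfl | hzy
  · exact (key hxy.symm).symm
  have h1 : (x - y : ℂ) ≠ 0 := by exact_mod_cast sub_ne_zero.mpr hxy
  have h2 : (z - x : ℂ) ≠ 0 := by exact_mod_cast sub_ne_zero.mpr hzx
  have h3 : (z - y : ℂ) ≠ 0 := by exact_mod_cast sub_ne_zero.mpr hzy
  have h4 : (y - x : ℂ) ≠ 0 := by exact_mod_cast sub_ne_zero.mpr hxy.symm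
  rw [dslope_of_ne _ hzy, dslope_of_ne _ hzx, slope_def_module, slope_def_module,
    dslope_of_ne _ hzx, dslope_of_ne _ hzy, dslope_of_ne _ hxy, dslope_of_ne _ hxy.symm]
  simp only [slope_def_module, Complex.real_smul]
  push_cast
  field_simp
  ring

theorem divDiff_perm {f : ℝ → ℂ} (hf : ContDiff ℝ ∞ f) {l l' : List ℝ} (h : l.Perm l') :
    divDiff f l = divDiff f l' := by
  induction h with
  | nil => rfl
  | cons x _ ih => funext z; simp only [divDiff, ih]
  | swap x y l =>
    funext z
    simp only [divDiff]
    exact dslope_dslope_comm ((contDiff_divDiff hf l).differentiable (by simp)) _ _ _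
  | trans _ _ ih1 ih2 => exact ih1.trans ih2

theorem divDiff_swap (f : ℝ → ℂ) (l : List ℝ) (x y : ℝ) :
    divDiff f (x :: l) y = divDiff f (y :: l) x := dslope_symm _ _ _

/-- The divided difference as a function of the multiset of its arguments; it is zero for the
empty multiset. -/
def divDiffMultiset (f : ℝ → ℂ) (s : Multiset ℝ) : ℂ :=
  match s.toList with
  | [] => 0
  | x :: l => divDiff f l x

@[simp] theorem divDiffMultiset_zero (f : ℝ → ℂ) : divDiffMultiset f 0 = 0 := by
  simp [divDiffMultiset]

theorem divDiff_eq_of_perm {f : ℝ → ℂ} (hf : ContDiff ℝ ∞ f) {x y : ℝ} {l l' : List ℝ}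
    (h : (x :: l).Perm (y :: l')) : divDiff f l x = divDiff f l' y := by
  rcases eq_or_ne x y with rfl | hxy
  · rw [divDiff_perm hf (List.perm_cons x |>.mp h)]
  have hy : y ∈ l := by
    have : y ∈ x :: l := h.symm.subset (by simp)
    simpa [hxy.symm] using this
  have h1 : l.Perm (y :: l.erase y) := List.perm_cons_erase hy
  have h2 : (x :: l.erase y).Perm l' := by
    have h3 := ((h1.cons x).symm.trans h)
    exact List.perm_cons y |>.mp ((List.Perm.swap x y _).trans h3)
  rw [divDiff_perm hf h1, ← divDiff_perm hf h2, divDiff_swap]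

theorem divDiffMultiset_coe_cons {f : ℝ → ℂ} (hf : ContDiff ℝ ∞ f) (x : ℝ) (l : List ℝ) :
    divDiffMultiset f (x ::ₘ (l : Multiset ℝ)) = divDiff f l x := by
  have hp : (x ::ₘ (l : Multiset ℝ)).toList.Perm (x :: l) := by
    rw [← Multiset.coe_eq_coe, Multiset.coe_toList, Multiset.cons_coe]
  unfold divDiffMultiset
  split
  · rename_i h; rw [h] at hp; exact absurd hp.length_eq (by simp)
  · rename_i y l' h
    rw [h] at hp
    exact divDiff_eq_of_perm hf hp

/-- The recursion for divided differences. -/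
theorem sub_mul_divDiffMultiset {f : ℝ → ℂ} (hf : ContDiff ℝ ∞ f) (x y : ℝ) (s : Multiset ℝ) :
    (x - y : ℂ) * divDiffMultiset f (x ::ₘ y ::ₘ s)
      = divDiffMultiset f (x ::ₘ s) - divDiffMultiset f (y ::ₘ s) := by
  obtain ⟨l, rfl⟩ : ∃ l : List ℝ, s = l := ⟨s.toList, (Multiset.coe_toList s).symm⟩
  rw [divDiffMultiset_coe_cons hf x, divDiffMultiset_coe_cons hf y, Multiset.cons_coe,
    divDiffMultiset_coe_cons hf]
  have := sub_smul_dslope (divDiff f l) y x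
  rw [Complex.real_smul] at this
  exact_mod_cast this

/-- The repeated argument is changed one copy at a time, passing through the divided difference with
the arguments `x`, `y` and `l`. -/
theorem deriv_divDiff_sub {f : ℝ → ℂ} (hf : ContDiff ℝ ∞ f) (l : List ℝ) (x y : ℝ) :
    divDiff f (x :: l) x - divDiff f (y :: l) y
      = (x - y : ℂ) * (divDiff f (y :: y :: l) x + divDiff f (x :: y :: l) x) := by
  have h1 := sub_smul_dslope (divDiff f (y :: l)) y x
  have h2 := sub_smul_dslope (divDiff f (x :: l)) y x
  rw [Complex.real_smul] at h1 h2
  push_cast at h1 h2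
  have h3 : divDiff f (x :: y :: l) x = dslope (divDiff f (x :: l)) y x :=
    congrFun (divDiff_perm hf (List.Perm.swap y x l)) x
  rw [mul_add, h3, h2]
  change _ = (x - y : ℂ) * dslope (divDiff f (y :: l)) y x + _
  rw [h1, divDiff_swap f l x y]
  ring

/-- The divided differences of the derivative. -/
theorem divDiff_deriv {f : ℝ → ℂ} (hf : ContDiff ℝ ∞ f) (l : List ℝ) (x : ℝ) :
    (l.map fun y => divDiff f (y :: l) x).sum + divDiff f (x :: l) x = divDiff (deriv f) l x := by
  have hf' := (contDiff_infty_iff_deriv.mp hf).2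
  induction l generalizing x with
  | nil => simp [divDiff]
  | cons y l ih =>
    -- The recursion only determines the value at `x` up to the factor `x - y`. Both sides are
    -- continuous in `x`, so it suffices to argue on the dense set `x ≠ y`.
    have hcL : Continuous fun x => ((y :: l).map fun z => divDiff f (z :: y :: l) x).sum
        + divDiff f (x :: y :: l) x := by
      have hs : ∀ m : List ℝ, Continuous fun x =>
          (m.map fun z => divDiff f (z :: y :: l) x).sum := by
        intro m
        induction m with
        | nil => simpa using continuous_const
        | cons z m ihm =>
          simp only [List.map_cons, List.sum_cons]
          exact (contDiff_divDiff hf _).continuous.add ihm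
      refine (hs _).add ?_
      have : (fun x => divDiff f (x :: y :: l) x) = deriv (divDiff f (y :: l)) :=
        funext fun x => dslope_same _ _
      rw [this]
      exact (contDiff_infty_iff_deriv.mp (contDiff_divDiff hf (y :: l))).2.continuous
    have hcR := (contDiff_divDiff hf' (y :: l)).continuous
    refine congrFun (Continuous.ext_on (dense_compl_singleton y) hcL hcR fun x hx => ?_) x
    have hx' : x ≠ y := hx
    have hxy : (x - y : ℂ) ≠ 0 := by exact_mod_cast sub_ne_zero.mpr hx'
    refine mul_left_cancel₀ hxy ?_
    have h1 := sub_smul_dslope (divDiff (deriv f) l) y x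
    rw [Complex.real_smul] at h1
    push_cast at h1
    change _ = (x - y : ℂ) * dslope (divDiff (deriv f) l) y x
    rw [h1, ← ih x, ← ih y]
    have h2 : (l.map fun z => divDiff f (z :: l) x).sum - (l.map fun z => divDiff f (z :: l) y).sum
        = (x - y : ℂ) * (l.map fun z => divDiff f (z :: y :: l) x).sum := by
      have : ∀ m : List ℝ, (m.map fun z => divDiff f (z :: l) x).sum
          - (m.map fun z => divDiff f (z :: l) y).sum
        = (x - y : ℂ) * (m.map fun z => divDiff f (z :: y :: l) x).sum := by
        intro m
        induction m with
        | nil => simp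
        | cons z m ihm =>
          simp only [List.map_cons, List.sum_cons]
          rw [mul_add, ← ihm]
          have h3 := sub_smul_dslope (divDiff f (z :: l)) y x
          rw [Complex.real_smul] at h3
          push_cast at h3
          have h4 : divDiff f (z :: y :: l) x = dslope (divDiff f (z :: l)) y x :=
            congrFun (divDiff_perm hf (List.Perm.swap y z l)) x
          rw [h4, h3]
          ring
      exact this l
    have h3 := deriv_divDiff_sub hf l x y
    simp only [List.map_cons, List.sum_cons]
    linear_combination -h2 - h3

/-- The `j`-th rotation in the bracket repeats the `j`-th eigenvalue. This identity sums over the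
rotations, and afterwards only `f'` occurs. -/
theorem sum_divDiffMultiset_cons {f : ℝ → ℂ} (hf : ContDiff ℝ ∞ f) (s : Multiset ℝ) :
    (s.map fun x => divDiffMultiset f (x ::ₘ s)).sum = divDiffMultiset (deriv f) s := by
  have hf' := (contDiff_infty_iff_deriv.mp hf).2
  obtain ⟨l, rfl⟩ : ∃ l : List ℝ, s = l := ⟨s.toList, (Multiset.coe_toList s).symm⟩
  cases l with
  | nil => simp
  | cons x l =>
    rw [← Multiset.cons_coe, divDiffMultiset_coe_cons hf', ← divDiff_deriv hf]
    simp only [Multiset.cons_coe, Multiset.map_coe, Multiset.sum_coe, List.map_cons, List.sum_cons]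
    rw [← Multiset.cons_coe, divDiffMultiset_coe_cons hf, add_comm]
    congr 2
    refine List.map_congr_left fun y _ => ?_
    rw [← Multiset.cons_coe, divDiffMultiset_coe_cons hf, divDiff_swap]

end DividedDifferences

/-! ### The bracket as a finite sum -/

section FiniteBracket

variable {H : Type*} [NormedAddCommGroup H] [InnerProductSpace ℂ H] [CompleteSpace H]

namespace SpectralTriple.Eigenbasis

variable {T : SpectralTriple H} {d : ℕ∞} (E : T.Eigenbasis d)

/-- Matrix elements as a linear map. -/
def eltₗ (k l : Modes d) : (H →L[ℂ] H) →ₗ[ℂ] ℂ where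
  toFun V := E.elt V k l
  map_add' V W := by simp [elt]
  map_smul' c V := by simp [elt]

theorem eltₗ_apply (V : H →L[ℂ] H) (k l : Modes d) : E.eltₗ k l V = E.elt V k l := rfl

theorem elt_rankOne (i j k l : Modes d) :
    E.elt (InnerProductSpace.rankOne ℂ (E.vec i) (E.vec j)) k l
      = if k = i ∧ j = l then 1 else 0 := by
  have h := orthonormal_iff_ite.mp E.vec.orthonormal
  simp only [elt, InnerProductSpace.rankOne_apply, inner_smul_right, h]
  split_ifs <;> simp_all

theorem elt_eq_zero_of_mem {K : ℕ} {V : H →L[ℂ] H} (hV : V ∈ E.matrices K) {k l : Modes d}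
    (h : k ∉ Modes.below d K ∨ l ∉ Modes.below d K) : E.elt V k l = 0 := by
  suffices hs : E.matrices K ≤ LinearMap.ker (E.eltₗ k l) from hs hV
  rw [matrices, Submodule.span_le]
  rintro _ ⟨i, hi, j, hj, rfl⟩
  simp only [SetLike.mem_coe, LinearMap.mem_ker, eltₗ_apply, elt_rankOne]
  rw [if_neg]
  rintro ⟨rfl, rfl⟩
  tauto

theorem below_mono {N K : ℕ} (h : N ≤ K) : Modes.below d N ⊆ Modes.below d K := by
  intro i hi
  simp only [Modes.below, Finset.mem_subtype, Finset.mem_range] at hi ⊢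
  omega

theorem matrices_mono {N K : ℕ} (h : N ≤ K) : E.matrices N ≤ E.matrices K := by
  refine Submodule.span_mono ?_
  rintro _ ⟨i, hi, j, hj, rfl⟩
  exact ⟨i, below_mono h hi, j, below_mono h hj, rfl⟩

theorem herm_mem {N : ℕ} (c : Coord d N) : E.herm c ∈ E.matrices N :=
  Submodule.sum_mem _ fun i _ => Submodule.sum_mem _ fun j _ => Submodule.smul_mem _ _
    (Submodule.subset_span ⟨i, i.2, j, j.2, rfl⟩)

theorem elt_herm {N : ℕ} (c : Coord d N) (i j : Modes.below d N) :
    E.elt (E.herm c) i j = hermEntry c i j := by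
  rw [← eltₗ_apply, herm]
  simp only [map_sum, map_smul, eltₗ_apply, elt_rankOne]
  rw [Finset.sum_eq_single i, Finset.sum_eq_single j]
  · simp
  · intro b _ hb
    have : ¬ ((i : Modes d) = i ∧ (b : Modes d) = j) := fun h => hb (Subtype.ext h.2)
    rw [if_neg this, smul_zero]
  · simp
  · intro b _ hb
    refine Finset.sum_eq_zero fun x _ => ?_
    have : ¬ ((i : Modes d) = b) := fun h => hb (Subtype.ext h.symm)
    simp [this]
  · simp

/-- Operators, all of which (or, if there are at least two, all but one of which) lie in `M_K`. -/
def Tame (K : ℕ) {n : ℕ} (V : Fin n → H →L[ℂ] H) : Prop :=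
  (∀ k, V k ∈ E.matrices K) ∨ (2 ≤ n ∧ ∃ k₀, ∀ k, k ≠ k₀ → V k ∈ E.matrices K)

/-- Every index is the row index of one factor and the column index of the preceding one. With at
least two factors these are different, so one of the two operators lies in `M_K` even if the other
is the exceptional one. -/
theorem Tame.prod_eq_zero {K n : ℕ} {V : Fin n → H →L[ℂ] H} (hV : E.Tame K V)
    {i : Fin n → Modes d} {k : Fin n} (hk : i k ∉ Modes.below d K) :
    ∏ k, E.elt (V k) (i k) (i (finRotate n k)) = 0 := by
  rcases hV with hV | ⟨hn, k₀, hV⟩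
  · exact Finset.prod_eq_zero (Finset.mem_univ k) (E.elt_eq_zero_of_mem (hV k) (Or.inl hk))
  · by_cases h : k = k₀
    · subst h
      have h1 : (finRotate n).symm k ≠ k := by
        intro h
        rw [Equiv.symm_apply_eq] at h
        obtain ⟨m, rfl⟩ : ∃ m, n = m + 1 := ⟨n - 1, by omega⟩
        rw [finRotate_apply] at h
        have h2 : (1 : Fin (m + 1)) = 0 := by simpa using h.symm
        have : m ≠ 0 := by omega
        rw [Fin.ext_iff, Fin.val_one', Fin.val_zero, Nat.mod_eq_of_lt (by omega)] at h2
        omega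
      refine Finset.prod_eq_zero (Finset.mem_univ ((finRotate n).symm k))
        (E.elt_eq_zero_of_mem (hV _ h1) (Or.inr ?_))
      rwa [Equiv.apply_symm_apply]
    · exact Finset.prod_eq_zero (Finset.mem_univ k) (E.elt_eq_zero_of_mem (hV k h) (Or.inl hk))

/-- The weight `f'[λ_{i₁}, …, λ_{iₙ}]` of the noncommutative vertex. -/
def vertexWeight (f : ℝ → ℂ) {ι : Type*} (v : ι → ℝ) (s : Multiset ι) : ℂ :=
  divDiffMultiset (deriv f) (s.map v)

theorem bracket_eq_sum {f : ℝ → ℂ} (hf : ContDiff ℝ ∞ f) (K : ℕ) {n : ℕ}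
    {V : Fin n → H →L[ℂ] H} (hV : E.Tame K V) :
    E.bracket f V = ∑ i : Fin n → Modes.below d K,
      vertexWeight f (fun k : Modes.below d K => E.val k) (Finset.univ.val.map i) *
        ∏ k, E.elt (V k) (i k) (i (finRotate n k)) := by
  cases n with
  | zero => simp [bracket, vertexWeight]
  | succ n =>
    -- Renaming the summation indices undoes the rotation by `j`; its only trace is that `E.val (i
    -- j)` is the repeated eigenvalue.
    have h1 : ∀ j : Fin (n + 1), E.moiTrace f (fun k => V (j + k))
        = ∑ i : Fin (n + 1) → Modes.below d K,
          divDiffMultiset f (E.val (i j) ::ₘ Finset.univ.val.map fun k => E.val (i k)) *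
            ∏ k, E.elt (V k) (i k) (i (finRotate _ k)) := by
      intro j
      set S : (Fin (n + 1) → Modes d) → ℂ := fun i =>
        divDiffMultiset f (E.val (i j) ::ₘ Finset.univ.val.map fun k => E.val (i k)) *
            ∏ k, E.elt (V k) (i k) (i (finRotate _ k)) with hS
      have h2 : E.moiTrace f (fun k => V (j + k)) = ∑ᶠ i, S i := by
        rw [moiTrace, ← finsum_comp_equiv (Equiv.arrowCongr (Equiv.addLeft (-j)) (Equiv.refl _))]
        refine finsum_congr fun i => ?_
        simp only [Equiv.arrowCongr_apply, Equiv.coe_refl, Function.comp_apply, id_eq,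
          Equiv.addLeft_symm, neg_neg, Equiv.coe_addLeft, add_zero, hS]
        congr 1
        · rw [← divDiffMultiset_coe_cons hf]
          congr 2
          rw [← Multiset.coe_reverse, List.reverse_reverse, List.ofFn_eq_map, ← Multiset.map_coe]
          change Multiset.map _ (Finset.univ : Finset (Fin (n + 1))).val = _
          have : (Finset.univ : Finset (Fin (n + 1))).val
              = Finset.univ.val.map (fun k => j + k) := by
            have h := congrArg Finset.val (Finset.map_univ_equiv (Equiv.addLeft j))
            rw [Finset.map_val] at h
            exact h.symm
          conv_rhs => rw [this]
          rw [Multiset.map_map]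
          rfl
        · refine Fintype.prod_equiv (Equiv.addLeft j) _ _ fun k => ?_
          simp [add_assoc]
      rw [h2]
      set e : (Fin (n + 1) → Modes.below d K) ↪ (Fin (n + 1) → Modes d) :=
        ⟨fun i k => i k, fun a b h => funext fun k => Subtype.ext (congrFun h k)⟩
      rw [finsum_eq_sum_of_support_subset (s := Finset.univ.map e), Finset.sum_map]
      · rfl
      · intro i hi
        rw [Finset.coe_map]
        by_cases h : ∀ k, i k ∈ Modes.below d K
        · exact ⟨fun k => ⟨i k, h k⟩, by simp, rfl⟩
        · push Not at h
          obtain ⟨k, hk⟩ := h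
          exact absurd (by simp only [hS, Tame.prod_eq_zero E hV hk, mul_zero]) hi
    simp only [bracket, h1]
    rw [Finset.sum_comm]
    refine Finset.sum_congr rfl fun i _ => ?_
    rw [← Finset.sum_mul, vertexWeight, ← sum_divDiffMultiset_cons hf]
    simp only [Multiset.map_map, Function.comp_def]
    rfl

end SpectralTriple.Eigenbasis

end FiniteBracket

/-! ### Gaussian moments -/

section GaussianMoments

open MeasureTheory Real

theorem integrable_pow_mul_exp_neg_mul_sq {b : ℝ} (hb : 0 < b) (k : ℕ) :
    Integrable fun x : ℝ => x ^ k * exp (-b * x ^ 2) := by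
  simpa using integrable_rpow_mul_exp_neg_mul_sq hb
    (s := k) (by have : (0 : ℝ) ≤ k := k.cast_nonneg; linarith)

theorem hasDerivAt_exp_neg_mul_sq (b x : ℝ) :
    HasDerivAt (fun x => exp (-b * x ^ 2)) (-2 * b * (x * exp (-b * x ^ 2))) x := by
  have h := (((hasDerivAt_id x).pow 2).const_mul (-b)).exp
  simp only [id, Pi.pow_apply] at h
  convert h using 1
  simp
  ring

theorem integral_mul_exp_neg_mul_sq_eq_zero {b : ℝ} (hb : 0 < b) :
    ∫ x : ℝ, x * exp (-b * x ^ 2) = 0 := by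
  have h := integral_eq_zero_of_hasDerivAt_of_integrable (hasDerivAt_exp_neg_mul_sq b)
    ((integrable_mul_exp_neg_mul_sq hb).const_mul _) (integrable_exp_neg_mul_sq hb)
  rw [integral_const_mul] at h
  simpa [hb.ne'] using h

/-- Integration by parts: the derivative of `x * exp (-b * x ^ 2)` integrates to zero. -/
theorem integral_sq_mul_exp_neg_mul_sq {b : ℝ} (hb : 0 < b) :
    ∫ x : ℝ, x ^ 2 * exp (-b * x ^ 2) = (2 * b)⁻¹ * ∫ x : ℝ, exp (-b * x ^ 2) := by
  have h0 := integrable_exp_neg_mul_sq hb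
  have h2 := (integrable_pow_mul_exp_neg_mul_sq hb 2).const_mul (-2 * b)
  have h := integral_eq_zero_of_hasDerivAt_of_integrable
    (f := fun x : ℝ => x * exp (-b * x ^ 2))
    (f' := fun x => exp (-b * x ^ 2) + -2 * b * (x ^ 2 * exp (-b * x ^ 2))) (fun x => ?_)
    (h0.add h2) (integrable_mul_exp_neg_mul_sq hb)
  · rw [integral_add h0 h2, integral_const_mul] at h
    rw [eq_inv_mul_iff_mul_eq₀ (by positivity)]
    linarith
  · have h3 := (hasDerivAt_id x).mul (hasDerivAt_exp_neg_mul_sq b x)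
    exact h3.congr_deriv (by simp only [id]; ring)

variable {ι : Type*} [Fintype ι]

/-- The density of a product of centred Gaussians. -/
def gaussDensity (w : ι → ℝ) (x : ι → ℝ) : ℝ := ∏ s, exp (-w s * x s ^ 2)

/-- Puts the integrand into product form, so that integrals factor over the coordinates. Adding the
two `Pi.single` exponents treats `s = t` and `s ≠ t` together. -/
theorem mul_mul_gaussDensity [DecidableEq ι] (w : ι → ℝ) (s t : ι) (x : ι → ℝ) :
    x s * x t * gaussDensity w x
      = ∏ i, x i ^ ((Pi.single s 1 : ι → ℕ) i + (Pi.single t 1 : ι → ℕ) i)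
        * exp (-w i * x i ^ 2) := by
  rw [Finset.prod_mul_distrib]
  simp only [pow_add, Finset.prod_mul_distrib, Pi.single_apply, pow_ite, pow_one, pow_zero]
  simp [gaussDensity]

theorem integrable_mul_mul_gaussDensity {w : ι → ℝ} (hw : ∀ s, 0 < w s) (s t : ι) :
    Integrable fun x : ι → ℝ => x s * x t * gaussDensity w x := by
  classical
  simp only [mul_mul_gaussDensity]
  exact Integrable.fintype_prod (f := fun i (y : ℝ) =>
    y ^ ((Pi.single s 1 : ι → ℕ) i + (Pi.single t 1 : ι → ℕ) i) * exp (-w i * y ^ 2))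
    fun i => integrable_pow_mul_exp_neg_mul_sq (hw i) _

theorem integral_gaussDensity_pos {w : ι → ℝ} (hw : ∀ s, 0 < w s) :
    0 < ∫ x : ι → ℝ, gaussDensity w x := by
  have := integral_fintype_prod_volume_eq_prod (ι := ι) (𝕜 := ℝ)
    (fun i (y : ℝ) => exp (-w i * y ^ 2))
  rw [show (∫ x : ι → ℝ, gaussDensity w x) = ∏ i, ∫ y : ℝ, exp (-w i * y ^ 2) from this]
  refine Finset.prod_pos fun i _ => ?_
  rw [integral_gaussian]
  exact sqrt_pos.mpr (div_pos pi_pos (hw i))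

theorem integral_mul_mul_gaussDensity [DecidableEq ι] {w : ι → ℝ} (hw : ∀ s, 0 < w s) (s t : ι) :
    ∫ x : ι → ℝ, x s * x t * gaussDensity w x
      = (if s = t then (2 * w s)⁻¹ else 0) * ∫ x : ι → ℝ, gaussDensity w x := by
  simp only [mul_mul_gaussDensity]
  rw [integral_fintype_prod_volume_eq_prod (ι := ι) (𝕜 := ℝ) (fun i (y : ℝ) =>
    y ^ ((Pi.single s 1 : ι → ℕ) i + (Pi.single t 1 : ι → ℕ) i) * exp (-w i * y ^ 2))]
  have h0 : (∫ x : ι → ℝ, gaussDensity w x) = ∏ i, ∫ y : ℝ, exp (-w i * y ^ 2) :=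
    integral_fintype_prod_volume_eq_prod (ι := ι) (𝕜 := ℝ) (fun i (y : ℝ) => exp (-w i * y ^ 2))
  rw [h0]
  split_ifs with h
  · subst h
    rw [← Finset.mul_prod_erase _ _ (Finset.mem_univ s),
      ← Finset.mul_prod_erase Finset.univ (fun i => ∫ y : ℝ, exp (-w i * y ^ 2))
        (Finset.mem_univ s), ← mul_assoc]
    congr 1
    · simpa using integral_sq_mul_exp_neg_mul_sq (hw s)
    · refine Finset.prod_congr rfl fun i hi => ?_
      simp [(Finset.ne_of_mem_erase hi)]
  · rw [zero_mul]
    refine Finset.prod_eq_zero (Finset.mem_univ s) ?_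
    simpa [h] using integral_mul_exp_neg_mul_sq_eq_zero (hw s)

/-- The mean of a product of two linear forms. -/
theorem integral_linear_mul_linear [DecidableEq ι] {w : ι → ℝ} (hw : ∀ s, 0 < w s) (α β : ι → ℂ) :
    Integrable (fun x : ι → ℝ => (∑ s, α s * x s) * (∑ t, β t * x t) * (gaussDensity w x : ℂ)) ∧
    ∫ x : ι → ℝ, (∑ s, α s * x s) * (∑ t, β t * x t) * (gaussDensity w x : ℂ)
      = (∑ s, α s * β s * (2 * w s : ℂ)⁻¹) * ∫ x : ι → ℝ, (gaussDensity w x : ℂ) := by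
  have h1 : ∀ x : ι → ℝ, (∑ s, α s * x s) * (∑ t, β t * x t) * (gaussDensity w x : ℂ)
      = ∑ s, ∑ t, α s * β t * ((x s * x t * gaussDensity w x : ℝ) : ℂ) := by
    intro x
    rw [Finset.sum_mul_sum, Finset.sum_mul]
    refine Finset.sum_congr rfl fun s _ => ?_
    rw [Finset.sum_mul]
    refine Finset.sum_congr rfl fun t _ => ?_
    push_cast
    ring
  have h2 : ∀ s t, Integrable fun x : ι → ℝ =>
      α s * β t * ((x s * x t * gaussDensity w x : ℝ) : ℂ) := fun s t =>
    ((integrable_mul_mul_gaussDensity hw s t).ofReal).const_mul _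
  simp only [h1]
  refine ⟨integrable_finsetSum _ fun s _ => integrable_finsetSum _ fun t _ => h2 s t, ?_⟩
  rw [integral_finsetSum _ fun s _ => integrable_finsetSum _ fun t _ => h2 s t, Finset.sum_mul]
  refine Finset.sum_congr rfl fun s _ => ?_
  rw [integral_finsetSum _ fun t _ => h2 s t, Finset.sum_eq_single s]
  · rw [integral_const_mul, integral_complex_ofReal, integral_mul_mul_gaussDensity hw, if_pos rfl,
      integral_complex_ofReal]
    push_cast
    ring
  · intro t _ ht
    rw [integral_const_mul, integral_complex_ofReal, integral_mul_mul_gaussDensity hw, if_neg ht.symm]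
    simp
  · simp

end GaussianMoments

/-! ### The propagator -/

section Propagator

open MeasureTheory

variable {H : Type*} [NormedAddCommGroup H] [InnerProductSpace ℂ H] [CompleteSpace H]

namespace SpectralTriple.Eigenbasis

variable {T : SpectralTriple H} {d : ℕ∞} (E : T.Eigenbasis d)

/-- The index set of the coordinates. -/
abbrev CoordIndex (d : ℕ∞) (N : ℕ) : Type :=
  {p : Modes.below d N × Modes.below d N // p.1 ≤ p.2} ⊕
    {p : Modes.below d N × Modes.below d N // p.1 < p.2}

/-- All coordinates, as one vector. -/
def coordEquiv (d : ℕ∞) (N : ℕ) : (CoordIndex d N → ℝ) ≃ᵐ Coord d N :=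
  MeasurableEquiv.sumPiEquivProdPi fun _ => ℝ

theorem measurePreserving_coordEquiv (d : ℕ∞) (N : ℕ) :
    MeasurePreserving (coordEquiv d N) volume volume :=
  volume_measurePreserving_sumPiEquivProdPi _

/-- The coefficients of `Q_{ab}` as a linear function of the coordinates. -/
def entryCoeff {N : ℕ} (a b : Modes.below d N) : CoordIndex d N → ℂ
  | .inl p => if p = ⟨(min a b, max a b), min_le_max⟩ then 1 else 0
  | .inr p => if h : a < b then if p = ⟨(a, b), h⟩ then Complex.I else 0
      else if h : b < a then if p = ⟨(b, a), h⟩ then -Complex.I else 0 else 0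

theorem hermEntry_eq {N : ℕ} (x : CoordIndex d N → ℝ) (a b : Modes.below d N) :
    hermEntry (coordEquiv d N x) a b = ∑ s, entryCoeff a b s * x s := by
  have h1 : ∀ p, (coordEquiv d N x).1 p = x (.inl p) := fun _ => rfl
  have h2 : ∀ p, (coordEquiv d N x).2 p = x (.inr p) := fun _ => rfl
  rw [Fintype.sum_sum_type]
  simp only [entryCoeff, ite_mul, one_mul, zero_mul, Finset.sum_ite_eq', Finset.mem_univ, if_true]
  rcases lt_trichotomy a b with h | rfl | h
  · simp [hermEntry, h, h1, h2, min_eq_left h.le, max_eq_right h.le, mul_comm]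
  · simp [hermEntry, h1]
  · simp [hermEntry, h, h.not_gt, h1, h2, min_eq_right h.le, max_eq_left h.le, mul_comm,
      sub_eq_add_neg]

/-- The coefficients of the Gaussian weight. -/
def weightCoeff (r : Modes.below d N → Modes.below d N → ℝ) : CoordIndex d N → ℝ
  | .inl p => if p.1.1 < p.1.2 then r p.1.1 p.1.2 else r p.1.1 p.1.2 / 2
  | .inr p => r p.1.1 p.1.2

theorem sum_eq_sum_le_add_sum_lt {α : Type*} [Fintype α] [LinearOrder α] (F : α → α → ℂ)
    (hF : ∀ a b, F a b = F b a) :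
    ∑ a, ∑ b, F a b = (∑ p : {p : α × α // p.1 ≤ p.2}, F p.1.1 p.1.2)
      + ∑ p : {p : α × α // p.1 < p.2}, F p.1.1 p.1.2 := by
  rw [← Finset.sum_product', Finset.univ_product_univ]
  have h1 : ∑ p : {p : α × α // p.1 ≤ p.2}, F p.1.1 p.1.2
      = ∑ p ∈ Finset.univ.filter (fun p : α × α => p.1 ≤ p.2), F p.1 p.2 :=
    (Finset.sum_subtype _ (by simp) (fun p : α × α => F p.1 p.2)).symm
  have h2 : ∑ p : {p : α × α // p.1 < p.2}, F p.1.1 p.1.2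
      = ∑ p ∈ Finset.univ.filter (fun p : α × α => p.1 < p.2), F p.1 p.2 :=
    (Finset.sum_subtype _ (by simp) (fun p : α × α => F p.1 p.2)).symm
  have h3 : ∑ p ∈ Finset.univ.filter (fun p : α × α => p.1 < p.2), F p.1 p.2
      = ∑ p ∈ Finset.univ.filter (fun p : α × α => ¬ p.1 ≤ p.2), F p.1 p.2 := by
    refine Finset.sum_bij (fun p _ => p.swap) (by simp) (fun a _ b _ h => Prod.swap_injective h)
      (fun b hb => ⟨b.swap, by simpa using hb, by simp⟩) (fun p _ => hF _ _)
  rw [h1, h2, h3, Finset.sum_filter_add_sum_filter_not]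

theorem sum_lt_eq_sum_le {α : Type*} [Fintype α] [LinearOrder α] (F : α → α → ℂ) :
    ∑ p : {p : α × α // p.1 < p.2}, F p.1.1 p.1.2
      = ∑ p : {p : α × α // p.1 ≤ p.2}, if p.1.1 < p.1.2 then F p.1.1 p.1.2 else 0 := by
  have h1 : ∑ p : {p : α × α // p.1 ≤ p.2}, (if p.1.1 < p.1.2 then F p.1.1 p.1.2 else 0)
      = ∑ p ∈ Finset.univ.filter (fun p : α × α => p.1 ≤ p.2), if p.1 < p.2 then F p.1 p.2 else 0 :=
    (Finset.sum_subtype _ (by simp)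
      (fun p : α × α => if p.1 < p.2 then F p.1 p.2 else 0)).symm
  have h2 : ∑ p : {p : α × α // p.1 < p.2}, F p.1.1 p.1.2
      = ∑ p ∈ Finset.univ.filter (fun p : α × α => p.1 < p.2), F p.1 p.2 :=
    (Finset.sum_subtype _ (by simp) (fun p : α × α => F p.1 p.2)).symm
  rw [h1, h2, ← Finset.sum_filter, Finset.filter_filter]
  refine Finset.sum_congr (Finset.filter_congr fun p _ => ?_) fun _ _ => rfl
  exact ⟨fun h => ⟨h.le, h⟩, fun h => h.2⟩

/-- The second divided differences `f'[λᵢ, λⱼ]` of the modes below `N` are positive. -/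
def PositiveBelow (f : ℝ → ℂ) (N : ℕ) : Prop :=
  ∀ i ∈ Modes.below d N, ∀ j ∈ Modes.below d N,
    0 < (divDiff (deriv f) [E.val i] (E.val j)).re ∧
      (divDiff (deriv f) [E.val i] (E.val j)).im = 0

/-- `⟨Q, Q⟩ = ∑ r_{ab} |Q_{ab}|²`. An off-diagonal pair occurs twice, which absorbs the factor `½`
of the exponent; a diagonal entry occurs once, whence the halved coefficients in `weightCoeff`. -/
theorem weight_eq {f : ℝ → ℂ} (hf : ContDiff ℝ ∞ f) {N : ℕ}
    (r : Modes.below d N → Modes.below d N → ℝ)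
    (hr : ∀ a b : Modes.below d N,
      vertexWeight f (fun k : Modes.below d N => E.val k) {a, b} = r a b)
    (x : CoordIndex d N → ℝ) :
    E.weight f (coordEquiv d N x) = (gaussDensity (weightCoeff r) x : ℂ) := by
  have hr' : ∀ a b, r a b = r b a := fun a b => by
    have := hr a b
    rw [Multiset.pair_comm, hr b a] at this
    exact_mod_cast this.symm
  have hQ : E.Tame N ![E.herm (coordEquiv d N x), E.herm (coordEquiv d N x)] :=
    Or.inl fun k => by fin_cases k <;> exact E.herm_mem _
  have h1 : E.bracket f ![E.herm (coordEquiv d N x), E.herm (coordEquiv d N x)]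
      = ∑ a : Modes.below d N, ∑ b : Modes.below d N, (r a b : ℂ) *
        (hermEntry (coordEquiv d N x) a b * hermEntry (coordEquiv d N x) b a) := by
    rw [E.bracket_eq_sum hf N hQ, ← Finset.sum_product', Finset.univ_product_univ]
    refine Fintype.sum_equiv (finTwoArrowEquiv _) _ _ fun i => ?_
    rw [Fin.prod_univ_two, finTwoArrowEquiv_apply, ← hr]
    simp only [finRotate_apply, Matrix.cons_val_zero, Matrix.cons_val_one, zero_add,
      Fin.isValue, show (1 + 1 : Fin 2) = 0 from rfl, elt_herm]
    rfl
  -- `A` is the real part of `Q_{ab}` and `B`, up to sign, the imaginary part, both extended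
  -- symmetrically. Only their squares matter.
  set A : Modes.below d N → Modes.below d N → ℝ :=
    fun a b => x (.inl ⟨(min a b, max a b), min_le_max⟩) with hA
  set B : Modes.below d N → Modes.below d N → ℝ :=
    fun a b => if h : a < b then x (.inr ⟨(a, b), h⟩)
      else if h : b < a then x (.inr ⟨(b, a), h⟩) else 0 with hB
  have hAB : ∀ a b, hermEntry (coordEquiv d N x) a b * hermEntry (coordEquiv d N x) b a
      = (A a b ^ 2 + B a b ^ 2 : ℂ) := by
    intro a b
    have h1 : ∀ p, (coordEquiv d N x).1 p = x (.inl p) := fun _ => rfl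
    have h2 : ∀ p, (coordEquiv d N x).2 p = x (.inr p) := fun _ => rfl
    rcases lt_trichotomy a b with h | rfl | h
    · simp only [hermEntry, h, h1, h2, min_eq_left h.le, max_eq_right h.le, hA, hB, dif_pos,
        h.not_gt, dif_neg, not_false_eq_true]
      linear_combination -(x (.inr ⟨(a, b), h⟩) : ℂ) ^ 2 * Complex.I_sq
    · simp [hermEntry, h1, hA, hB, sq]
    · simp only [hermEntry, h, h1, h2, min_eq_right h.le, max_eq_left h.le, hA, hB, dif_pos,
        h.not_gt, dif_neg, not_false_eq_true]
      linear_combination -(x (.inr ⟨(b, a), h⟩) : ℂ) ^ 2 * Complex.I_sq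
  have hA' : ∀ p : {p : Modes.below d N × Modes.below d N // p.1 ≤ p.2},
      A p.1.1 p.1.2 = x (.inl p) := fun p => by
    simp [hA, min_eq_left p.2, max_eq_right p.2]
  have hB' : ∀ p : {p : Modes.below d N × Modes.below d N // p.1 < p.2},
      B p.1.1 p.1.2 = x (.inr p) := fun p => by simp [hB, p.2]
  have hAs : ∀ a b, A a b = A b a := fun a b => by simp only [hA, min_comm a b, max_comm a b]
  have hBs : ∀ a b, B a b = B b a := fun a b => by
    rcases lt_trichotomy a b with h | rfl | h
    · simp [hB, h, h.not_gt]
    · rfl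
    · simp [hB, h, h.not_gt]
  have hBd : ∀ a b, ¬ a < b → a ≤ b → B a b = 0 := fun a b h h' => by
    simp [hB, h, h'.not_gt]
  rw [weight, h1]
  simp only [hAB]
  rw [sum_eq_sum_le_add_sum_lt (fun a b => (r a b : ℂ) * (A a b ^ 2 + B a b ^ 2))
    (fun a b => by rw [hr', hAs, hBs]), gaussDensity, ← Real.exp_sum, Complex.ofReal_exp]
  congr 1
  have h3 : ∑ p : {p : Modes.below d N × Modes.below d N // p.1 ≤ p.2},
      (r p.1.1 p.1.2 : ℂ) * (A p.1.1 p.1.2 ^ 2 + B p.1.1 p.1.2 ^ 2)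
      = (∑ p : {p : Modes.below d N × Modes.below d N // p.1 ≤ p.2},
          (r p.1.1 p.1.2 : ℂ) * A p.1.1 p.1.2 ^ 2)
        + ∑ p : {p : Modes.below d N × Modes.below d N // p.1 < p.2},
          (r p.1.1 p.1.2 : ℂ) * B p.1.1 p.1.2 ^ 2 := by
    rw [sum_lt_eq_sum_le (fun a b => (r a b : ℂ) * B a b ^ 2), ← Finset.sum_add_distrib]
    refine Finset.sum_congr rfl fun p _ => ?_
    split_ifs with h
    · ring
    · rw [hBd _ _ h p.2]; simp
  rw [h3]
  simp only [mul_add, Finset.sum_add_distrib]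
  rw [sum_lt_eq_sum_le (fun a b => (r a b : ℂ) * A a b ^ 2)]
  simp only [hA', hB', Fintype.sum_sum_type, weightCoeff]
  push_cast
  have h4 : ∑ p : {p : Modes.below d N × Modes.below d N // p.1 ≤ p.2},
      -((if p.1.1 < p.1.2 then r p.1.1 p.1.2 else r p.1.1 p.1.2 / 2 : ℝ) : ℂ) * (x (.inl p) : ℂ) ^ 2
      = -(1 / 2) * ((∑ p : {p : Modes.below d N × Modes.below d N // p.1 ≤ p.2},
          (r p.1.1 p.1.2 : ℂ) * (x (.inl p) : ℂ) ^ 2)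
        + ∑ p : {p : Modes.below d N × Modes.below d N // p.1 ≤ p.2},
          if p.1.1 < p.1.2 then (r p.1.1 p.1.2 : ℂ) * (x (.inl p) : ℂ) ^ 2 else 0) := by
    rw [← Finset.sum_add_distrib, Finset.mul_sum]
    refine Finset.sum_congr rfl fun p _ => ?_
    split_ifs <;> push_cast <;> ring
  rw [h4]
  simp only [neg_mul, Finset.sum_neg_distrib]
  ring

/-- The propagator: the covariance of the matrix elements `Q_{ij}` and `Q_{kl}`. -/
def propagator (f : ℝ → ℂ) (N : ℕ) (i j k l : Modes d) : ℂ :=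
  if i = l ∧ j = k ∧ i ∈ Modes.below d N ∧ j ∈ Modes.below d N then
    (divDiffMultiset (deriv f) {E.val i, E.val j})⁻¹ else 0

/-- A coordinate of weight `w` has variance `1/(2w)`. In `Q_{ab} Q_{ba}` with `a ≠ b` the real and
imaginary parts each contribute `1/(2r)`; in `Q_{ab} Q_{ab}` they cancel because `i² = -1`. A
diagonal entry has one coordinate, of weight `r/2`. -/
theorem sum_entryCoeff {N : ℕ} (r : Modes.below d N → Modes.below d N → ℝ)
    (hr : ∀ a b, r a b = r b a) (a b k l : Modes.below d N) :
    ∑ s, entryCoeff a b s * entryCoeff k l s * (2 * weightCoeff r s : ℂ)⁻¹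
      = if a = l ∧ b = k then (r a b : ℂ)⁻¹ else 0 := by
  rw [Fintype.sum_sum_type]
  simp only [entryCoeff, weightCoeff]
  by_cases hc : a = l ∧ b = k
  · obtain ⟨rfl, rfl⟩ := hc
    rcases lt_trichotomy a b with h | rfl | h
    · simp [h, h.not_gt, min_eq_left h.le, max_eq_right h.le, min_eq_right h.le, max_eq_left h.le]
      ring
    · simp
      ring
    · simp [h, h.not_gt, min_eq_left h.le, max_eq_right h.le, min_eq_right h.le, max_eq_left h.le,
        hr a b]
      ring
  rw [if_neg hc]
  rcases lt_trichotomy a b with h | rfl | h <;> rcases lt_trichotomy k l with h' | rfl | h'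
  · simp [h, h', min_eq_left h.le, max_eq_right h.le, min_eq_left h'.le, max_eq_right h'.le]
    split_ifs <;> simp
  · have : ¬ (k = a ∧ k = b) := by rintro ⟨rfl, rfl⟩; exact h.ne rfl
    simp [h, min_eq_left h.le, max_eq_right h.le]
    tauto
  · have : ¬ (l = a ∧ k = b) := fun e => hc ⟨e.1.symm, e.2.symm⟩
    simp [h, h', h'.not_gt, min_eq_left h.le, max_eq_right h.le, min_eq_right h'.le,
      max_eq_left h'.le, this]
  · have : ¬ (k = a ∧ l = a) := by rintro ⟨rfl, rfl⟩; exact h'.ne rfl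
    simp [h', min_eq_left h'.le, max_eq_right h'.le]
    tauto
  · have : ¬ k = a := fun e => hc ⟨e.symm, e.symm⟩
    simp [this]
  · have : ¬ (l = a ∧ k = a) := by rintro ⟨rfl, rfl⟩; exact h'.ne rfl
    simp [h', min_eq_right h'.le, max_eq_left h'.le]
    tauto
  · have : ¬ (k = b ∧ l = a) := fun e => hc ⟨e.2.symm, e.1.symm⟩
    simp [h, h', h.not_gt, min_eq_right h.le, max_eq_left h.le, min_eq_left h'.le,
      max_eq_right h'.le, this]
  · have : ¬ (k = b ∧ k = a) := by rintro ⟨rfl, rfl⟩; exact h.ne rfl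
    simp [h, min_eq_right h.le, max_eq_left h.le]
    tauto
  · simp [h, h', h.not_gt, h'.not_gt, min_eq_right h.le, max_eq_left h.le, min_eq_right h'.le,
      max_eq_left h'.le]

/-- The Gaussian mean of a quadratic form in the matrix elements. -/
theorem gaussMean_sum {f : ℝ → ℂ} (hf : ContDiff ℝ ∞ f) {N : ℕ} (hN : E.PositiveBelow f N)
    {X : Type*} (s : Finset X) (κ : X → ℂ) (i j k l : X → Modes d)
    (F : (H →L[ℂ] H) → ℂ) (hF : ∀ c : Coord d N, F (E.herm c) = ∑ x ∈ s, κ x *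
      (E.elt (E.herm c) (i x) (j x) * E.elt (E.herm c) (k x) (l x))) :
    E.gaussMean f N F = ∑ x ∈ s, κ x * E.propagator f N (i x) (j x) (k x) (l x) := by
  classical
  have hdd : ∀ a b : Modes.below d N, vertexWeight f (fun k : Modes.below d N => E.val k) {a, b}
      = divDiff (deriv f) [E.val b] (E.val a) := fun a b => by
    rw [vertexWeight, Multiset.insert_eq_cons, Multiset.map_cons, Multiset.map_singleton]
    exact divDiffMultiset_coe_cons (contDiff_infty_iff_deriv.mp hf).2 _ [E.val b]
  set r : Modes.below d N → Modes.below d N → ℝ :=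
    fun a b => (divDiff (deriv f) [E.val b] (E.val a)).re with hrdef
  have hr : ∀ a b : Modes.below d N,
      vertexWeight f (fun k : Modes.below d N => E.val k) {a, b} = r a b := fun a b => by
    rw [hdd]
    exact Complex.ext rfl (by simp [(hN b b.2 a a.2).2])
  have hr' : ∀ a b, r a b = r b a := fun a b => by
    have := hr a b
    rw [Multiset.pair_comm, hr b a] at this
    exact_mod_cast this.symm
  have hpos : ∀ a b, 0 < r a b := fun a b => (hN b b.2 a a.2).1
  have hw : ∀ t, 0 < weightCoeff r t := by
    rintro (p | p)
    · simp only [weightCoeff]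
      split_ifs
      · exact hpos _ _
      · exact half_pos (hpos _ _)
    · exact hpos _ _
  set Z : ℂ := ∫ x : CoordIndex d N → ℝ, (gaussDensity (weightCoeff r) x : ℂ) with hZ
  have hZ0 : Z ≠ 0 := by
    rw [hZ, integral_complex_ofReal]
    exact_mod_cast (integral_gaussDensity_pos hw).ne'
  have hden : ∫ c : Coord d N, E.weight f c = Z := by
    rw [← (measurePreserving_coordEquiv d N).integral_comp']
    simp only [E.weight_eq hf r hr]
    rfl
  have hnum : ∀ x, Integrable (fun y : CoordIndex d N → ℝ =>
        E.elt (E.herm (coordEquiv d N y)) (i x) (j x) * E.elt (E.herm (coordEquiv d N y)) (k x) (l x)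
          * (gaussDensity (weightCoeff r) y : ℂ)) ∧
      ∫ y : CoordIndex d N → ℝ,
        E.elt (E.herm (coordEquiv d N y)) (i x) (j x) * E.elt (E.herm (coordEquiv d N y)) (k x) (l x)
          * (gaussDensity (weightCoeff r) y : ℂ)
        = E.propagator f N (i x) (j x) (k x) (l x) * Z := by
    intro x
    -- Matrix elements of `Q` outside the first `N` modes vanish identically; the definition of
    -- `propagator` is zero there as well.
    by_cases h1 : i x ∈ Modes.below d N ∧ j x ∈ Modes.below d N
    · by_cases h2 : k x ∈ Modes.below d N ∧ l x ∈ Modes.below d N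
      · have h3 := integral_linear_mul_linear hw (entryCoeff ⟨i x, h1.1⟩ ⟨j x, h1.2⟩)
          (entryCoeff ⟨k x, h2.1⟩ ⟨l x, h2.2⟩)
        simp only [← hermEntry_eq, ← E.elt_herm] at h3
        refine ⟨h3.1, h3.2.trans ?_⟩
        rw [sum_entryCoeff r hr']
        congr 1
        simp only [propagator, h1, Subtype.mk.injEq, and_true, ← hr]
        refine if_congr Iff.rfl ?_ rfl
        simp [vertexWeight]
      · have h3 : ∀ y, E.elt (E.herm (coordEquiv d N y)) (k x) (l x) = 0 := fun y =>
          E.elt_eq_zero_of_mem (E.herm_mem _) (by tauto)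
        simp only [h3, mul_zero, zero_mul, integral_zero]
        refine ⟨integrable_zero _ _ _, ?_⟩
        rw [propagator, if_neg, zero_mul]
        rintro ⟨h4, h5, h6⟩
        rw [h4, h5] at h6
        exact h2 h6.symm
    · have h3 : ∀ y, E.elt (E.herm (coordEquiv d N y)) (i x) (j x) = 0 := fun y =>
        E.elt_eq_zero_of_mem (E.herm_mem _) (by tauto)
      simp only [h3, zero_mul, integral_zero]
      refine ⟨integrable_zero _ _ _, ?_⟩
      rw [propagator, if_neg (fun h => h1 h.2.2), zero_mul]
  rw [gaussMean, hden, ← (measurePreserving_coordEquiv d N).integral_comp', div_eq_iff hZ0]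
  simp only [E.weight_eq hf r hr, hF, Finset.sum_mul, mul_assoc]
  rw [integral_finsetSum]
  · refine Finset.sum_congr rfl fun x _ => ?_
    rw [integral_const_mul, ← (hnum x).2]
    simp only [mul_assoc]
  · intro x _
    have := (hnum x).1.const_mul (κ x)
    simpa only [mul_assoc] using this

end SpectralTriple.Eigenbasis

end Propagator

/-! ### Amplitudes as finite sums -/

section FiniteAmplitude

namespace NCDiagram

variable {n : ℕ} (G : NCDiagram n)

theorem mem_propagators {h : G.HalfEdge} :
    h ∈ G.propagators ↔ finSigmaFinEquiv h < finSigmaFinEquiv (G.glue h) := by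
  simp only [propagators, List.mem_filter, List.mem_map, List.mem_finRange, true_and,
    decide_eq_true_eq, and_iff_right_iff_imp]
  exact fun _ => ⟨finSigmaFinEquiv h, Equiv.symm_apply_apply _ _⟩

theorem propagators_nodup : G.propagators.Nodup :=
  ((List.nodup_finRange _).map (Equiv.injective _)).filter _

/-- An internal edge is listed through its half-edge with the smaller number only. -/
theorem propagators_append_nodup : (G.propagators ++ G.propagators.map G.glue).Nodup := by
  refine List.Nodup.append G.propagators_nodup
    (G.propagators_nodup.map G.gluePerm.injective) ?_
  intro h h1 h2
  obtain ⟨h', h3, rfl⟩ := List.mem_map.mp h2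
  rw [mem_propagators] at h1 h3
  rw [G.glue_glue] at h1
  exact h1.not_gt h3

theorem notMem_propagators_iff {h : G.HalfEdge} :
    (h ∉ G.propagators ∧ G.glue h ∉ G.propagators) ↔ G.glue h = h := by
  rw [mem_propagators, mem_propagators, G.glue_glue, not_lt, not_lt]
  constructor
  · rintro ⟨h1, h2⟩
    exact finSigmaFinEquiv.injective (le_antisymm h1 h2)
  · intro h1
    rw [h1]
    simp

theorem glue_ne_of_mem_propagators {h : G.HalfEdge} (hh : h ∈ G.propagators) : G.glue h ≠ h := by
  rw [mem_propagators] at hh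
  intro h'
  rw [h'] at hh
  exact hh.ne rfl

/-- The amplitude of a diagram with vertex weights `c`, covariance `p` and matrices `v`. The index
`ι h` is the row index at the half-edge `h`; its column index is the row index at the next half-edge
of the same vertex. -/
def indexSum {I : Type*} [Fintype I] (c : Multiset I → ℂ) (p : I → I → I → I → ℂ)
    (v : Fin n → I → I → ℂ) : ℂ :=
  ∑ ι : G.HalfEdge → I, (∏ w : Fin G.numVert, c (Finset.univ.val.map fun k => ι ⟨w, k⟩)) *
    (∏ i, v i (ι (G.ext i)) (ι (G.rot (G.ext i)))) *
    (G.propagators.map fun h =>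
      -p (ι h) (ι (G.rot h)) (ι (G.glue h)) (ι (G.rot (G.glue h)))).prod

end NCDiagram

variable {H : Type*} [NormedAddCommGroup H] [InnerProductSpace ℂ H] [CompleteSpace H]

namespace SpectralTriple.Eigenbasis

variable {T : SpectralTriple H} {d : ℕ∞} (E : T.Eigenbasis d)

/-- Insertion of random matrices never creates a second exceptional operator. -/
theorem Tame.of_forall {K n : ℕ} {V W : Fin n → H →L[ℂ] H} (hV : E.Tame K V)
    (h : ∀ k, W k = V k ∨ W k ∈ E.matrices K) : E.Tame K W := by
  rcases hV with hV | ⟨hn, k₀, hV⟩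
  · exact Or.inl fun k => (h k).elim (fun e => e ▸ hV k) id
  · exact Or.inr ⟨hn, k₀, fun k hk => (h k).elim (fun e => e ▸ hV k hk) id⟩

variable {n : ℕ} (G : NCDiagram n)

theorem prod_bracket_eq_sum {f : ℝ → ℂ} (hf : ContDiff ℝ ∞ f) {K : ℕ}
    {W : G.HalfEdge → H →L[ℂ] H} (hW : ∀ v, E.Tame K fun k => W ⟨v, k⟩) :
    ∏ v, E.bracket f (fun k : Fin (G.deg v) => W ⟨v, k⟩)
      = ∑ ι : G.HalfEdge → Modes.below d K,
        (∏ w : Fin G.numVert, vertexWeight f (fun k : Modes.below d K => E.val k)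
          (Finset.univ.val.map fun k => ι ⟨w, k⟩)) *
        ∏ h, E.elt (W h) (ι h) (ι (G.rot h)) := by
  simp only [E.bracket_eq_sum hf K (hW _)]
  rw [Finset.prod_univ_sum]
  simp only [Fintype.piFinset_univ]
  refine Fintype.sum_equiv (Equiv.piCurry fun (v : Fin G.numVert) (_ : Fin (G.deg v)) =>
    Modes.below d K).symm _ _ fun i => ?_
  rw [Finset.prod_mul_distrib, Fintype.prod_sigma]
  rfl

/-- Induction on the edges that have already been joined. A contraction integrates out the two
matrix elements at the ends of its edge, which enter bilinearly, and replaces them by their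
covariance. The hypothesis on `L` ensures that both ends of a new edge are still free. -/
theorem foldr_contract {f : ℝ → ℂ} (hf : ContDiff ℝ ∞ f) {N K : ℕ} (hNK : N ≤ K)
    (hN : E.PositiveBelow f N) (L : List G.HalfEdge) (hL : (L ++ L.map G.glue).Nodup) :
    ∀ W : G.HalfEdge → H →L[ℂ] H, (∀ v, E.Tame K fun k => W ⟨v, k⟩) →
    L.foldr (fun h Γ => E.contract f N h (G.glue h) Γ)
      (fun W => ∏ v, E.bracket f fun k : Fin (G.deg v) => W ⟨v, k⟩) W
    = ∑ ι : G.HalfEdge → Modes.below d K,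
        (∏ w : Fin G.numVert, vertexWeight f (fun k : Modes.below d K => E.val k)
          (Finset.univ.val.map fun k => ι ⟨w, k⟩)) *
        (∏ h ∈ Finset.univ.filter (fun h => h ∉ L ∧ G.glue h ∉ L),
          E.elt (W h) (ι h) (ι (G.rot h))) *
        (L.map fun h => -E.propagator f N (ι h) (ι (G.rot h)) (ι (G.glue h))
          (ι (G.rot (G.glue h)))).prod := by
  induction L with
  | nil =>
    intro W hW
    simp [E.prod_bracket_eq_sum G hf hW]
  | cons h L ih =>
    intro W hW
    have hnd := List.nodup_append.mp hL
    have h1 : (L ++ L.map G.glue).Nodup := by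
      refine hL.sublist ?_
      exact List.Sublist.append (List.sublist_cons_self _ _)
        ((List.sublist_cons_self _ _).map _)
    have h2 : h ∉ L := (List.nodup_cons.mp hnd.1).1
    have h3 : G.glue h ∉ L := fun hh => hnd.2.2 _ (List.mem_cons_of_mem _ hh) (G.glue h)
      (by simp) rfl
    have h4 : G.glue h ≠ h := fun hh => hnd.2.2 h (by simp) h (by simp [hh]) rfl
    set A := Finset.univ.filter (fun x => x ∉ L ∧ G.glue x ∉ L) with hA
    set A' := Finset.univ.filter (fun x => x ∉ h :: L ∧ G.glue x ∉ h :: L) with hA'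
    have h5 : A' = (A.erase h).erase (G.glue h) := by
      ext x
      simp only [hA, hA', Finset.mem_filter, Finset.mem_univ, true_and, List.mem_cons, not_or,
        Finset.mem_erase]
      have : G.glue x = h ↔ x = G.glue h :=
        ⟨fun e => by rw [← e, G.glue_glue], fun e => by rw [e, G.glue_glue]⟩
      rw [this]
      tauto
    rw [List.foldr_cons, contract, E.gaussMean_sum hf hN Finset.univ
      (fun ι : G.HalfEdge → Modes.below d K =>
        (∏ w : Fin G.numVert, vertexWeight f (fun k : Modes.below d K => E.val k)
          (Finset.univ.val.map fun k => ι ⟨w, k⟩)) *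
        (∏ h ∈ A', E.elt (W h) (ι h) (ι (G.rot h))) *
        (L.map fun h => -E.propagator f N (ι h) (ι (G.rot h)) (ι (G.glue h))
          (ι (G.rot (G.glue h)))).prod)
      (fun ι => ι h) (fun ι => ι (G.rot h)) (fun ι => ι (G.glue h))
      (fun ι => ι (G.rot (G.glue h)))]
    · rw [← Finset.sum_neg_distrib]
      refine Finset.sum_congr rfl fun ι _ => ?_
      rw [List.map_cons, List.prod_cons]
      ring
    · intro c
      rw [ih h1]
      · refine Finset.sum_congr rfl fun ι _ => ?_
        rw [← Finset.mul_prod_erase A _ (a := h) (by simp [hA, h2, h3]),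
          ← Finset.mul_prod_erase (A.erase h) _ (a := G.glue h)
            (by simp [hA, h2, h3, h4, G.glue_glue]), ← h5]
        have h6 : ∏ x ∈ A', E.elt (Function.update (Function.update W h (E.herm c)) (G.glue h)
            (E.herm c) x) (ι x) (ι (G.rot x)) = ∏ x ∈ A', E.elt (W x) (ι x) (ι (G.rot x)) := by
          refine Finset.prod_congr rfl fun x hx => ?_
          rw [h5, Finset.mem_erase, Finset.mem_erase] at hx
          rw [Function.update_of_ne hx.1, Function.update_of_ne hx.2.1]
        rw [h6, Function.update_self, Function.update_of_ne h4.symm, Function.update_self]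
        ring
      · refine fun v => Tame.of_forall E (hW v) fun k => ?_
        by_cases e1 : (⟨v, k⟩ : G.HalfEdge) = G.glue h
        · right
          rw [e1, Function.update_self]
          exact E.matrices_mono hNK (E.herm_mem c)
        by_cases e2 : (⟨v, k⟩ : G.HalfEdge) = h
        · right
          rw [Function.update_of_ne e1, e2, Function.update_self]
          exact E.matrices_mono hNK (E.herm_mem c)
        · left
          rw [Function.update_of_ne e1, Function.update_of_ne e2]

/-- One argument outside `M_K` is admitted, since it meets a single vertex and that vertex remains
tame once its degree is at least two. The Ward identity needs this: `[D, a]`, `aV₁` and `Vₙa` need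
not lie in `M_N`. -/
theorem amplitude_eq_indexSum {f : ℝ → ℂ} (hf : ContDiff ℝ ∞ f) {N K : ℕ} (hNK : N ≤ K)
    (hN : E.PositiveBelow f N) {V : Fin n → H →L[ℂ] H}
    (hV : (∀ i, V i ∈ E.matrices K) ∨
      ((∀ v, 2 ≤ G.deg v) ∧ ∃ i₀, ∀ i, i ≠ i₀ → V i ∈ E.matrices K)) :
    E.amplitude f N G V = G.indexSum (vertexWeight f fun k : Modes.below d K => E.val k)
      (fun i j k l : Modes.below d K => E.propagator f N i j k l)
      (fun i (a b : Modes.below d K) => E.elt (V i) a b) := by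
  rw [amplitude, E.foldr_contract G hf hNK hN _ G.propagators_append_nodup, NCDiagram.indexSum]
  · refine Finset.sum_congr rfl fun ι _ => ?_
    congr 2
    simp only [G.notMem_propagators_iff]
    symm
    refine Finset.prod_bij (fun i _ => (G.ext i : G.HalfEdge)) (fun i _ => by simp [(G.ext i).2])
      (fun i _ j _ h => G.ext.injective (Subtype.ext h)) (fun h hh => ?_) (fun i _ => ?_)
    · have hh' : G.glue h = h := by simpa using hh
      exact ⟨G.ext.symm ⟨h, hh'⟩, Finset.mem_univ _, by simp⟩
    · rw [dif_pos (G.ext i).2]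
      simp
  · intro v
    rcases hV with hV | ⟨hd, i₀, hV⟩
    · refine Or.inl fun k => ?_
      dsimp only
      split_ifs
      · exact hV _
      · exact Submodule.zero_mem _
    · by_cases hex : ∃ k₀ : Fin (G.deg v), (⟨v, k₀⟩ : G.HalfEdge) = G.ext i₀
      · obtain ⟨k₀, hk₀⟩ := hex
        refine Or.inr ⟨hd v, k₀, fun k hk => ?_⟩
        dsimp only
        split_ifs with hh
        · refine hV _ fun e => hk ?_
          rw [Equiv.symm_apply_eq] at e
          have e' := congrArg Subtype.val e
          rw [← hk₀] at e'
          simpa using e'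
        · exact Submodule.zero_mem _
      · refine Or.inl fun k => ?_
        dsimp only
        split_ifs with hh
        · refine hV _ fun e => hex ⟨k, ?_⟩
          rw [Equiv.symm_apply_eq] at e
          exact congrArg Subtype.val e
        · exact Submodule.zero_mem _

end SpectralTriple.Eigenbasis

end FiniteAmplitude

/-! ### Isomorphism invariance -/

namespace NCDiagram

variable {n : ℕ} (G : NCDiagram n)

theorem map_vertex_eq {I : Type*} (ι : G.HalfEdge → I) (w : Fin G.numVert) :
    (Finset.univ.val.map fun k => ι ⟨w, k⟩)
      = (Finset.univ.filter fun h : G.HalfEdge => h.1 = w).val.map ι := by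
  have : (Finset.univ.filter fun h : G.HalfEdge => h.1 = w)
      = Finset.univ.map ⟨fun k : Fin (G.deg w) => (⟨w, k⟩ : G.HalfEdge),
        fun _ _ h => eq_of_heq (Sigma.mk.inj h).2⟩ := by
    ext ⟨w', k⟩
    simp only [Finset.mem_filter, Finset.mem_univ, true_and, Finset.mem_map]
    constructor
    · rintro rfl
      exact ⟨k, rfl⟩
    · rintro ⟨k', h⟩
      exact (congrArg Sigma.fst h).symm
  rw [this, Finset.map_val, Multiset.map_map]
  rfl

/-- An isomorphism need not respect which end of an internal edge represents it in `propagators`.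
The symmetry `hp` of the covariance makes the choice irrelevant. -/
theorem Isomorphic.indexSum_eq {G G' : NCDiagram n} (h : Isomorphic G G') {I : Type*} [Fintype I]
    (c : Multiset I → ℂ) (p : I → I → I → I → ℂ) (hp : ∀ i j k l, p i j k l = p k l i j)
    (v : Fin n → I → I → ℂ) : G.indexSum c p v = G'.indexSum c p v := by
  obtain ⟨ν, e, h1, h2, h3, h4⟩ := h
  refine Fintype.sum_equiv (Equiv.arrowCongr e (Equiv.refl I)) _ _ fun ι => ?_
  set ι' := Equiv.arrowCongr e (Equiv.refl I) ι with hι'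
  have hι : ∀ x, ι' (e x) = ι x := fun x => by simp [hι', Equiv.arrowCongr_apply]
  congr 1
  · congr 1
    · refine Fintype.prod_equiv ν _ _ fun w => ?_
      rw [map_vertex_eq, map_vertex_eq]
      have : (Finset.univ.filter fun x : G'.HalfEdge => x.1 = ν w)
          = (Finset.univ.filter fun x : G.HalfEdge => x.1 = w).map e.toEmbedding := by
        ext x
        obtain ⟨y, rfl⟩ := e.surjective x
        simp [h1]
      rw [this, Finset.map_val, Multiset.map_map]
      congr 2
      funext x
      exact (hι x).symm
    · refine Finset.prod_congr rfl fun i _ => ?_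
      rw [← h4, ← h2, hι, hι]
  · have hnd := G.propagators_nodup
    have hnd' := G'.propagators_nodup
    rw [← List.prod_toFinset _ hnd, ← List.prod_toFinset _ hnd']
    have key : ∀ {G : NCDiagram n} {x : G.HalfEdge}, G.glue x ≠ x → x ∉ G.propagators →
        G.glue x ∈ G.propagators := by
      intro G x hx hx'
      by_contra hx''
      exact hx (G.notMem_propagators_iff.mp ⟨hx', hx''⟩)
    have key2 : ∀ {G : NCDiagram n} {x : G.HalfEdge}, x ∈ G.propagators →
        G.glue x ∉ G.propagators := by
      intro G x hx hx'
      rw [mem_propagators] at hx hx'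
      rw [G.glue_glue] at hx'
      exact hx.not_gt hx'
    have hne : ∀ {x}, x ∈ G.propagators → G'.glue (e x) ≠ e x := fun hx hh =>
      G.glue_ne_of_mem_propagators hx (e.injective ((h3 _).trans hh))
    have hne' : ∀ {x}, x ∈ G'.propagators → G.glue (e.symm x) ≠ e.symm x := fun {x} hx hh => by
      refine G'.glue_ne_of_mem_propagators hx ?_
      have := congrArg e hh
      rwa [h3, Equiv.apply_symm_apply] at this
    refine Finset.prod_bij'
      (fun x _ => if e x ∈ G'.propagators then e x else G'.glue (e x))
      (fun x _ => if e.symm x ∈ G.propagators then e.symm x else G.glue (e.symm x))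
      (fun x hx => ?_) (fun x hx => ?_) (fun x hx => ?_) (fun x hx => ?_) (fun x hx => ?_)
    · rw [List.mem_toFinset] at hx ⊢
      split_ifs with hx'
      · exact hx'
      · exact key (hne hx) hx'
    · rw [List.mem_toFinset] at hx ⊢
      split_ifs with hx'
      · exact hx'
      · exact key (hne' hx) hx'
    · rw [List.mem_toFinset] at hx
      by_cases hx' : e x ∈ G'.propagators
      · rw [if_pos hx', Equiv.symm_apply_apply, if_pos hx]
      · rw [if_neg hx', ← h3, Equiv.symm_apply_apply, if_neg (key2 hx), G.glue_glue]
    · rw [List.mem_toFinset] at hx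
      by_cases hx' : e.symm x ∈ G.propagators
      · rw [if_pos hx', Equiv.apply_symm_apply, if_pos hx]
      · rw [if_neg hx', h3, Equiv.apply_symm_apply, if_neg (key2 hx), G'.glue_glue]
    · split_ifs with hx'
      · rw [hι, ← h2, hι, ← h3, hι, ← h2, hι]
      · rw [G'.glue_glue, ← h3, hι, ← h2, hι, hι, ← h2, hι, hp]

/-! ### The shape of the relevant diagrams -/

theorem rot_fst (h : G.HalfEdge) : (G.rot h).1 = h.1 := rfl

theorem rot_pow_fst (m : ℕ) (h : G.HalfEdge) : ((G.rot ^ m) h).1 = h.1 := by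
  induction m with
  | zero => rfl
  | succ m ih => rw [pow_succ', Equiv.Perm.mul_apply, rot_fst, ih]

theorem rot_pow_mk (m : ℕ) (w : Fin G.numVert) (k : Fin (G.deg w)) :
    (G.rot ^ m) ⟨w, k⟩ = ⟨w, (finRotate (G.deg w) ^ m) k⟩ := by
  induction m with
  | zero => rfl
  | succ m ih => rw [pow_succ', Equiv.Perm.mul_apply, ih, pow_succ', Equiv.Perm.mul_apply]; rfl

theorem exists_rot_pow_eq (hd : ∀ v, 3 ≤ G.deg v) {h h' : G.HalfEdge} (hh : h.1 = h'.1) :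
    ∃ m : ℕ, (G.rot ^ m) h = h' := by
  obtain ⟨w, k⟩ := h
  obtain ⟨w', k'⟩ := h'
  obtain rfl : w = w' := hh
  have hc : ∀ (r : ℕ), 3 ≤ r → ∀ k k' : Fin r, ∃ m : ℕ, (finRotate r ^ m) k = k' := by
    intro r hr k k'
    obtain ⟨m, rfl⟩ : ∃ m, r = m + 2 := ⟨r - 2, by omega⟩
    have hs : ∀ x : Fin (m + 2), finRotate (m + 2) x ≠ x := fun x => by
      rw [← Equiv.Perm.mem_support, support_finRotate]
      exact Finset.mem_univ _
    exact isCycle_finRotate.exists_pow_eq (hs k) (hs k')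
  obtain ⟨m, hm⟩ := hc _ (hd w) k k'
  exact ⟨m, by rw [rot_pow_mk, hm]⟩

theorem rot_ne (hd : ∀ v, 3 ≤ G.deg v) (h : G.HalfEdge) : G.rot h ≠ h := by
  obtain ⟨w, k⟩ := h
  intro hh
  have h2 : finRotate (G.deg w) k = k := eq_of_heq (Sigma.mk.inj hh).2
  have hc : ∀ (r : ℕ), 3 ≤ r → ∀ k : Fin r, finRotate r k ≠ k := by
    intro r hr k
    obtain ⟨m, rfl⟩ : ∃ m, r = m + 2 := ⟨r - 2, by omega⟩
    rw [← Equiv.Perm.mem_support, support_finRotate]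
    exact Finset.mem_univ _
  exact hc _ (hd w) k h2

theorem rot_rot_ne (hd : ∀ v, 3 ≤ G.deg v) (h : G.HalfEdge) : G.rot (G.rot h) ≠ h := by
  obtain ⟨w, k⟩ := h
  intro hh
  have h2 : finRotate (G.deg w) (finRotate (G.deg w) k) = k := eq_of_heq (Sigma.mk.inj hh).2
  have hc : ∀ (r : ℕ), 3 ≤ r → ∀ k : Fin r, finRotate r (finRotate r k) ≠ k := by
    intro r hr k
    obtain ⟨m, rfl⟩ : ∃ m, r = m + 3 := ⟨r - 3, by omega⟩
    rw [finRotate_apply, finRotate_apply]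
    intro h
    have h3 : (1 + 1 : Fin (m + 3)) = 0 := by
      rw [add_assoc] at h
      simpa using h
    rw [Fin.ext_iff, Fin.val_add, Fin.val_one', Fin.val_zero, Nat.mod_eq_of_lt (a := 1) (by omega),
      Nat.mod_eq_of_lt (by omega)] at h3
    omega
  exact hc _ (hd w) k h2

/-- A bijection of half-edges that respects the cyclic orders induces one of the vertices. -/
theorem isomorphic_of_equiv {G G' : NCDiagram n} (hd : ∀ v, 3 ≤ G.deg v)
    (hd' : ∀ v, 3 ≤ G'.deg v) (e : G.HalfEdge ≃ G'.HalfEdge)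
    (hrot : ∀ h, e (G.rot h) = G'.rot (e h)) (hglue : ∀ h, e (G.glue h) = G'.glue (e h))
    (hext : ∀ i, e (G.ext i) = G'.ext i) : Isomorphic G G' := by
  have key : ∀ {G G' : NCDiagram n}, (∀ v, 3 ≤ G.deg v) → ∀ (e : G.HalfEdge ≃ G'.HalfEdge),
      (∀ h, e (G.rot h) = G'.rot (e h)) → ∀ h h' : G.HalfEdge, h.1 = h'.1 →
      (e h).1 = (e h').1 := by
    intro G G' hd e hrot h h' hh
    obtain ⟨m, rfl⟩ := G.exists_rot_pow_eq hd hh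
    have : ∀ m, e ((G.rot ^ m) h) = (G'.rot ^ m) (e h) := by
      intro m
      induction m with
      | zero => rfl
      | succ m ih => rw [pow_succ', Equiv.Perm.mul_apply, hrot, ih, pow_succ', Equiv.Perm.mul_apply]
    rw [this, rot_pow_fst]
  have hrot' : ∀ h, e.symm (G'.rot h) = G.rot (e.symm h) := fun h => by
    rw [Equiv.symm_apply_eq, hrot, Equiv.apply_symm_apply]
  have pos : ∀ v, 0 < G.deg v := fun v => by have := hd v; omega
  have pos' : ∀ v, 0 < G'.deg v := fun v => by have := hd' v; omega
  refine ⟨⟨fun v => (e ⟨v, ⟨0, pos v⟩⟩).1, fun v => (e.symm ⟨v, ⟨0, pos' v⟩⟩).1,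
    fun v => ?_, fun v => ?_⟩, e, fun h => key hd e hrot _ _ rfl, hrot, hglue, hext⟩
  · exact (key hd' e.symm hrot' ⟨_, ⟨0, pos' _⟩⟩ (e ⟨v, ⟨0, pos v⟩⟩) rfl).trans (by rw [Equiv.symm_apply_apply])
  · exact (key hd e hrot ⟨_, ⟨0, pos _⟩⟩ (e.symm ⟨v, ⟨0, pos' v⟩⟩) rfl).trans (by rw [Equiv.apply_symm_apply])

theorem card_internal :
    (Finset.univ.filter fun h : G.HalfEdge => G.glue h ≠ h).card = 2 * G.propagators.length := by
  have h := List.toFinset_card_of_nodup G.propagators_append_nodup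
  rw [List.length_append, List.length_map, ← two_mul] at h
  rw [← h]
  congr 1
  ext x
  simp only [Finset.mem_filter, Finset.mem_univ, true_and, List.mem_toFinset, List.mem_append,
    List.mem_map, ne_eq, ← notMem_propagators_iff]
  have : (∃ a ∈ G.propagators, G.glue a = x) ↔ G.glue x ∈ G.propagators := by
    constructor
    · rintro ⟨a, ha, rfl⟩
      rwa [G.glue_glue]
    · exact fun h => ⟨_, h, G.glue_glue x⟩
  rw [this]
  tauto

/-- The internal half-edges at a vertex. -/
def internalAt (w : Fin G.numVert) : Finset G.HalfEdge :=
  Finset.univ.filter fun h => h.1 = w ∧ G.glue h ≠ h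

theorem mem_internalAt {w : Fin G.numVert} {h : G.HalfEdge} :
    h ∈ G.internalAt w ↔ h.1 = w ∧ G.glue h ≠ h := by simp [internalAt]

theorem sum_card_internalAt : ∑ w, (G.internalAt w).card = 2 * G.propagators.length := by
  rw [← card_internal, Finset.card_eq_sum_card_fiberwise (f := fun h => h.1) (t := Finset.univ)
    (fun _ _ => by simp)]
  refine Finset.sum_congr rfl fun w _ => ?_
  rw [Finset.filter_filter, internalAt]
  congr 1
  ext h
  simp [and_comm]

/-- Otherwise no path could leave `w`. -/
theorem ConnectedWithout.exists_leaving {R : Set G.HalfEdge} (hR : G.ConnectedWithout R)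
    {w w' : Fin G.numVert} (hw : w ≠ w') : ∃ h ∉ R, h.1 = w ∧ (G.glue h).1 ≠ w := by
  by_contra! hcon
  have : ∀ v, Relation.ReflTransGen
      (fun v w => ∃ h : G.HalfEdge, h ∉ R ∧ h.1 = v ∧ (G.glue h).1 = w) w v → v = w := by
    intro v hv
    induction hv with
    | refl => rfl
    | tail _ h ih =>
      obtain ⟨h, h1, h2, h3⟩ := h
      rw [← h3]
      exact hcon h h1 (h2.trans ih)
  exact hw (this w' (hR.2 w w')).symm

variable {G}

namespace Relevant

variable (hG : G.Relevant)

include hG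

/-- One loop means as many internal edges as vertices, so the average number of internal half-edges
at a vertex is two. If there is another vertex, some edge leaves `w`, and by irreducibility a second
one leaves after its removal; so no vertex is below the average. -/
theorem card_internalAt (w : Fin G.numVert) : (G.internalAt w).card = 2 := by
  have hE : G.propagators.length = G.numVert := by
    have := hG.oneLoop
    unfold loopOrder at this
    omega
  have hle : ∀ w, 2 ≤ (G.internalAt w).card := by
    intro w
    by_cases hV : ∃ w', w ≠ w'
    · obtain ⟨w', hw'⟩ := hV
      obtain ⟨h, -, h1, h2⟩ := hG.planar.1.exists_leaving G hw'
      have h3 : G.glue h ≠ h := fun e => h2 (by rw [e, h1])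
      obtain ⟨h', h4, h5, h6⟩ := (hG.irreducible h h3).exists_leaving G hw'
      have h7 : G.glue h' ≠ h' := fun e => h6 (by rw [e, h5])
      have h8 : h ≠ h' := fun e => h4 (by simp [e])
      rw [← Finset.card_pair h8]
      refine Finset.card_le_card ?_
      intro x hx
      rw [mem_internalAt]
      rcases Finset.mem_insert.mp hx with rfl | hx
      · exact ⟨h1, h3⟩
      · rw [Finset.mem_singleton.mp hx]
        exact ⟨h5, h7⟩
    -- With a single vertex, both ends of the only internal edge are there.
    · push Not at hV
      have h1 := G.sum_card_internalAt
      have h2 : G.numVert = 1 := by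
        have := Fintype.card_eq_one_iff.mpr ⟨w, fun y => (hV y).symm⟩
        simpa using this
      rw [Finset.sum_eq_single w (fun b _ hb => absurd (hV b).symm hb) (by simp), hE, h2] at h1
      omega
  have hsum : ∑ w : Fin G.numVert, 2 = ∑ w, (G.internalAt w).card := by
    rw [sum_card_internalAt, hE]
    simp [mul_comm]
  exact ((Finset.sum_eq_sum_iff_of_le fun w _ => hle w).mp hsum w (Finset.mem_univ w)).symm

theorem eq_or_eq_of_internal {x y h : G.HalfEdge} (hxy : x ≠ y) (hx : G.glue x ≠ x)
    (hy : G.glue y ≠ y) (hh : G.glue h ≠ h) (h1 : x.1 = y.1) (h2 : h.1 = y.1) :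
    h = x ∨ h = y := by
  have hs : ({x, y} : Finset G.HalfEdge) = G.internalAt y.1 := by
    refine Finset.eq_of_subset_of_card_le ?_ ?_
    · intro z hz
      rw [mem_internalAt]
      rcases Finset.mem_insert.mp hz with rfl | hz
      · exact ⟨h1, hx⟩
      · rw [Finset.mem_singleton.mp hz]
        exact ⟨rfl, hy⟩
    · rw [hG.card_internalAt, Finset.card_pair hxy]
  have : h ∈ G.internalAt y.1 := G.mem_internalAt.mpr ⟨h2, hh⟩
  rw [← hs] at this
  simpa using this

/-- The half-edges on the inside of the loop, with their properties. -/
theorem exists_inner : ∃ inner : G.HalfEdge → Prop,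
    (∀ h, inner h → G.glue h ≠ h) ∧ (∀ h, G.glue h ≠ h → inner h ∨ inner (G.rot h)) ∧
    (∀ h, inner h → G.glue (G.rot h) = G.rot h) ∧ (∀ h, inner (G.rot h) → G.glue h ≠ h) ∧
    (∀ h, inner (G.rot h) ↔ inner (G.glue h)) ∧
    (∀ h h', inner h → inner h' → h.1 = h'.1 → h = h') ∧ ∀ w, ∃ h, inner h ∧ h.1 = w := by
  obtain ⟨h₀, hh₀⟩ := hG.externalOutside
  have hd := hG.three_le_deg
  set inner : G.HalfEdge → Prop := fun h => G.faceStep.SameCycle h₀ h with hinner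
  have h5 : ∀ h, inner (G.rot h) ↔ inner (G.glue h) := by
    intro h
    have : G.rot h = G.faceStep (G.glue h) := by
      change G.rot h = G.rot (G.glue (G.glue h))
      rw [G.glue_glue]
    rw [hinner]
    dsimp only
    rw [this, Equiv.Perm.sameCycle_apply_right]
  have h1 : ∀ h, inner h → G.glue h ≠ h := by
    intro h hh he
    refine hh₀ (G.ext.symm ⟨h, he⟩) ?_
    rw [Equiv.apply_symm_apply]
    exact hh
  have h4 : ∀ h, inner (G.rot h) → G.glue h ≠ h := by
    intro h hh
    have := h1 _ ((h5 h).mp hh)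
    rw [G.glue_glue] at this
    exact this.symm
  -- A corner of the inner face lies between `h` and `rot h`, both of which are then internal. There
  -- are only two internal half-edges at a vertex, so these are all.
  have key : ∀ h h', inner (G.rot h) → h'.1 = h.1 → G.glue h' ≠ h' → h' = h ∨ h' = G.rot h :=
    fun h h' hh he hh' => hG.eq_or_eq_of_internal (G.rot_ne hd h).symm (h4 h hh) (h1 _ hh) hh'
      rfl he
  have h3 : ∀ h, inner h → G.glue (G.rot h) = G.rot h := by
    intro h hh
    by_contra hcon
    obtain ⟨x, rfl⟩ := G.rot.surjective h
    rcases key x (G.rot (G.rot x)) hh rfl hcon with e | e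
    · exact G.rot_rot_ne hd x e
    · exact G.rot_ne hd _ e
  have h6 : ∀ h h', inner h → inner h' → h.1 = h'.1 → h = h' := by
    intro h h' hh hh' he
    obtain ⟨x, rfl⟩ := G.rot.surjective h
    rcases key x h' hh he.symm (h1 _ hh') with rfl | e
    · exact absurd (h3 _ hh') (h1 _ hh)
    · exact e.symm
  -- The inner face runs along both internal half-edges of a vertex that it touches, hence touches
  -- the neighbours, and by connectedness every vertex.
  have h7 : ∀ w, ∃ h, inner h ∧ h.1 = w := by
    intro w
    have hw := hG.planar.1.2 h₀.1 w
    induction hw with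
    | refl => exact ⟨h₀, Equiv.Perm.SameCycle.refl _ _, rfl⟩
    | tail _ hbc ih =>
      obtain ⟨y, hy, rfl⟩ := ih
      obtain ⟨h, -, hh1, rfl⟩ := hbc
      obtain ⟨x, rfl⟩ := G.rot.surjective y
      by_cases hh : G.glue h = h
      · exact ⟨G.rot x, hy, by rw [hh, hh1]⟩
      rcases key x h hy hh1 hh with rfl | rfl
      · exact ⟨G.glue h, (h5 h).mp hy, rfl⟩
      · refine ⟨G.rot (G.glue (G.rot x)), ?_, rfl⟩
        rw [h5, G.glue_glue]
        exact hy
  refine ⟨inner, h1, ?_, h3, h4, h5, h6, h7⟩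
  intro h hh
  obtain ⟨y, hy, hyw⟩ := h7 h.1
  obtain ⟨x, rfl⟩ := G.rot.surjective y
  rcases key x h hy hyw.symm hh with rfl | rfl
  · exact Or.inr hy
  · exact Or.inl hy

end Relevant

/-! ### Reconstruction of a relevant diagram from its cuts. -/

variable (G) in
/-- The `j`-th external edge is the first one at its vertex. -/
def IsCut (j : Fin n) : Prop := G.glue (G.rot.symm (G.ext j)) ≠ G.rot.symm (G.ext j)

theorem glue_ext (j : Fin n) : G.glue (G.ext j) = G.ext j := (G.ext j).2

theorem exists_ext {h : G.HalfEdge} (hh : G.glue h = h) : ∃ j, h = G.ext j :=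
  ⟨G.ext.symm ⟨h, hh⟩, by rw [Equiv.apply_symm_apply]⟩

theorem ext_injective {i j : Fin n} (h : (G.ext i : G.HalfEdge) = G.ext j) : i = j :=
  G.ext.injective (Subtype.ext h)

theorem faceStep_apply (h : G.HalfEdge) : G.faceStep h = G.rot (G.glue h) := rfl

namespace MarkedCyclically

variable (hG : G.MarkedCyclically)

include hG

theorem rot_ext_of_external {j : Fin n} (h : G.glue (G.rot (G.ext j)) = G.rot (G.ext j)) :
    G.rot (G.ext j) = G.ext (finRotate n j) := by
  obtain ⟨m, hm, h1, h2⟩ := hG j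
  have h3 : G.faceStep (G.ext j) = G.rot (G.ext j) := by rw [faceStep_apply, glue_ext]
  have : m = 1 := by
    by_contra hne
    exact h2 1 one_pos (by omega) (by rw [pow_one, h3, h])
  rw [this, pow_one, h3] at h1
  exact h1

/-- After the last leg of a vertex, the boundary walk crosses one propagator and meets the first leg
of the next vertex. -/
theorem rot_glue_rot_ext {j : Fin n} (h : G.glue (G.rot (G.ext j)) ≠ G.rot (G.ext j))
    (h' : G.glue (G.rot (G.glue (G.rot (G.ext j)))) = G.rot (G.glue (G.rot (G.ext j)))) :
    G.rot (G.glue (G.rot (G.ext j))) = G.ext (finRotate n j) := by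
  obtain ⟨m, hm, h1, h2⟩ := hG j
  have h3 : G.faceStep (G.ext j) = G.rot (G.ext j) := by rw [faceStep_apply, glue_ext]
  have h4 : (G.faceStep ^ 2) (G.ext j) = G.rot (G.glue (G.rot (G.ext j))) := by
    rw [pow_two, Equiv.Perm.mul_apply, h3, faceStep_apply]
  have : m = 2 := by
    by_contra hne
    rcases Nat.lt_or_ge m 2 with hlt | hge
    · have hm1 : m = 1 := by omega
      rw [hm1, pow_one, h3] at h1
      exact h (by rw [h1, glue_ext])
    · exact h2 2 two_pos (by omega) (by rw [h4, h'])
  rw [this, h4] at h1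
  exact h1

end MarkedCyclically

/-- The half-edges of a relevant diagram: the external ones, and for every cut the half-edge before
it together with the other end of that propagator. -/
def halfEdgeOf (G : NCDiagram n) : Fin n ⊕ {j // G.IsCut j} ⊕ {j // G.IsCut j} → G.HalfEdge
  | .inl j => G.ext j
  | .inr (.inl j) => G.rot.symm (G.ext j.1)
  | .inr (.inr j) => G.glue (G.rot.symm (G.ext j.1))

namespace Relevant

variable (hG : G.Relevant)

include hG

/-- If the half-edge after a leg is internal, it is not on the inner face, so its other end is. The
half-edge after that end is external, and by cyclic marking it is the next leg. -/
theorem rot_ext (j : Fin n) : G.rot (G.ext j) = if G.glue (G.rot.symm (G.ext (finRotate n j)))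
      = G.rot.symm (G.ext (finRotate n j)) then (G.ext (finRotate n j) : G.HalfEdge)
    else G.glue (G.rot.symm (G.ext (finRotate n j))) := by
  obtain ⟨inner, h1, h2, h3, h4, h5, h6, h7⟩ := hG.exists_inner
  by_cases h : G.glue (G.rot (G.ext j)) = G.rot (G.ext j)
  · have h8 := hG.markedCyclically.rot_ext_of_external h
    rw [← h8, Equiv.symm_apply_apply, if_pos (glue_ext j)]
  · have h9 : ¬ inner (G.rot (G.ext j)) := fun hh => h4 _ hh (glue_ext j)
    have h10 := (h2 _ h).resolve_left h9
    have h11 := h3 _ ((h5 _).mp h10)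
    have h8 := hG.markedCyclically.rot_glue_rot_ext h h11
    rw [← h8, Equiv.symm_apply_apply, G.glue_glue, if_neg (fun e => h e.symm)]

/-- An internal half-edge is either inner, and then sits immediately before a cut, or is glued to an
inner one. Injectivity holds because the three kinds are distinguished by being external, inner, or
internal but not inner. -/
theorem halfEdgeOf_bijective : Function.Bijective G.halfEdgeOf := by
  obtain ⟨inner, h1, h2, h3, h4, h5, h6, h7⟩ := hG.exists_inner
  have hY : ∀ j, G.IsCut j → inner (G.rot.symm (G.ext j)) := by
    intro j hj
    refine (h2 _ hj).resolve_right fun hh => ?_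
    rw [Equiv.apply_symm_apply] at hh
    exact h1 _ hh (glue_ext j)
  have hX : ∀ j, G.IsCut j → ¬ inner (G.glue (G.rot.symm (G.ext j))) := by
    intro j hj hh
    rw [← h5, Equiv.apply_symm_apply] at hh
    exact h1 _ hh (glue_ext j)
  have hX' : ∀ j, G.IsCut j → G.glue (G.glue (G.rot.symm (G.ext j)))
      ≠ G.glue (G.rot.symm (G.ext j)) := by
    intro j hj
    rw [G.glue_glue]
    exact hj.symm
  have hinj : ∀ i j : Fin n, G.rot.symm (G.ext i) = G.rot.symm (G.ext j) → i = j :=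
    fun i j h => ext_injective (G.rot.symm.injective h)
  have hinj' : ∀ i j : Fin n, G.glue (G.rot.symm (G.ext i)) = G.glue (G.rot.symm (G.ext j)) →
      i = j := fun i j h => hinj i j (G.gluePerm.injective h)
  constructor
  · rintro (i | i | i) (j | j | j) h <;> simp only [halfEdgeOf] at h
    · rw [ext_injective h]
    · exact absurd (h ▸ glue_ext i) j.2
    · exact absurd (h ▸ glue_ext i) (hX' _ j.2)
    · exact absurd (h ▸ glue_ext j) i.2
    · rw [Subtype.ext (hinj _ _ h)]
    · exact absurd (h ▸ hY _ i.2) (hX _ j.2)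
    · exact absurd (h ▸ glue_ext j) (hX' _ i.2)
    · exact absurd (h ▸ hY _ j.2) (hX _ i.2)
    · rw [Subtype.ext (hinj' _ _ h)]
  · intro h
    have hYs : ∀ h, inner h → ∃ j : {j // G.IsCut j}, G.rot.symm (G.ext j.1) = h := by
      intro h hh
      obtain ⟨j, hj⟩ := exists_ext (h3 h hh)
      have : G.rot.symm (G.ext j) = h := by rw [← hj, Equiv.symm_apply_apply]
      refine ⟨⟨j, ?_⟩, this⟩
      rw [IsCut, this]
      exact h1 h hh
    by_cases hh : G.glue h = h
    · obtain ⟨j, rfl⟩ := exists_ext hh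
      exact ⟨.inl j, rfl⟩
    · rcases h2 h hh with hi | hi
      · obtain ⟨j, hj⟩ := hYs h hi
        exact ⟨.inr (.inl j), hj⟩
      · obtain ⟨j, hj⟩ := hYs _ ((h5 h).mp hi)
        refine ⟨.inr (.inr j), ?_⟩
        rw [halfEdgeOf, hj, G.glue_glue]

end Relevant

/-- A relevant diagram is determined by its cuts. -/
theorem Relevant.isomorphic {G G' : NCDiagram n} (hG : G.Relevant) (hG' : G'.Relevant)
    (hcut : ∀ j, G.IsCut j ↔ G'.IsCut j) : Isomorphic G G' := by
  set κ := Equiv.ofBijective _ hG.halfEdgeOf_bijective with hκ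
  set κ' := Equiv.ofBijective _ hG'.halfEdgeOf_bijective with hκ'
  set σ : {j // G.IsCut j} ≃ {j // G'.IsCut j} := Equiv.subtypeEquivRight hcut with hσ
  set e : G.HalfEdge ≃ G'.HalfEdge :=
    κ.symm.trans ((Equiv.sumCongr (Equiv.refl _) (Equiv.sumCongr σ σ)).trans κ') with he
  have e1 : ∀ j, e (G.ext j) = G'.ext j := by
    intro j
    have : (G.ext j : G.HalfEdge) = κ (.inl j) := rfl
    rw [this, he, Equiv.trans_apply, Equiv.symm_apply_apply]
    rfl
  have e2 : ∀ j, G.IsCut j → e (G.rot.symm (G.ext j)) = G'.rot.symm (G'.ext j) := by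
    intro j hj
    have : G.rot.symm (G.ext j) = κ (.inr (.inl ⟨j, hj⟩)) := rfl
    rw [this, he, Equiv.trans_apply, Equiv.symm_apply_apply]
    rfl
  have e3 : ∀ j, G.IsCut j → e (G.glue (G.rot.symm (G.ext j)))
      = G'.glue (G'.rot.symm (G'.ext j)) := by
    intro j hj
    have : G.glue (G.rot.symm (G.ext j)) = κ (.inr (.inr ⟨j, hj⟩)) := rfl
    rw [this, he, Equiv.trans_apply, Equiv.symm_apply_apply]
    rfl
  have hglue : ∀ h, e (G.glue h) = G'.glue (e h) := by
    intro h
    obtain ⟨x, rfl⟩ := hG.halfEdgeOf_bijective.2 h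
    rcases x with j | ⟨j, hj⟩ | ⟨j, hj⟩ <;> simp only [halfEdgeOf]
    · rw [glue_ext, e1, glue_ext]
    · rw [e3 j hj, e2 j hj]
    · rw [G.glue_glue, e3 j hj, e2 j hj, G'.glue_glue]
  have hr1 : ∀ j, e (G.rot (G.ext j)) = G'.rot (e (G.ext j)) := by
    intro j
    rw [e1, hG.rot_ext, hG'.rot_ext]
    by_cases h : G.IsCut (finRotate n j)
    · have h' := (hcut _).mp h
      rw [if_neg h, if_neg h', e3 _ h]
    · have h' : ¬ G'.IsCut (finRotate n j) := fun h' => h ((hcut _).mpr h')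
      rw [IsCut, not_not] at h h'
      rw [if_pos h, if_pos h', e1]
  have hr2 : ∀ j, G.IsCut j → e (G.rot (G.rot.symm (G.ext j)))
      = G'.rot (e (G.rot.symm (G.ext j))) := by
    intro j hj
    rw [e2 j hj, Equiv.apply_symm_apply, Equiv.apply_symm_apply, e1]
  refine isomorphic_of_equiv hG.three_le_deg hG'.three_le_deg e (fun h => ?_) hglue e1
  obtain ⟨x, rfl⟩ := hG.halfEdgeOf_bijective.2 h
  rcases x with j | ⟨j, hj⟩ | ⟨j, hj⟩ <;> simp only [halfEdgeOf]
  · exact hr1 j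
  · exact hr2 j hj
  · obtain ⟨inner, h1, h2, h3, h4, h5, h6, h7⟩ := hG.exists_inner
    obtain ⟨inner', h1', h2', h3', h4', h5', h6', h7'⟩ := hG'.exists_inner
    have hin' : ∀ j, G'.IsCut j → inner' (G'.rot.symm (G'.ext j)) := by
      intro j hj
      refine (h2' _ hj).resolve_right fun hh => ?_
      rw [Equiv.apply_symm_apply] at hh
      exact h1' _ hh (glue_ext j)
    have hin : ∀ j, G.IsCut j → inner (G.rot.symm (G.ext j)) := by
      intro j hj
      refine (h2 _ hj).resolve_right fun hh => ?_
      rw [Equiv.apply_symm_apply] at hh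
      exact h1 _ hh (glue_ext j)
    have hYs : ∀ h, inner h → ∃ j, G.IsCut j ∧ G.rot.symm (G.ext j) = h := by
      intro h hh
      obtain ⟨j, hj⟩ := exists_ext (h3 h hh)
      have : G.rot.symm (G.ext j) = h := by rw [← hj, Equiv.symm_apply_apply]
      refine ⟨j, ?_, this⟩
      rw [IsCut, this]
      exact h1 h hh
    -- `X` is the half-edge of a vertex that precedes the inner one. Its successor is the half-edge
    -- before some cut `p`; it remains to see that the images of `X` and of this successor lie at
    -- the same vertex.
    set X := G.glue (G.rot.symm (G.ext j)) with hX
    have hrX : inner (G.rot X) := by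
      rw [h5, hX, G.glue_glue]
      exact hin j hj
    obtain ⟨p, hp, hpX⟩ := hYs _ hrX
    rw [← hpX, e2 p hp]
    have hvert : (G.rot.symm (G.ext p)).1 = X.1 := by rw [hpX]; rfl
    obtain ⟨m, hm⟩ : ∃ m, (G.rot ^ m) (G.rot.symm (G.ext p)) = X :=
      G.exists_rot_pow_eq hG.three_le_deg hvert
    -- Going around the vertex from the half-edge before `p`, only legs and the inner half-edge are
    -- met before `X`, and there `e` is already known to commute with `rot`.
    have hchain : ∀ i, (∀ i' < i, (G.rot ^ i') (G.rot.symm (G.ext p)) ≠ X) →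
        e ((G.rot ^ i) (G.rot.symm (G.ext p))) = (G'.rot ^ i) (G'.rot.symm (G'.ext p)) := by
      intro i
      induction i with
      | zero => intro _; rw [pow_zero, pow_zero]; exact e2 p hp
      | succ i ih =>
        intro hi
        rw [pow_succ', Equiv.Perm.mul_apply, pow_succ', Equiv.Perm.mul_apply,
          ← ih fun i' hi' => hi i' (by omega)]
        set z := (G.rot ^ i) (G.rot.symm (G.ext p)) with hz
        have hzX : z ≠ X := hi i (by omega)
        have hz1 : z.1 = X.1 := by rw [hz, rot_pow_fst, hvert]
        by_cases hzg : G.glue z = z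
        · obtain ⟨k, hk⟩ := exists_ext hzg
          rw [hk]
          exact hr1 k
        · rcases h2 z hzg with hzi | hzi
          · obtain ⟨k, hk, hkz⟩ := hYs z hzi
            rw [← hkz]
            exact hr2 k hk
          · exact absurd (G.rot.injective (h6 _ _ hzi hrX (by rw [rot_fst, rot_fst, hz1]))) hzX
    classical
    have hex : ∃ m, (G.rot ^ m) (G.rot.symm (G.ext p)) = X := ⟨m, hm⟩
    have hfin := hchain (Nat.find hex) fun i' hi' => Nat.find_min hex hi'
    rw [Nat.find_spec hex] at hfin
    -- A vertex has only one inner half-edge, so two inner half-edges at the same vertex agree.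
    refine h6' _ _ (hin' p ((hcut p).mp hp)) ?_ ?_
    · rw [e3 j hj, h5', G'.glue_glue]
      exact hin' j ((hcut j).mp hj)
    · rw [rot_fst, hfin, rot_pow_fst]

theorem Isomorphic.isCut_iff {G G' : NCDiagram n} (h : Isomorphic G G') (j : Fin n) :
    G.IsCut j ↔ G'.IsCut j := by
  obtain ⟨ν, e, h1, h2, h3, h4⟩ := h
  have h5 : ∀ h, e (G.rot.symm h) = G'.rot.symm (e h) := fun h => by
    rw [Equiv.eq_symm_apply, ← h2, Equiv.apply_symm_apply]
  rw [IsCut, IsCut, ← h4, ← h5, ← h3, e.injective.ne_iff]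

open Classical in
/-- The set of cuts of a class of relevant diagrams. -/
def RelevantClass.cuts (c : RelevantClass n) : Finset (Fin n) :=
  Finset.univ.filter fun j => c.out.1.IsCut j

theorem RelevantClass.cuts_injective :
    Function.Injective (RelevantClass.cuts : RelevantClass n → Finset (Fin n)) := by
  intro c c' h
  rw [← Quotient.out_eq c, ← Quotient.out_eq c']
  refine Quotient.sound (Relevant.isomorphic c.out.2 c'.out.2 fun j => ?_)
  have := congrArg (j ∈ ·) h
  simpa [RelevantClass.cuts] using this

instance RelevantClass.finite : Finite (RelevantClass n) :=
  Finite.of_injective _ RelevantClass.cuts_injective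

end NCDiagram

open scoped Fin.NatCast Fin.CommRing

/-! ### The standard diagrams -/

theorem finRotate_castSucc {m : ℕ} (i : Fin m) : finRotate (m + 1) i.castSucc = i.succ := by
  rw [finRotate_apply, Fin.coeSucc_eq_succ]

/-- An arrangement of the cyclically ordered set `Fin (n + 1)` in consecutive blocks: the `v`-th
block has `size v + 1` elements and is followed by the block `next v`. -/
structure CyclicBlocks (n : ℕ) where
  numBlocks : ℕ
  size : Fin numBlocks → ℕ
  next : Equiv.Perm (Fin numBlocks)
  label : ((v : Fin numBlocks) × Fin (size v + 1)) ≃ Fin (n + 1)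
  label_succ : ∀ v (j : Fin (size v)), label ⟨v, j.succ⟩ = label ⟨v, j.castSucc⟩ + 1
  label_next : ∀ v, label ⟨next v, 0⟩ = label ⟨v, Fin.last _⟩ + 1

namespace CyclicBlocks

variable {n : ℕ} (D : CyclicBlocks n)

/-- The half-edges of the loop diagram: at the vertex `v` these are, in clockwise order, `inc v`,
the external edges `leg v j`, and `out v`. -/
abbrev HE : Type := (v : Fin D.numBlocks) × Fin (D.size v + 1 + 2)

/-- The half-edge of the loop that comes from the preceding vertex. -/
def inc (v : Fin D.numBlocks) : D.HE := ⟨v, 0⟩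

/-- The half-edge of the loop that leads to the next vertex. -/
def out (v : Fin D.numBlocks) : D.HE := ⟨v, Fin.last _⟩

/-- The external edges. -/
def leg (v : Fin D.numBlocks) (j : Fin (D.size v + 1)) : D.HE := ⟨v, j.castSucc.succ⟩

@[elab_as_elim]
theorem cases_halfEdge {P : D.HE → Prop} (hi : ∀ v, P (D.inc v)) (ho : ∀ v, P (D.out v))
    (hl : ∀ v j, P (D.leg v j)) (h : D.HE) : P h := by
  obtain ⟨v, i⟩ := h
  induction i using Fin.cases with
  | zero => exact hi v
  | succ i =>
    induction i using Fin.lastCases with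
    | last => exact ho v
    | cast j => exact hl v j

/-- Functions on the half-edges. -/
def elim {X : Type*} (i o : Fin D.numBlocks → X) (l : (v : Fin D.numBlocks) → Fin (D.size v + 1) → X)
    (h : D.HE) : X :=
  Fin.cases (motive := fun _ => X) (i h.1)
    (fun k => Fin.lastCases (motive := fun _ => X) (o h.1) (fun j => l h.1 j) k) h.2

variable {X : Type*} (i o : Fin D.numBlocks → X)
  (l : (v : Fin D.numBlocks) → Fin (D.size v + 1) → X)

@[simp] theorem elim_inc (v) : D.elim i o l (D.inc v) = i v := rfl

@[simp] theorem elim_out (v) : D.elim i o l (D.out v) = o v := by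
  change Fin.lastCases (motive := fun _ => X) (o v) (fun j => l v j) (Fin.last _) = _
  rw [Fin.lastCases_last]

@[simp] theorem elim_leg (v j) : D.elim i o l (D.leg v j) = l v j := by
  simp only [elim, leg, Fin.cases_succ, Fin.lastCases_castSucc]

/-- The gluing of the loop. -/
def glueFun : D.HE → D.HE :=
  D.elim (fun v => D.out (D.next.symm v)) (fun v => D.inc (D.next v)) fun v j => D.leg v j

theorem leg_eq_or (h : D.HE) : (D.glueFun h = h ↔ ∃ v j, h = D.leg v j) := by
  have hio : ∀ v w, D.inc v ≠ D.out w := fun v w e => by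
    have h1 := congrArg (D.elim (fun _ => true) (fun _ => false) (fun _ _ => false)) e
    simp at h1
  have hil : ∀ v w j, D.inc v ≠ D.leg w j := fun v w j e => by
    have h1 := congrArg (D.elim (fun _ => true) (fun _ => false) (fun _ _ => false)) e
    simp at h1
  have hol : ∀ v w j, D.out v ≠ D.leg w j := fun v w j e => by
    have h1 := congrArg (D.elim (fun _ => true) (fun _ => true) (fun _ _ => false)) e
    simp at h1
  refine D.cases_halfEdge (fun v => ?_) (fun v => ?_) (fun v j => ?_) h
  · simp [glueFun, (hio _ _).symm, hil]
  · simp [glueFun, hio, hol]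
  · simp only [glueFun, elim_leg, true_iff]
    exact ⟨v, j, rfl⟩

theorem leg_injective : Function.Injective fun x : (v : Fin D.numBlocks) × Fin (D.size v + 1) =>
    D.leg x.1 x.2 := by
  rintro ⟨v, j⟩ ⟨w, k⟩ h
  have h1 : v = w := congrArg Sigma.fst h
  subst h1
  have h2 : j = k := Fin.castSucc_injective _ (Fin.succ_injective _ (eq_of_heq (Sigma.mk.inj h).2))
  rw [h2]

/-- The diagram that consists of one loop, with the given blocks of external edges. -/
abbrev diagram : NCDiagram (n + 1) where
  numVert := D.numBlocks
  deg v := D.size v + 1 + 2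
  glue := D.glueFun
  glue_glue := D.cases_halfEdge (fun v => by simp [glueFun]) (fun v => by simp [glueFun])
    fun v j => by simp [glueFun]
  ext := D.label.symm.trans <| Equiv.ofBijective
    (fun x => ⟨D.leg x.1 x.2, (D.leg_eq_or _).mpr ⟨_, _, rfl⟩⟩)
    ⟨fun x y h => D.leg_injective (Subtype.ext_iff.mp h), fun h => by
      obtain ⟨v, j, hj⟩ := (D.leg_eq_or _).mp h.2
      exact ⟨⟨v, j⟩, Subtype.ext hj.symm⟩⟩

@[simp] theorem glue_inc (v) : D.diagram.glue (D.inc v) = D.out (D.next.symm v) := by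
  change D.glueFun _ = _
  simp [glueFun]

@[simp] theorem glue_out (v) : D.diagram.glue (D.out v) = D.inc (D.next v) := by
  change D.glueFun _ = _
  simp [glueFun]

@[simp] theorem glue_leg (v j) : D.diagram.glue (D.leg v j) = D.leg v j := by
  change D.glueFun _ = _
  simp [glueFun]

@[simp] theorem ext_label (v j) : (D.diagram.ext (D.label ⟨v, j⟩) : D.HE) = D.leg v j := by
  have h : ∀ i, (D.diagram.ext i : D.HE) = D.leg (D.label.symm i).1 (D.label.symm i).2 := fun _ => rfl
  rw [h, Equiv.symm_apply_apply]

@[simp] theorem rot_inc (v) : D.diagram.rot (D.inc v) = D.leg v 0 := by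
  change (⟨v, finRotate _ 0⟩ : D.HE) = ⟨v, _⟩
  rw [finRotate_apply, zero_add]
  rfl

@[simp] theorem rot_leg_castSucc (v) (j : Fin (D.size v)) :
    D.diagram.rot (D.leg v j.castSucc) = D.leg v j.succ := by
  change (⟨v, finRotate _ j.castSucc.castSucc.succ⟩ : D.HE) = ⟨v, _⟩
  rw [← Fin.castSucc_succ, ← Fin.castSucc_succ, finRotate_castSucc]

@[simp] theorem rot_leg_last (v) : D.diagram.rot (D.leg v (Fin.last _)) = D.out v := by
  change (⟨v, finRotate _ (Fin.last _).castSucc.succ⟩ : D.HE) = ⟨v, _⟩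
  rw [← Fin.castSucc_succ, finRotate_castSucc]
  rfl

@[simp] theorem rot_out (v) : D.diagram.rot (D.out v) = D.inc v := by
  change (⟨v, finRotate _ (Fin.last _)⟩ : D.HE) = ⟨v, _⟩
  rw [finRotate_last]

theorem glue_inc_ne (v) : D.diagram.glue (D.inc v) ≠ D.inc v := fun e => by
  obtain ⟨w, j, h⟩ := (D.leg_eq_or (D.inc v)).mp e
  have h1 := congrArg (D.elim (fun _ => true) (fun _ => false) (fun _ _ => false)) h
  simp at h1

theorem glue_out_ne (v) : D.diagram.glue (D.out v) ≠ D.out v := fun e => by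
  obtain ⟨w, j, h⟩ := (D.leg_eq_or (D.out v)).mp e
  have h1 := congrArg (D.elim (fun _ => true) (fun _ => true) (fun _ _ => false)) h
  simp at h1

theorem inc_ne_out (v w) : D.inc v ≠ D.out w := fun e => by
  have h1 := congrArg (D.elim (fun _ => true) (fun _ => false) (fun _ _ => false)) e
  simp at h1

theorem inc_ne_leg (v w j) : D.inc v ≠ D.leg w j := fun e => by
  have h1 := congrArg (D.elim (fun _ => true) (fun _ => false) (fun _ _ => false)) e
  simp at h1

theorem inc_injective : Function.Injective D.inc := fun _ _ h => congrArg Sigma.fst h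

theorem out_injective : Function.Injective D.out := fun _ _ h => congrArg Sigma.fst h

/-- The block of a label. -/
def blockOf (i : Fin (n + 1)) : Fin D.numBlocks := (D.label.symm i).1

@[simp] theorem blockOf_label (v j) : D.blockOf (D.label ⟨v, j⟩) = v := by simp [blockOf]

theorem exists_label (i : Fin (n + 1)) : ∃ v j, i = D.label ⟨v, j⟩ :=
  ⟨_, _, (D.label.apply_symm_apply i).symm⟩

/-- Induction along the consecutive labels, starting from any of them. -/
theorem blockOf_induction {P : Fin D.numBlocks → Prop} (i₀ : Fin (n + 1)) (h0 : P (D.blockOf i₀))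
    (h : ∀ v, D.label ⟨D.next v, 0⟩ ≠ i₀ → P v → P (D.next v)) (v : Fin D.numBlocks) : P v := by
  -- Fewer than `n + 1` steps are made, so the label `i₀` is never entered again. The extra
  -- hypothesis of the induction step is thus available, which is what allows the loop to be opened
  -- at `i₀`.
  have key : ∀ m : ℕ, m ≤ n → P (D.blockOf (i₀ + (m : Fin (n + 1)))) := by
    intro m
    induction m with
    | zero => intro _; simpa using h0
    | succ m ih =>
      intro hm
      have ih := ih (by omega)
      obtain ⟨w, j, hj⟩ := D.exists_label (i₀ + (m : Fin (n + 1)))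
      rw [Nat.cast_succ, ← add_assoc]
      rw [hj] at ih ⊢
      rw [blockOf_label] at ih
      induction j using Fin.lastCases with
      | last =>
        rw [← D.label_next, blockOf_label]
        refine h w (fun e => ?_) ih
        rw [D.label_next, ← hj, add_assoc, ← Nat.cast_succ, add_eq_left,
          Fin.natCast_eq_zero] at e
        exact absurd (Nat.le_of_dvd (by omega) e) (by omega)
      | cast j => rwa [← D.label_succ, blockOf_label]
  have h1 := key (D.label ⟨v, 0⟩ - i₀).val (by omega)
  rwa [Fin.cast_val_eq_self, add_sub_cancel, blockOf_label] at h1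

/-- A loop without one of its propagators is a chain of vertices that begins at `D.next v₀`. -/
theorem connectedWithout_pair (v₀ : Fin D.numBlocks) :
    D.diagram.ConnectedWithout {D.out v₀, D.inc (D.next v₀)} := by
  refine ⟨Fin.pos v₀, ?_⟩
  set R : Set D.HE := {D.out v₀, D.inc (D.next v₀)} with hR
  have hglue : ∀ h, D.diagram.glue h ∈ R → h ∈ R := by
    intro h hh
    rcases hh with hh | hh
    · have := congrArg D.diagram.glue hh
      rw [D.diagram.glue_glue, glue_out] at this
      exact Or.inr this
    · have := congrArg D.diagram.glue hh
      rw [D.diagram.glue_glue, glue_inc, Equiv.symm_apply_apply] at this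
      exact Or.inl this
  set r : Fin D.numBlocks → Fin D.numBlocks → Prop :=
    fun v w => ∃ h : D.diagram.HalfEdge, h ∉ R ∧ h.1 = v ∧ (D.diagram.glue h).1 = w with hr
  have hsymm : Std.Symm r := ⟨by
    rintro v w ⟨h, h1, h2, h3⟩
    exact ⟨D.diagram.glue h, fun e => h1 (hglue _ e), h3, by rw [D.diagram.glue_glue]; exact h2⟩⟩
  have h1 : ∀ v, Relation.ReflTransGen r (D.next v₀) v := by
    refine D.blockOf_induction (D.label ⟨D.next v₀, 0⟩) ?_ fun v hv ih => ih.tail ?_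
    · rw [blockOf_label]
    · refine ⟨D.out v, ?_, rfl, by rw [glue_out]; rfl⟩
      rintro (e | e)
      · rw [D.out_injective e] at hv
        exact hv rfl
      · exact D.inc_ne_out _ _ (Set.mem_singleton_iff.mp e).symm
  intro v w
  exact (Relation.ReflTransGen.stdSymm.symm _ _ (h1 v)).trans (h1 w)

/-- There are as many propagators as vertices and exactly two faces, so Euler's formula holds. The
inner face consists of the `D.inc v`, the outer one of all other half-edges. -/
theorem relevant : D.diagram.Relevant := by
  have v₀ : Fin D.numBlocks := D.blockOf 0
  have hcon : D.diagram.ConnectedWithout ∅ := by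
    obtain ⟨h1, h2⟩ := D.connectedWithout_pair v₀
    refine ⟨h1, fun v w => Relation.ReflTransGen.mono ?_ v w (h2 v w)⟩
    rintro a b ⟨h, -, h3⟩
    exact ⟨h, by simp, h3⟩
  have hlen : D.diagram.propagators.length = D.numBlocks := by
    have h1 := D.diagram.sum_card_internalAt
    have h2 : ∀ w, (D.diagram.internalAt w).card = 2 := by
      intro w
      have : D.diagram.internalAt w = {D.inc w, D.out w} := by
        ext h
        rw [NCDiagram.mem_internalAt, Finset.mem_insert, Finset.mem_singleton]
        constructor
        · rintro ⟨h3, h4⟩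
          subst h3
          revert h4
          refine D.cases_halfEdge (fun v _ => Or.inl rfl) (fun v _ => Or.inr rfl)
            (fun v j h4 => absurd (D.glue_leg v j) h4) h
        · rintro (rfl | rfl)
          · exact ⟨rfl, D.glue_inc_ne w⟩
          · exact ⟨rfl, D.glue_out_ne w⟩
      rw [this]
      exact Finset.card_pair (D.inc_ne_out w w)
    simp only [h2, Finset.sum_const, Finset.card_univ, Fintype.card_fin, smul_eq_mul] at h1
    have : D.diagram.numVert = D.numBlocks := rfl
    omega
  -- The walk along the inner face visits the vertices against the order of `D.next`, the walk along
  -- the outer face follows that order.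
  have f1 : ∀ v, D.diagram.faceStep (D.inc v) = D.inc (D.next.symm v) := fun v => by
    rw [NCDiagram.faceStep_apply, glue_inc, rot_out]
  have f2 : ∀ v (j : Fin (D.size v)), D.diagram.faceStep (D.leg v j.castSucc) = D.leg v j.succ :=
    fun v j => by rw [NCDiagram.faceStep_apply, glue_leg, rot_leg_castSucc]
  have f3 : ∀ v, D.diagram.faceStep (D.leg v (Fin.last _)) = D.out v := fun v => by
    rw [NCDiagram.faceStep_apply, glue_leg, rot_leg_last]
  have f4 : ∀ v, D.diagram.faceStep (D.out v) = D.leg (D.next v) 0 := fun v => by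
    rw [NCDiagram.faceStep_apply, glue_out, rot_inc]
  have hinner : ∀ v, D.diagram.faceStep.SameCycle (D.inc v₀) (D.inc v) := by
    refine D.blockOf_induction (D.label ⟨v₀, 0⟩) (by rw [blockOf_label]) fun v _ ih => ?_
    rw [← Equiv.Perm.sameCycle_apply_right, f1, Equiv.symm_apply_apply]
    exact ih
  have houter1 : ∀ v (j : Fin (D.size v + 1)),
      D.diagram.faceStep.SameCycle (D.leg v 0) (D.leg v j) := by
    intro v j
    induction j using Fin.induction with
    | zero => exact Equiv.Perm.SameCycle.refl _ _
    | succ j ih => rwa [← f2, Equiv.Perm.sameCycle_apply_right]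
  have houter2 : ∀ v, D.diagram.faceStep.SameCycle (D.leg v₀ 0) (D.leg v 0) := by
    refine D.blockOf_induction (D.label ⟨v₀, 0⟩) (by rw [blockOf_label]) fun v _ ih => ?_
    rw [← f4, Equiv.Perm.sameCycle_apply_right, ← f3, Equiv.Perm.sameCycle_apply_right]
    exact ih.trans (houter1 v _)
  have hnot : ∀ h, D.diagram.faceStep.SameCycle (D.inc v₀) h → ∃ v, h = D.inc v := by
    intro h hh
    obtain ⟨m, -, hm⟩ := hh.exists_pow_eq'
    have : ∀ m : ℕ, ∃ v, (D.diagram.faceStep ^ m) (D.inc v₀) = D.inc v := by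
      intro m
      induction m with
      | zero => exact ⟨v₀, rfl⟩
      | succ m ih =>
        obtain ⟨v, hv⟩ := ih
        exact ⟨_, by rw [pow_succ', Equiv.Perm.mul_apply, hv, f1]⟩
    rw [← hm]
    exact this m
  have hfaces : D.diagram.numFaces = 2 := by
    rw [NCDiagram.numFaces, Nat.card_eq_two_iff]
    refine ⟨Quotient.mk _ (D.inc v₀), Quotient.mk _ (D.leg v₀ 0), fun e => ?_, ?_⟩
    · obtain ⟨v, hv⟩ := hnot _ (Quotient.exact e)
      exact D.inc_ne_leg _ _ _ hv.symm
    · rw [Set.eq_univ_iff_forall]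
      intro q
      induction q using Quotient.inductionOn with
      | h h =>
        revert h
        refine D.cases_halfEdge (fun v => Or.inl (Quotient.sound (hinner v).symm)) (fun v => Or.inr ?_)
          (fun v j => Or.inr (Quotient.sound ((houter2 v).trans (houter1 v j)).symm))
        refine Quotient.sound (Equiv.Perm.SameCycle.symm ?_)
        rw [← f3, Equiv.Perm.sameCycle_apply_right]
        exact (houter2 v).trans (houter1 v _)
  refine ⟨⟨hcon, ?_⟩, ?_, ?_, fun v => ?_, ⟨D.inc v₀, fun i hi => ?_⟩, fun i => ?_⟩
  · rw [hlen, hfaces]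
    change (D.numBlocks : ℤ) - _ + _ = _
    simp
  · rw [NCDiagram.loopOrder, hlen]
    change 1 - (D.numBlocks : ℤ) + _ = _
    simp
  · refine D.cases_halfEdge (fun v _ => ?_) (fun v _ => ?_) (fun v j h => ?_)
    · have := D.connectedWithout_pair (D.next.symm v)
      rw [Equiv.apply_symm_apply] at this
      rw [glue_inc, Set.pair_comm]
      exact this
    · rw [glue_out]
      exact D.connectedWithout_pair v
    · exact absurd (D.glue_leg v j) h
  · change 3 ≤ D.size v + 1 + 2
    omega
  · obtain ⟨v, hv⟩ := hnot _ hi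
    obtain ⟨w, j, rfl⟩ := D.exists_label i
    rw [ext_label] at hv
    exact D.inc_ne_leg _ _ _ hv.symm
  · obtain ⟨v, j, rfl⟩ := D.exists_label i
    rw [finRotate_apply]
    induction j using Fin.lastCases with
    | last =>
      refine ⟨2, two_pos, ?_, fun l hl hl' => ?_⟩
      · rw [pow_two, Equiv.Perm.mul_apply, ext_label, f3, f4, ← D.label_next, ext_label]
      · obtain rfl : l = 1 := by omega
        rw [pow_one, ext_label, f3]
        exact D.glue_out_ne v
    | cast j =>
      refine ⟨1, one_pos, ?_, fun l hl hl' => by omega⟩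
      rw [pow_one, ext_label, f2, ← D.label_succ, ext_label]

theorem isCut_iff (i : Fin (n + 1)) : D.diagram.IsCut i ↔ ∃ v, i = D.label ⟨v, 0⟩ := by
  obtain ⟨v, j, rfl⟩ := D.exists_label i
  rw [NCDiagram.IsCut, ext_label]
  induction j using Fin.cases with
  | zero =>
    rw [show D.diagram.rot.symm (D.leg v 0) = D.inc v by
      rw [Equiv.symm_apply_eq, rot_inc]]
    exact ⟨fun _ => ⟨v, rfl⟩, fun _ => D.glue_inc_ne v⟩
  | succ j =>
    rw [show D.diagram.rot.symm (D.leg v j.succ) = D.leg v j.castSucc by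
      rw [Equiv.symm_apply_eq, rot_leg_castSucc]]
    refine ⟨fun h => absurd (D.glue_leg v _) h, ?_⟩
    rintro ⟨w, hw⟩
    have h1 := D.label.injective hw
    obtain rfl : v = w := congrArg Sigma.fst h1
    have h2 := eq_of_heq (Sigma.mk.inj h1).2
    exact absurd h2 (Fin.succ_ne_zero j)

/-- The index sum of a loop diagram; `a` is the index of the inner face. -/
theorem indexSum_eq {I : Type*} [Fintype I] (c : Multiset I → ℂ) (p : I → I → I → I → ℂ)
    (g : I → I → ℂ) (hp : ∀ i j k l, p i j k l = p k l i j)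
    (hp0 : ∀ i j k l, ¬ (i = l ∧ j = k) → p i j k l = 0) (hg : ∀ i j, p i j j i = g i j)
    (v : Fin (n + 1) → I → I → ℂ) :
    D.diagram.indexSum c p v = ∑ a : I, ∑ x : Fin (n + 1) → I,
      (∏ w, -g (x (D.label ⟨D.next w, 0⟩)) a * c (a ::ₘ x (D.label ⟨D.next w, 0⟩) ::ₘ
        Finset.univ.val.map fun j => x (D.label ⟨w, j⟩))) * ∏ i, v i (x i) (x (i + 1)) := by
  have v₀ : Fin D.numBlocks := D.blockOf 0
  -- The propagator that leaves the vertex `w` is listed either as `D.out w` or as `D.inc (D.next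
  -- w)`; a function invariant under gluing does not see which.
  have hprop : ∀ t : D.HE → ℂ, (∀ h, t (D.diagram.glue h) = t h) →
      (D.diagram.propagators.map t).prod = ∏ w, t (D.out w) := by
    intro t ht
    rw [← List.prod_toFinset _ D.diagram.propagators_nodup]
    symm
    refine Finset.prod_bij (fun w _ => if D.out w ∈ D.diagram.propagators then D.out w
      else D.inc (D.next w)) (fun w _ => ?_) (fun w _ w' _ h => ?_) (fun h hh => ?_) (fun w _ => ?_)
    · rw [List.mem_toFinset]
      split_ifs with hw
      · exact hw
      · by_contra hw'
        rw [← glue_out] at hw'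
        exact D.glue_out_ne w (D.diagram.notMem_propagators_iff.mp ⟨hw, hw'⟩)
    · split_ifs at h
      · exact D.out_injective h
      · exact absurd h.symm (D.inc_ne_out _ _)
      · exact absurd h (D.inc_ne_out _ _)
      · exact D.next.injective (D.inc_injective h)
    · rw [List.mem_toFinset] at hh
      revert hh
      refine D.cases_halfEdge (fun w hw => ⟨D.next.symm w, Finset.mem_univ _, ?_⟩)
        (fun w hw => ⟨w, Finset.mem_univ _, if_pos hw⟩)
        (fun w j hw => absurd (D.glue_leg w j) (D.diagram.glue_ne_of_mem_propagators hw)) h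
      rw [Equiv.apply_symm_apply, if_neg]
      intro hw'
      have h1 := (NCDiagram.mem_propagators _).mp hw
      have h2 := (NCDiagram.mem_propagators _).mp hw'
      rw [glue_inc] at h1
      rw [glue_out, Equiv.apply_symm_apply] at h2
      exact h1.not_gt h2
    · split_ifs
      · rfl
      · rw [← glue_out, ht]
  have hterm : ∀ ι : D.HE → I, (D.diagram.propagators.map fun h =>
      -p (ι h) (ι (D.diagram.rot h)) (ι (D.diagram.glue h))
        (ι (D.diagram.rot (D.diagram.glue h)))).prod
      = ∏ w, -p (ι (D.out w)) (ι (D.inc w)) (ι (D.inc (D.next w))) (ι (D.leg (D.next w) 0)) := by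
    intro ι
    rw [hprop]
    · refine Finset.prod_congr rfl fun w _ => ?_
      rw [rot_out, glue_out, rot_inc]
    · intro h
      rw [D.diagram.glue_glue, hp]
  rw [NCDiagram.indexSum, ← Finset.sum_product', Finset.univ_product_univ]
  symm
  -- The propagators force the indices to agree along the faces. What survives is one common index
  -- `a` of all `D.inc v` and one free index for each leg, with `D.out w` sharing the index of the
  -- first leg of the next vertex.
  refine Fintype.sum_of_injective (fun ax : I × (Fin (n + 1) → I) =>
    D.elim (fun _ => ax.1) (fun w => ax.2 (D.label ⟨D.next w, 0⟩)) fun w j => ax.2 (D.label ⟨w, j⟩))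
    ?_ _ _ ?_ ?_
  · rintro ⟨a, x⟩ ⟨a', x'⟩ h
    have h1 := congrFun h (D.inc v₀)
    have h2 : x = x' := by
      funext i
      obtain ⟨w, j, rfl⟩ := D.exists_label i
      have := congrFun h (D.leg w j)
      simpa using this
    simp only [elim_inc] at h1
    rw [h1, h2]
  · intro ι hι
    rw [hterm]
    by_contra hne
    refine hι ⟨(ι (D.inc v₀), fun i => ι (D.diagram.ext i)), ?_⟩
    have hne2 : ∀ w, ι (D.out w) = ι (D.leg (D.next w) 0) ∧ ι (D.inc w) = ι (D.inc (D.next w)) := by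
      intro w
      by_contra hcon
      refine hne (mul_eq_zero_of_right _ (Finset.prod_eq_zero (Finset.mem_univ w) ?_))
      rw [hp0 _ _ _ _ hcon, neg_zero]
    have hconst : ∀ v, ι (D.inc v₀) = ι (D.inc v) := by
      refine D.blockOf_induction (D.label ⟨v₀, 0⟩) (by rw [blockOf_label]) fun v _ ih => ?_
      rw [ih, (hne2 v).2]
    funext h
    refine D.cases_halfEdge (fun v => ?_) (fun v => ?_) (fun v j => ?_) h
    · beta_reduce
      rw [elim_inc]
      exact hconst v
    · beta_reduce
      rw [elim_out]
      dsimp only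
      rw [ext_label, (hne2 v).1]
    · beta_reduce
      rw [elim_leg]
      dsimp only
      rw [ext_label]
  · rintro ⟨a, x⟩
    rw [hterm]
    simp only [elim_inc, elim_out, elim_leg, hg]
    set ι : D.HE → I := D.elim (fun _ => a) (fun w => x (D.label ⟨D.next w, 0⟩))
      fun w j => x (D.label ⟨w, j⟩) with hι
    have h1 : ∀ w, (Finset.univ.val.map fun k : Fin (D.size w + 1 + 2) => ι ⟨w, k⟩)
        = a ::ₘ x (D.label ⟨D.next w, 0⟩) ::ₘ Finset.univ.val.map fun j => x (D.label ⟨w, j⟩) := by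
      intro w
      have e1 : ∀ (m : ℕ) (F : Fin (m + 2) → I), (Finset.univ.val.map F)
          = F 0 ::ₘ F (Fin.last _) ::ₘ Finset.univ.val.map fun j : Fin m => F j.castSucc.succ := by
        intro m F
        rw [Fin.univ_succ, Finset.cons_val, Multiset.map_cons, Finset.map_val, Multiset.map_map,
          Fin.univ_castSuccEmb, Finset.cons_val, Multiset.map_cons, Finset.map_val,
          Multiset.map_map]
        rfl
      have h0 : ι ⟨w, 0⟩ = a := D.elim_inc _ _ _ w
      have h2 : ι ⟨w, Fin.last _⟩ = x (D.label ⟨D.next w, 0⟩) := D.elim_out _ _ _ w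
      have h3 : ∀ j, ι ⟨w, Fin.succ (Fin.castSucc j)⟩ = x (D.label ⟨w, j⟩) :=
        fun j => D.elim_leg _ _ _ w j
      rw [e1, h0, h2]
      simp only [h3]
    have h2 : ∀ i, v i (ι (D.diagram.ext i)) (ι (D.diagram.rot (D.diagram.ext i)))
        = v i (x i) (x (i + 1)) := by
      intro i
      obtain ⟨w, j, rfl⟩ := D.exists_label i
      rw [ext_label]
      induction j using Fin.lastCases with
      | last => rw [rot_leg_last, ← D.label_next, hι, elim_leg, elim_out]
      | cast j => rw [rot_leg_castSucc, ← D.label_succ, hι, elim_leg, elim_leg]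
    change _ = (∏ w : Fin D.numBlocks, c (Finset.univ.val.map fun k => ι ⟨w, k⟩)) * _ * _
    simp only [h1, h2]
    rw [Finset.prod_mul_distrib]
    ring

end CyclicBlocks

open scoped Fin.NatCast Fin.CommRing

/-! ### From sets of cuts to loop diagrams. -/

section Cuts

variable {n : ℕ} (S : Finset (Fin (n + 1)))

/-- The number of steps, minus one, from `i` back to the preceding cut. -/
def backGap (i : Fin (n + 1)) : ℕ := sInf {m : ℕ | i - ((m + 1 : ℕ) : Fin (n + 1)) ∈ S}

/-- The number of steps, minus one, from `i` forward to the next cut. -/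
def foreGap (i : Fin (n + 1)) : ℕ := sInf {m : ℕ | i + ((m + 1 : ℕ) : Fin (n + 1)) ∈ S}

variable {S}

theorem sub_backGap_mem (hS : S.Nonempty) (i : Fin (n + 1)) :
    i - ((backGap S i + 1 : ℕ) : Fin (n + 1)) ∈ S := by
  obtain ⟨s, hs⟩ := hS
  refine Nat.sInf_mem (s := {m : ℕ | i - ((m + 1 : ℕ) : Fin (n + 1)) ∈ S}) ⟨(i - s - 1).val, ?_⟩
  rw [Set.mem_ofPred_eq, Nat.cast_succ, Fin.cast_val_eq_self]
  convert hs using 1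
  ring

theorem add_foreGap_mem (hS : S.Nonempty) (i : Fin (n + 1)) :
    i + ((foreGap S i + 1 : ℕ) : Fin (n + 1)) ∈ S := by
  obtain ⟨s, hs⟩ := hS
  refine Nat.sInf_mem (s := {m : ℕ | i + ((m + 1 : ℕ) : Fin (n + 1)) ∈ S}) ⟨(s - i - 1).val, ?_⟩
  rw [Set.mem_ofPred_eq, Nat.cast_succ, Fin.cast_val_eq_self]
  convert hs using 1
  ring

theorem sub_notMem_of_lt_backGap {i : Fin (n + 1)} {m : ℕ} (hm : m < backGap S i) :
    i - ((m + 1 : ℕ) : Fin (n + 1)) ∉ S := Nat.notMem_of_lt_sInf hm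

theorem add_notMem_of_lt_foreGap {i : Fin (n + 1)} {m : ℕ} (hm : m < foreGap S i) :
    i + ((m + 1 : ℕ) : Fin (n + 1)) ∉ S := Nat.notMem_of_lt_sInf hm

theorem backGap_eq {i : Fin (n + 1)} {m : ℕ} (h : i - ((m + 1 : ℕ) : Fin (n + 1)) ∈ S)
    (h' : ∀ k < m, i - ((k + 1 : ℕ) : Fin (n + 1)) ∉ S) : backGap S i = m :=
  le_antisymm (Nat.sInf_le h) (not_lt.mp fun hlt => h' _ hlt
    (Nat.sInf_mem (s := {m : ℕ | i - ((m + 1 : ℕ) : Fin (n + 1)) ∈ S}) ⟨m, h⟩))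

theorem foreGap_eq {i : Fin (n + 1)} {m : ℕ} (h : i + ((m + 1 : ℕ) : Fin (n + 1)) ∈ S)
    (h' : ∀ k < m, i + ((k + 1 : ℕ) : Fin (n + 1)) ∉ S) : foreGap S i = m :=
  le_antisymm (Nat.sInf_le h) (not_lt.mp fun hlt => h' _ hlt
    (Nat.sInf_mem (s := {m : ℕ | i + ((m + 1 : ℕ) : Fin (n + 1)) ∈ S}) ⟨m, h⟩))

/-- The labels of the block that ends at the cut `s`. -/
theorem foreGap_block {s : Fin (n + 1)} (hs : s ∈ S) {j : ℕ} (hj : j ≤ backGap S s) :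
    foreGap S (s - ((backGap S s + 1 : ℕ) : Fin (n + 1)) + (j : Fin (n + 1)))
      = backGap S s - j := by
  obtain ⟨k, hk⟩ := Nat.exists_eq_add_of_le hj
  rw [hk, Nat.add_sub_cancel_left]
  refine foreGap_eq ?_ fun m hm => ?_
  · convert hs using 1
    push_cast
    ring
  · obtain ⟨l, rfl⟩ := Nat.exists_eq_add_of_lt hm
    have := sub_notMem_of_lt_backGap (S := S) (i := s) (m := l) (by omega)
    convert this using 2
    push_cast
    ring

theorem backGap_add_foreGap {i : Fin (n + 1)} (m : ℕ) (hm : m < foreGap S i) :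
    (i + ((foreGap S i + 1 : ℕ) : Fin (n + 1))) - ((m + 1 : ℕ) : Fin (n + 1)) ∉ S := by
  obtain ⟨l, hl⟩ := Nat.exists_eq_add_of_lt hm
  have := add_notMem_of_lt_foreGap (S := S) (i := i) (m := l) (by omega)
  convert this using 2
  rw [hl]
  push_cast
  ring

theorem backGap_next {s : Fin (n + 1)} (hs : s ∈ S) :
    backGap S (s + ((foreGap S s + 1 : ℕ) : Fin (n + 1))) = foreGap S s := by
  refine backGap_eq ?_ backGap_add_foreGap
  rwa [add_sub_cancel_right]

theorem foreGap_le_backGap (hS : S.Nonempty) (i : Fin (n + 1)) :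
    foreGap S i ≤ backGap S (i + ((foreGap S i + 1 : ℕ) : Fin (n + 1))) :=
  not_lt.mp fun h => backGap_add_foreGap _ h (sub_backGap_mem hS _)

theorem backGap_add_one (hS : S.Nonempty) (i : Fin (n + 1)) :
    backGap S (i + 1) = if i ∈ S then 0 else backGap S i + 1 := by
  split_ifs with h
  · refine backGap_eq ?_ (by simp)
    simpa using h
  · refine backGap_eq ?_ fun k hk => ?_
    · convert sub_backGap_mem hS i using 1
      push_cast
      ring
    · rcases k with _ | k
      · simpa using h
      · convert sub_notMem_of_lt_backGap (S := S) (i := i) (m := k) (by omega) using 2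
        push_cast
        ring

/-- `foreGap` recovers from a label the cut at which its block ends, and with it the position in the
block. -/
theorem blockLabel_bijective (hS : S.Nonempty) : Function.Bijective
    fun x : (v : Fin S.card) × Fin (backGap S (S.equivFin.symm v) + 1) =>
      ((S.equivFin.symm x.1 : Fin (n + 1)) - ((backGap S (S.equivFin.symm x.1) + 1 : ℕ) : Fin (n + 1))
        + ((x.2 : ℕ) : Fin (n + 1)) : Fin (n + 1)) := by
  constructor
  · rintro ⟨v, j⟩ ⟨w, k⟩ h
    dsimp only at h
    have h1 := foreGap_block (S.equivFin.symm v).2 (Nat.lt_succ_iff.mp j.2)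
    have h2 := foreGap_block (S.equivFin.symm w).2 (Nat.lt_succ_iff.mp k.2)
    have key : ∀ (s : Fin (n + 1)) {b j : ℕ}, j ≤ b → s = (s - ((b + 1 : ℕ) : Fin (n + 1))
        + (j : Fin (n + 1))) + ((b - j + 1 : ℕ) : Fin (n + 1)) := by
      intro s b j hj
      obtain ⟨l, rfl⟩ := Nat.exists_eq_add_of_le hj
      rw [Nat.add_sub_cancel_left]
      push_cast
      ring
    have h3 : v = w := by
      rw [← S.equivFin.symm.injective.eq_iff, Subtype.ext_iff,
        key (S.equivFin.symm v) (Nat.lt_succ_iff.mp j.2),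
        key (S.equivFin.symm w) (Nat.lt_succ_iff.mp k.2), ← h1, ← h2, h]
    subst h3
    rw [h, h2] at h1
    have hj := j.2
    have hk := k.2
    have : j = k := Fin.ext (by omega)
    rw [this]
  · intro i
    set t := i + ((foreGap S i + 1 : ℕ) : Fin (n + 1)) with ht
    have hle := foreGap_le_backGap hS i
    rw [← ht] at hle
    have h1 : (S.equivFin.symm (S.equivFin ⟨t, add_foreGap_mem hS i⟩) : Fin (n + 1)) = t := by
      rw [Equiv.symm_apply_apply]
    refine ⟨⟨S.equivFin ⟨t, add_foreGap_mem hS i⟩, ⟨backGap S t - foreGap S i, ?_⟩⟩, ?_⟩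
    · rw [h1]
      omega
    · dsimp only
      rw [h1]
      obtain ⟨l, hl⟩ := Nat.exists_eq_add_of_le hle
      rw [hl, Nat.add_sub_cancel_left, ht]
      push_cast
      ring

/-- The gap behind the next cut is the gap in front of the given one, so the given cut can be
recovered. -/
theorem nextCut_injective (hS : S.Nonempty) : Function.Injective fun s : S =>
    (⟨s.1 + ((foreGap S s.1 + 1 : ℕ) : Fin (n + 1)), add_foreGap_mem hS s.1⟩ : S) := by
  intro s t h
  have h1 := Subtype.ext_iff.mp h
  dsimp only at h1
  have h2 := backGap_next s.2
  rw [h1, backGap_next t.2] at h2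
  rw [h2, add_left_inj] at h1
  exact Subtype.ext h1

/-- The blocks into which a nonempty set of cuts divides the labels. Each block is named by the cut
at which it ends. -/
abbrev CyclicBlocks.ofCuts (S : Finset (Fin (n + 1))) (hS : S.Nonempty) : CyclicBlocks n where
  numBlocks := S.card
  size v := backGap S (S.equivFin.symm v)
  next := (S.equivFin.symm.trans (Equiv.ofBijective _
    (Finite.injective_iff_bijective.mp (nextCut_injective hS)))).trans S.equivFin
  label := Equiv.ofBijective _ (blockLabel_bijective hS)
  label_succ v j := by
    simp only [Equiv.ofBijective_apply, Fin.val_succ, Fin.val_castSucc]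
    push_cast
    ring
  label_next v := by
    simp only [Equiv.ofBijective_apply, Fin.val_last, Equiv.trans_apply, Equiv.symm_apply_apply,
      Fin.val_zero, backGap_next (S.equivFin.symm v).2]
    push_cast
    ring

theorem CyclicBlocks.ofCuts_label (hS : S.Nonempty) (v : Fin S.card)
    (j : Fin (backGap S (S.equivFin.symm v) + 1)) : (ofCuts S hS).label ⟨v, j⟩
      = (S.equivFin.symm v : Fin (n + 1)) - ((backGap S (S.equivFin.symm v) + 1 : ℕ) : Fin (n + 1))
        + ((j : ℕ) : Fin (n + 1)) := rfl

theorem CyclicBlocks.ofCuts_label_next (hS : S.Nonempty) (v : Fin S.card) :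
    (ofCuts S hS).label ⟨(ofCuts S hS).next v, 0⟩ = S.equivFin.symm v := by
  have h1 : (S.equivFin.symm ((ofCuts S hS).next v) : Fin (n + 1)) = (S.equivFin.symm v : Fin (n + 1))
      + ((foreGap S (S.equivFin.symm v) + 1 : ℕ) : Fin (n + 1)) := by
    simp [ofCuts]
  have h2 := ofCuts_label hS ((ofCuts S hS).next v) 0
  refine h2.trans ?_
  rw [h1, backGap_next (S.equivFin.symm v).2, add_sub_cancel_right]
  simp

/-- The multiset of the values of `x` in the block that ends before `i`. -/
def cutBlock {I : Type*} (S : Finset (Fin (n + 1))) (x : Fin (n + 1) → I) (i : Fin (n + 1)) :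
    Multiset I :=
  (Multiset.range (backGap S i + 1)).map fun j => x (i - ((j + 1 : ℕ) : Fin (n + 1)))

/-- This recursion identifies `cutBlock` with the state kept when the labels are scanned from left
to right. -/
theorem cutBlock_add_one {I : Type*} (hS : S.Nonempty) (x : Fin (n + 1) → I) (i : Fin (n + 1)) :
    cutBlock S x (i + 1) = if i ∈ S then {x i} else x i ::ₘ cutBlock S x i := by
  rw [cutBlock, backGap_add_one hS]
  split_ifs with h
  · simp
  · have h1 : ∀ m, Multiset.range (m + 1) = 0 ::ₘ (Multiset.range m).map Nat.succ := fun m => by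
      simp only [Multiset.range, List.range_succ_eq_map, Multiset.map_coe, Multiset.cons_coe]
    rw [h1, Multiset.map_cons, Multiset.map_map, cutBlock]
    congr 1
    · simp
    · refine Multiset.map_congr rfl fun j _ => ?_
      simp only [Function.comp_apply]
      congr 1
      push_cast
      ring

theorem CyclicBlocks.ofCuts_block {I : Type*} (hS : S.Nonempty) (x : Fin (n + 1) → I)
    (v : Fin S.card) :
    (Finset.univ.val.map fun j => x ((ofCuts S hS).label ⟨v, j⟩))
      = cutBlock S x (S.equivFin.symm v) := by
  have h1 : ∀ (m : ℕ) (F : ℕ → I), ((Finset.univ : Finset (Fin m)).val.map fun j : Fin m => F (j : ℕ))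
      = (Multiset.range m).map F := by
    intro m F
    rw [← Finset.range_val, ← Nat.Iio_eq_range, ← Fin.map_valEmbedding_univ, Finset.map_val,
      Multiset.map_map]
    rfl
  rw [cutBlock, ← h1]
  set m := backGap S (S.equivFin.symm v) with hm
  change (Finset.univ : Finset (Fin (m + 1))).val.map _ = _
  -- Labels of a block are numbered from its start, whereas `cutBlock` counts backwards from the cut
  -- at its end.
  conv_lhs => rw [← Finset.map_univ_equiv (Fin.revPerm (n := m + 1)), Finset.map_val,
    Multiset.map_map]
  refine Multiset.map_congr rfl fun j _ => ?_
  simp only [Function.comp_apply]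
  congr 1
  simp only [Equiv.ofBijective_apply, Equiv.toEmbedding_apply, Fin.revPerm_apply,
    Fin.val_rev, ← hm]
  obtain ⟨l, hl⟩ := Nat.exists_eq_add_of_le (Nat.lt_succ_iff.mp j.2)
  rw [show m + 1 - ((j : ℕ) + 1) = l by omega,
    congrArg (fun k : ℕ => ((k + 1 : ℕ) : Fin (n + 1))) hl]
  push_cast
  ring

/-- The half-edge that follows an inner one is external, and it is a cut because its predecessor is
internal. -/
theorem NCDiagram.RelevantClass.cuts_nonempty (c : NCDiagram.RelevantClass (n + 1)) :
    c.cuts.Nonempty := by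
  obtain ⟨inner, h1, h2, h3, h4, h5, h6, h7⟩ := c.out.2.exists_inner
  have hpos := c.out.2.planar.1.1
  obtain ⟨h, hh, -⟩ := h7 ⟨0, hpos⟩
  obtain ⟨j, hj⟩ := NCDiagram.exists_ext (h3 h hh)
  refine ⟨j, ?_⟩
  have h8 : c.out.1.IsCut j := by
    rw [NCDiagram.IsCut, ← hj, Equiv.symm_apply_apply]
    exact h1 h hh
  simpa [NCDiagram.RelevantClass.cuts] using h8

theorem CyclicBlocks.isCut_ofCuts (hS : S.Nonempty) (i : Fin (n + 1)) :
    (ofCuts S hS).diagram.IsCut i ↔ i ∈ S := by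
  rw [isCut_iff]
  constructor
  · rintro ⟨v, rfl⟩
    obtain ⟨w, rfl⟩ := (ofCuts S hS).next.surjective v
    rw [ofCuts_label_next]
    exact (S.equivFin.symm w).2
  · intro hi
    refine ⟨(ofCuts S hS).next (S.equivFin ⟨i, hi⟩), ?_⟩
    rw [ofCuts_label_next, Equiv.symm_apply_apply]

/-- Uniqueness is the reconstruction of a diagram from its cuts; existence is the loop diagram of
`CyclicBlocks.ofCuts`. -/
theorem NCDiagram.sum_relevantClass {M : Type*} [AddCommMonoid M]
    (F : NCDiagram (n + 1) → M) (hF : ∀ G G', Isomorphic G G' → G.Relevant → F G = F G') :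
    ∑ᶠ c : RelevantClass (n + 1), F c.out.1
      = ∑ S : {S : Finset (Fin (n + 1)) // S.Nonempty}, F (CyclicBlocks.ofCuts S.1 S.2).diagram := by
  rw [← finsum_eq_sum_of_fintype]
  have hbij : Function.Bijective fun c : RelevantClass (n + 1) =>
      (⟨c.cuts, c.cuts_nonempty⟩ : {S : Finset (Fin (n + 1)) // S.Nonempty}) := by
    refine ⟨fun c c' h => RelevantClass.cuts_injective (Subtype.ext_iff.mp h), fun S => ?_⟩
    refine ⟨⟦⟨_, (CyclicBlocks.ofCuts S.1 S.2).relevant⟩⟧, Subtype.ext (Finset.ext fun i => ?_)⟩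
    have h1 : Isomorphic _ _ := Quotient.exact (Quotient.out_eq (s := relevantSetoid (n + 1))
      ⟦⟨_, (CyclicBlocks.ofCuts S.1 S.2).relevant⟩⟧)
    simp only [RelevantClass.cuts, Finset.mem_filter, Finset.mem_univ, true_and]
    rw [h1.isCut_iff, CyclicBlocks.isCut_ofCuts]
  refine finsum_eq_of_bijective _ hbij fun c => ?_
  refine hF _ _ (Relevant.isomorphic c.out.2 (CyclicBlocks.relevant _) fun j => ?_) c.out.2
  rw [CyclicBlocks.isCut_ofCuts]
  simp [RelevantClass.cuts]

/-- The contribution of a set of cuts to the one-loop bracket, for the index `a` of the inner face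
and the indices `x` of the outer face. -/
def cutWeight {I : Type*} (u : I → ℂ) (h : Multiset I → ℂ) (S : Finset (Fin (n + 1)))
    (x : Fin (n + 1) → I) : ℂ :=
  ∏ s ∈ S, u (x s) * h (x s ::ₘ cutBlock S x s)

theorem CyclicBlocks.ofCuts_indexSum (hS : S.Nonempty) {I : Type*} [Fintype I] (c : Multiset I → ℂ)
    (p : I → I → I → I → ℂ) (g : I → I → ℂ) (hp : ∀ i j k l, p i j k l = p k l i j)
    (hp0 : ∀ i j k l, ¬ (i = l ∧ j = k) → p i j k l = 0) (hg : ∀ i j, p i j j i = g i j)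
    (v : Fin (n + 1) → I → I → ℂ) :
    (ofCuts S hS).diagram.indexSum c p v = ∑ a : I, ∑ x : Fin (n + 1) → I,
      cutWeight (fun i => -g i a) (fun m => c (a ::ₘ m)) S x * ∏ i, v i (x i) (x (i + 1)) := by
  rw [indexSum_eq _ c p g hp hp0 hg]
  refine Finset.sum_congr rfl fun a _ => Finset.sum_congr rfl fun x _ => ?_
  congr 1
  rw [cutWeight, ← Finset.prod_coe_sort S]
  rw [← Equiv.prod_comp S.equivFin.symm]
  refine Finset.prod_congr rfl fun w _ => ?_
  rw [ofCuts_label_next hS w, ← ofCuts_block hS x w]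

end Cuts

/-! ### The Ward identity for sums over cuts -/

section Scan

variable {I : Type*} (u : I → ℂ) (h : Multiset I → ℂ)

/-- The product of the weights of the marked entries of a list, each of which is weighted with the
entries since the previous mark; `st` holds the entries since the last mark before the list. -/
def scanWeight : Multiset I → List (I × Bool) → ℂ
  | _, [] => 1
  | st, (x, true) :: l => u x * h (x ::ₘ st) * scanWeight {x} l
  | st, (x, false) :: l => scanWeight (x ::ₘ st) l

/-- The entries since the last mark. -/
def scanEnd : Multiset I → List (I × Bool) → Multiset I
  | st, [] => st
  | _, (x, true) :: l => scanEnd {x} l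
  | st, (x, false) :: l => scanEnd (x ::ₘ st) l

/-- The weight of a cyclic list with marks. -/
def markedWeight (l : List (I × Bool)) : ℂ :=
  if l.any (·.2) then scanWeight u h (scanEnd 0 l) l else 0

theorem scanWeight_append (st : Multiset I) (l l' : List (I × Bool)) :
    scanWeight u h st (l ++ l') = scanWeight u h st l * scanWeight u h (scanEnd st l) l' := by
  induction l generalizing st with
  | nil => simp [scanWeight, scanEnd]
  | cons p l ih =>
    obtain ⟨x, _ | _⟩ := p <;> simp [scanWeight, scanEnd, ih, mul_assoc]

theorem scanEnd_append (st : Multiset I) (l l' : List (I × Bool)) :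
    scanEnd st (l ++ l') = scanEnd (scanEnd st l) l' := by
  induction l generalizing st with
  | nil => simp [scanEnd]
  | cons p l ih => obtain ⟨x, _ | _⟩ := p <;> simp [scanEnd, ih]

theorem scan_of_unmarked {l : List (I × Bool)} (hl : l.any (·.2) = false) :
    ∃ w : Multiset I, ∀ st, scanWeight u h st l = 1 ∧ scanEnd st l = w + st := by
  induction l with
  | nil => exact ⟨0, fun st => by simp [scanWeight, scanEnd]⟩
  | cons p l ih =>
    obtain ⟨x, _ | _⟩ := p
    · obtain ⟨w, hw⟩ := ih (by simpa using hl)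
      refine ⟨x ::ₘ w, fun st => ⟨(hw _).1, ?_⟩⟩
      rw [scanEnd, (hw _).2, Multiset.add_cons, Multiset.cons_add]
    · simp at hl

/-- Only the first mark sees the initial state, and afterwards the state is reset. Hence the state
enters through a single factor `h (w + st)`. -/
theorem scan_of_marked {l : List (I × Bool)} (hl : l.any (·.2) = true) :
    ∃ (k : ℂ) (w e : Multiset I), ∀ st, scanWeight u h st l = k * h (w + st) ∧ scanEnd st l = e := by
  induction l with
  | nil => simp at hl
  | cons p l ih =>
    obtain ⟨x, _ | _⟩ := p
    · obtain ⟨k, w, e, hw⟩ := ih (by simpa using hl)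
      refine ⟨k, x ::ₘ w, e, fun st => ?_⟩
      rw [scanWeight, scanEnd, (hw _).1, (hw _).2, Multiset.add_cons, Multiset.cons_add]
      exact ⟨rfl, rfl⟩
    · refine ⟨u x * scanWeight u h {x} l, {x}, scanEnd {x} l, fun st => ⟨?_, rfl⟩⟩
      rw [scanWeight, Multiset.singleton_add]
      ring

theorem scanEnd_eq {l : List (I × Bool)} (hl : l.any (·.2) = true) (st st' : Multiset I) :
    scanEnd st l = scanEnd st' l := by
  obtain ⟨k, w, e, hw⟩ := scan_of_marked (fun _ => 0) (fun _ => 0) hl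
  rw [(hw _).2, (hw _).2]

variable {u h}

/-- In each of the four choices of marks at `x` and `y`, exactly one factor `h` contains the
adjacent pair, and `hh` splits it. Unmarked pairs and single marks give the right-hand side and
unwanted products; when both are marked, the factor `h {x, y}` splits into `h {x} - h {y}`, and `hu`
turns these into what cancels the unwanted products. -/
theorem markedWeight_ward {v : I → ℂ} (hh : ∀ x y s, (v x - v y) * h (x ::ₘ y ::ₘ s)
    = h (x ::ₘ s) - h (y ::ₘ s)) (hu : ∀ x, u x * h {x} = -1) (x y : I) (r : List (I × Bool)) :
    (v x - v y) * ∑ b, ∑ b', markedWeight u h ((x, b) :: (r ++ [(y, b')]))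
      = ∑ b, markedWeight u h ((x, b) :: r) - ∑ b, markedWeight u h ((y, b) :: r) := by
  have hx := hu x
  have hy := hu y
  simp only [Fintype.sum_bool]
  by_cases hr : r.any (·.2) = true
  -- Here `r` separates its entries `w` before the first mark from the entries `e` after the last
  -- one, so the two neighbours of the pair `x`, `y` belong to different vertices.
  · obtain ⟨k, w, e, hw⟩ := scan_of_marked u h hr
    simp only [markedWeight, List.any_cons, List.any_append, hr, Bool.or_true, Bool.true_or,
      if_true, scanWeight, scanEnd, scanWeight_append, scanEnd_append, (hw _).1, (hw _).2, mul_one]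
    have h1 : (v x - v y) * h (w + x ::ₘ y ::ₘ e) = h (w + x ::ₘ e) - h (w + y ::ₘ e) := by
      simpa only [Multiset.add_cons] using hh x y (w + e)
    have h3 : (v x - v y) * h (w + x ::ₘ {y}) = h (w + {x}) - h (w + {y}) := by
      simpa only [Multiset.add_cons, ← Multiset.cons_zero, add_zero] using hh x y w
    have h4 : (v x - v y) * h (x ::ₘ {y}) = h {x} - h {y} := hh x y 0
    linear_combination k * h1 + u x * k * h (w + {x}) * hh x y e + k * u y * h (y ::ₘ e) * h3
      + u x * u y * k * h (w + {x}) * h (y ::ₘ e) * h4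
      + u y * k * h (w + {x}) * h (y ::ₘ e) * hx - u x * k * h (w + {x}) * h (y ::ₘ e) * hy
  -- Here the only possible marks are at `x` and `y`. If just one of them is marked, there is a
  -- single vertex, in which the marked index occurs twice; the unmarked list contributes zero.
  · obtain ⟨w, hw⟩ := scan_of_unmarked u h (by simpa using hr)
    simp only [Bool.not_eq_true] at hr
    simp only [markedWeight, List.any_cons, List.any_append, hr, Bool.or_true,
      Bool.or_false, List.any_nil, Bool.false_eq_true,
      if_true, if_false, scanWeight, scanEnd, scanWeight_append, scanEnd_append, (hw _).1, (hw _).2, mul_one]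
    simp only [Multiset.add_cons, ← Multiset.cons_zero, add_zero]
    have h1 := hh x y (y ::ₘ w)
    have h2 : (v x - v y) * h (x ::ₘ y ::ₘ x ::ₘ w) = h (x ::ₘ x ::ₘ w) - h (y ::ₘ x ::ₘ w) :=
      hh x y (x ::ₘ w)
    have h4 : (v x - v y) * h (x ::ₘ {y}) = h {x} - h {y} := hh x y 0
    simp only [Multiset.cons_swap y x, ← Multiset.cons_zero] at h1 h2 h4 hx hy ⊢
    linear_combination u y * h1 + u x * h2 + u x * u y * h (x ::ₘ y ::ₘ w) * h4
      + u y * h (x ::ₘ y ::ₘ w) * hx - u x * h (x ::ₘ y ::ₘ w) * hy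

end Scan

/-! ### Sums over sets of cuts: Ward identity and rotation invariance. -/

section CutSum

open scoped Fin.NatCast Fin.CommRing

variable {I : Type*} (u : I → ℂ) (h : Multiset I → ℂ) {n : ℕ}

theorem scan_range {S : Finset (Fin (n + 1))} (hS : S.Nonempty) (x : Fin (n + 1) → I) (k : ℕ) :
    scanWeight u h (cutBlock S x 0)
        ((List.range k).map fun i : ℕ => (x (i : Fin (n + 1)), decide ((i : Fin (n + 1)) ∈ S)))
      = ∏ i ∈ Finset.range k, (if ((i : ℕ) : Fin (n + 1)) ∈ S then
          u (x (i : Fin (n + 1))) * h (x (i : Fin (n + 1)) ::ₘ cutBlock S x (i : Fin (n + 1))) else 1)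
    ∧ scanEnd (cutBlock S x 0)
        ((List.range k).map fun i : ℕ => (x (i : Fin (n + 1)), decide ((i : Fin (n + 1)) ∈ S)))
      = cutBlock S x (k : Fin (n + 1)) := by
  induction k with
  | zero => simp [scanWeight, scanEnd]
  | succ k ih =>
    rw [List.range_succ, List.map_append, scanWeight_append, scanEnd_append, ih.1, ih.2,
      Finset.prod_range_succ, Nat.cast_succ, cutBlock_add_one hS]
    by_cases hk : ((k : ℕ) : Fin (n + 1)) ∈ S
    · simp [hk, scanWeight, scanEnd]
    · simp [hk, scanWeight, scanEnd]

theorem cutWeight_eq_markedWeight {S : Finset (Fin (n + 1))} (hS : S.Nonempty)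
    (x : Fin (n + 1) → I) :
    cutWeight u h S x = markedWeight u h (List.ofFn fun i => (x i, decide (i ∈ S))) := by
  have hl : (List.ofFn fun i => (x i, decide (i ∈ S))) = (List.range (n + 1)).map
      fun i : ℕ => (x (i : Fin (n + 1)), decide ((i : Fin (n + 1)) ∈ S)) := by
    refine List.ext_getElem (by simp) fun i h1 h2 => ?_
    have h3 : i < n + 1 := by simpa using h1
    have h4 : (⟨i, h3⟩ : Fin (n + 1)) = (i : Fin (n + 1)) := by
      apply Fin.ext
      rw [Fin.val_natCast, Nat.mod_eq_of_lt h3]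
    rw [List.getElem_ofFn]
    simp [h4]
  have hany : (List.ofFn fun i => (x i, decide (i ∈ S))).any (·.2) = true := by
    obtain ⟨s, hs⟩ := hS
    simp only [List.any_eq_true, List.mem_ofFn]
    exact ⟨_, ⟨s, rfl⟩, by simpa using hs⟩
  obtain ⟨h1, h2⟩ := scan_range u h hS x (n + 1)
  rw [← hl] at h1 h2
  -- A full turn of the scan returns to the state `cutBlock S x 0`, and the end state does not
  -- depend on the start because there is a mark.
  rw [markedWeight, if_pos hany, scanEnd_eq hany 0 (cutBlock S x 0), h2]
  have h3 : ((n + 1 : ℕ) : Fin (n + 1)) = 0 := by simp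
  rw [h3, h1, Finset.prod_range, cutWeight, ← Finset.prod_filter]
  simp

/-- The sum of the weights over all nonempty sets of cuts. -/
def cutSum (x : Fin (n + 1) → I) : ℂ :=
  ∑ S : {S : Finset (Fin (n + 1)) // S.Nonempty}, cutWeight u h S.1 x

/-- The empty set may be added because an unmarked list has weight zero. Then the marks at different
positions are summed independently. -/
theorem cutSum_eq (x : Fin (n + 1) → I) :
    cutSum u h x = ∑ b : Fin (n + 1) → Bool, markedWeight u h (List.ofFn fun i => (x i, b i)) := by
  classical
  rw [cutSum]
  refine Finset.sum_of_injOn (fun S => fun i => decide (i ∈ S.1)) ?_ (by simp) ?_ ?_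
  · intro S _ S' _ hSS
    refine Subtype.ext (Finset.ext fun i => ?_)
    simpa using congrFun hSS i
  · intro b _ hb
    rw [markedWeight, if_neg]
    intro hany
    simp only [List.any_eq_true, List.mem_ofFn] at hany
    obtain ⟨_, ⟨s, rfl⟩, hs⟩ := hany
    refine hb ⟨⟨Finset.univ.filter fun i => b i = true, ⟨s, by simpa using hs⟩⟩, by simp, ?_⟩
    funext i
    simp
  · intro S _
    exact cutWeight_eq_markedWeight u h S.2 x

variable {u h}

theorem cutSum_ward {v : I → ℂ} (hh : ∀ x y s, (v x - v y) * h (x ::ₘ y ::ₘ s)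
    = h (x ::ₘ s) - h (y ::ₘ s)) (hu : ∀ x, u x * h {x} = -1) (x y : I) (r : Fin n → I) :
    (v x - v y) * cutSum u h (Fin.cons x (Fin.snoc r y : Fin (n + 1) → I) : Fin (n + 2) → I)
      = cutSum u h (Fin.cons x r : Fin (n + 1) → I)
        - cutSum u h (Fin.cons y r : Fin (n + 1) → I) := by
  have e1 : ∀ {m : ℕ} (F : (Fin (m + 1) → Bool) → ℂ), ∑ b, F b
      = ∑ b : Fin m → Bool, ∑ b₀ : Bool, F (Fin.cons b₀ b) := fun F => by
    rw [← (Fin.consEquiv fun _ => Bool).sum_comp, Fintype.sum_prod_type_right]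
    rfl
  have e2 : ∀ {m : ℕ} (F : (Fin (m + 1) → Bool) → ℂ), ∑ b, F b
      = ∑ b : Fin m → Bool, ∑ b₀ : Bool, F (Fin.snoc b b₀) := fun F => by
    rw [← (Fin.snocEquiv fun _ => Bool).sum_comp, Fintype.sum_prod_type_right]
    rfl
  have l1 : ∀ {m : ℕ} (z : I) (r : Fin m → I) (b₀ : Bool) (b : Fin m → Bool),
      (List.ofFn fun i : Fin (m + 1) => ((Fin.cons z r : Fin (m + 1) → I) i,
        (Fin.cons b₀ b : Fin (m + 1) → Bool) i)) = (z, b₀) :: List.ofFn fun i => (r i, b i) := by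
    intro m z r b₀ b
    simp [List.ofFn_succ]
  have l2 : ∀ {m : ℕ} (z : I) (r : Fin m → I) (b₀ : Bool) (b : Fin m → Bool),
      (List.ofFn fun i : Fin (m + 1) => ((Fin.snoc r z : Fin (m + 1) → I) i,
        (Fin.snoc b b₀ : Fin (m + 1) → Bool) i)) = (List.ofFn fun i => (r i, b i)) ++ [(z, b₀)] := by
    intro m z r b₀ b
    rw [List.ofFn_succ', List.concat_eq_append]
    simp
  simp only [cutSum_eq]
  rw [e1, e2, e1, e1, Finset.mul_sum, ← Finset.sum_sub_distrib]
  refine Finset.sum_congr rfl fun b _ => ?_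
  simp only [l1, l2]
  rw [Finset.sum_comm]
  exact markedWeight_ward hh hu x y _

/-- An open path of indices is compared with a cyclic one: only the first factor sees the starting
index, which is then free to be contracted with another matrix. -/
theorem prod_cyclic_eq (V : Fin (n + 1) → I → I → ℂ) (x : Fin (n + 2) → I) (w : Fin (n + 1) → I)
    (h0 : ∀ i : Fin n, x i.succ.castSucc = w i.succ) (h1 : x (Fin.last _) = w 0) :
    (∏ i, V i (x i.castSucc) (x i.succ)) = V 0 (x 0) (w 1) * ∏ i : Fin n, V i.succ (w i.succ) (w (i.succ + 1)) := by
  have h2 : ∀ i : Fin (n + 1), x i.succ = w (i + 1) := by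
    intro i
    induction i using Fin.lastCases with
    | last => rw [Fin.succ_last, h1, Fin.last_add_one]
    | cast i => rw [Fin.coeSucc_eq_succ, ← h0, ← Fin.succ_castSucc]
  rw [Fin.prod_univ_succ]
  congr 1
  · rw [h2]; simp
  · refine Finset.prod_congr rfl fun i _ => ?_
    rw [h2, h0]

/-- Rotation of the cuts. -/
theorem cutBlock_rotate (S : Finset (Fin (n + 1))) (x : Fin (n + 1) → I) (i : Fin (n + 1)) :
    cutBlock (S.map (Equiv.addRight 1).toEmbedding) x (i + 1)
      = cutBlock S (fun j => x (j + 1)) i := by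
  have h1 : backGap (S.map (Equiv.addRight 1).toEmbedding) (i + 1) = backGap S i := by
    rw [backGap, backGap]
    congr 1
    ext m
    simp only [Set.mem_ofPred_eq, Finset.mem_map_equiv, Equiv.addRight_symm, Equiv.coe_addRight]
    rw [add_sub_right_comm, add_neg_cancel_right]
  rw [cutBlock, cutBlock, h1]
  refine Multiset.map_congr rfl fun j _ => ?_
  rw [add_sub_right_comm]

theorem cutSum_rotate (x : Fin (n + 1) → I) : cutSum u h (fun j => x (j + 1)) = cutSum u h x := by
  rw [cutSum, cutSum]
  refine Fintype.sum_equiv ((Equiv.addRight (1 : Fin (n + 1))).finsetCongr.subtypeEquiv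
    fun S => by simp) _ _ fun S => ?_
  rw [cutWeight, cutWeight]
  simp only [Equiv.subtypeEquiv_apply, Equiv.finsetCongr_apply, Finset.prod_map,
    Equiv.toEmbedding_apply, Equiv.coe_addRight]
  refine Finset.prod_congr rfl fun s _ => ?_
  rw [cutBlock_rotate]

variable [Fintype I]

/-- The cyclic contraction of matrices with a function of the indices. -/
def traceSum (Φ : (Fin (n + 1) → I) → ℂ) (V : Fin (n + 1) → I → I → ℂ) : ℂ :=
  ∑ x, Φ x * ∏ i, V i (x i) (x (i + 1))

/-- The additional matrix closes the path from `y` back to `x` with the entry `(v y - v x) a_{yx}`.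
By `hΦ` its scalar factor turns the kernel into a difference in which either `x` or `y` has
disappeared. Summing over the index that disappeared is a matrix product, with `a` to the left of `V
0` or to the right of `V (Fin.last n)`. -/
theorem traceSum_ward {v : I → ℂ} {Φ : (Fin (n + 1) → I) → ℂ} {Φ' : (Fin (n + 2) → I) → ℂ}
    (hΦ : ∀ x y (r : Fin n → I),
      (v x - v y) * Φ' (Fin.cons x (Fin.snoc r y : Fin (n + 1) → I) : Fin (n + 2) → I)
      = Φ (Fin.cons x r : Fin (n + 1) → I) - Φ (Fin.cons y r : Fin (n + 1) → I))
    (V : Fin (n + 1) → I → I → ℂ) (a : I → I → ℂ) :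
    traceSum Φ (Function.update V 0 fun i j => ∑ k, a i k * V 0 k j)
      - traceSum Φ (Function.update V (Fin.last n) fun i j => ∑ k, V (Fin.last n) i k * a k j)
      = traceSum Φ' (Fin.snoc V fun i j => (v i - v j) * a i j : Fin (n + 2) → I → I → ℂ) := by
  have e1 : ∀ {m : ℕ} (F : (Fin (m + 1) → I) → ℂ), ∑ x, F x
      = ∑ r : Fin m → I, ∑ z : I, F (Fin.cons z r) := fun F => by
    rw [← (Fin.consEquiv fun _ => I).sum_comp, Fintype.sum_prod_type_right]
    rfl
  have e2 : ∀ {m : ℕ} (F : (Fin (m + 1) → I) → ℂ), ∑ x, F x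
      = ∑ r : Fin m → I, ∑ z : I, F (Fin.snoc r z) := fun F => by
    rw [← (Fin.snocEquiv fun _ => I).sum_comp, Fintype.sum_prod_type_right]
    rfl
  have hR : traceSum Φ' (Fin.snoc V fun i j => (v i - v j) * a i j : Fin (n + 2) → I → I → ℂ)
      = ∑ r : Fin n → I, ∑ x : I, ∑ y : I,
        (Φ (Fin.cons y r : Fin (n + 1) → I) - Φ (Fin.cons x r : Fin (n + 1) → I)) * a y x *
          ∏ i : Fin (n + 1), V i
            ((Fin.cons x (Fin.snoc r y : Fin (n + 1) → I) : Fin (n + 2) → I) i.castSucc)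
            ((Fin.cons x (Fin.snoc r y : Fin (n + 1) → I) : Fin (n + 2) → I) i.succ) := by
    rw [traceSum, e1, e2]
    refine Finset.sum_congr rfl fun r _ => ?_
    rw [Finset.sum_comm]
    refine Finset.sum_congr rfl fun x _ => Finset.sum_congr rfl fun y _ => ?_
    rw [Fin.prod_univ_castSucc]
    simp only [Fin.snoc_castSucc, Fin.snoc_last, Fin.last_add_one, Fin.coeSucc_eq_succ,
      Fin.cons_zero]
    have h1 : (Fin.cons x (Fin.snoc r y : Fin (n + 1) → I) : Fin (n + 2) → I) (Fin.last _) = y := by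
      rw [← Fin.succ_last, Fin.cons_succ, Fin.snoc_last]
    rw [h1, ← neg_sub (Φ _), ← hΦ]
    ring
  have hA : traceSum Φ (Function.update V 0 fun i j => ∑ k, a i k * V 0 k j)
      = ∑ r : Fin n → I, ∑ x : I, ∑ y : I, Φ (Fin.cons y r : Fin (n + 1) → I) * a y x *
          ∏ i : Fin (n + 1), V i
            ((Fin.cons x (Fin.snoc r y : Fin (n + 1) → I) : Fin (n + 2) → I) i.castSucc)
            ((Fin.cons x (Fin.snoc r y : Fin (n + 1) → I) : Fin (n + 2) → I) i.succ) := by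
    rw [traceSum, e1]
    refine Finset.sum_congr rfl fun r _ => ?_
    rw [Finset.sum_comm]
    refine Finset.sum_congr rfl fun y _ => ?_
    have h1 : ∀ x, (∏ i : Fin (n + 1), V i
            ((Fin.cons x (Fin.snoc r y : Fin (n + 1) → I) : Fin (n + 2) → I) i.castSucc)
            ((Fin.cons x (Fin.snoc r y : Fin (n + 1) → I) : Fin (n + 2) → I) i.succ))
        = V 0 x ((Fin.cons y r : Fin (n + 1) → I) 1) * ∏ i : Fin n, V i.succ (r i)
          ((Fin.cons y r : Fin (n + 1) → I) (i.succ + 1)) := by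
      intro x
      rw [prod_cyclic_eq V _ (Fin.cons y r : Fin (n + 1) → I)]
      · simp
      · intro i
        rw [← Fin.succ_castSucc]
        simp
      · rw [← Fin.succ_last, Fin.cons_succ, Fin.snoc_last, Fin.cons_zero]
    simp only [h1]
    rw [Fin.prod_univ_succ]
    simp only [Function.update_self, Fin.cons_zero, zero_add, Fin.cons_succ, ne_eq,
      Fin.succ_ne_zero, not_false_eq_true, Function.update_of_ne, Finset.sum_mul, Finset.mul_sum]
    refine Finset.sum_congr rfl fun x _ => ?_
    ring
  have hB : traceSum Φ (Function.update V (Fin.last n) fun i j => ∑ k, V (Fin.last n) i k * a k j)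
      = ∑ r : Fin n → I, ∑ x : I, ∑ y : I, Φ (Fin.cons x r : Fin (n + 1) → I) * a y x *
          ∏ i : Fin (n + 1), V i
            ((Fin.cons x (Fin.snoc r y : Fin (n + 1) → I) : Fin (n + 2) → I) i.castSucc)
            ((Fin.cons x (Fin.snoc r y : Fin (n + 1) → I) : Fin (n + 2) → I) i.succ) := by
    rw [traceSum, e1]
    refine Finset.sum_congr rfl fun r _ => Finset.sum_congr rfl fun x _ => ?_
    have h0 : ∀ y, (Fin.cons x (Fin.snoc r y : Fin (n + 1) → I) : Fin (n + 2) → I)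
        = Fin.snoc (Fin.cons x r : Fin (n + 1) → I) y := fun y => Fin.cons_snoc_eq_snoc_cons _ _ _
    simp only [h0, Fin.prod_univ_castSucc, Fin.snoc_castSucc, Fin.succ_last, Fin.snoc_last,
      Function.update_self, Fin.last_add_one, Fin.coeSucc_eq_succ, Fin.cons_zero,
      ← Fin.castSucc_succ, ne_eq, Fin.castSucc_ne_last, not_false_eq_true, Function.update_of_ne,
      Finset.mul_sum]
    refine Finset.sum_congr rfl fun y _ => ?_
    ring
  rw [hA, hB, hR]
  simp only [← Finset.sum_sub_distrib, sub_mul]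

theorem traceSum_rotate {Φ : (Fin (n + 1) → I) → ℂ} (hΦ : ∀ x, Φ (fun j => x (j + 1)) = Φ x)
    (V : Fin (n + 1) → I → I → ℂ) : traceSum Φ (fun i => V (i - 1)) = traceSum Φ V := by
  rw [traceSum, traceSum]
  refine Fintype.sum_equiv (Equiv.arrowCongr (Equiv.subRight (1 : Fin (n + 1))) (Equiv.refl I))
    _ _ fun x => ?_
  have h1 : (Equiv.arrowCongr (Equiv.subRight (1 : Fin (n + 1))) (Equiv.refl I)) x
      = fun j => x (j + 1) := by
    funext j
    simp [Equiv.arrowCongr_apply]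
  rw [h1, hΦ]
  congr 1
  refine Fintype.prod_equiv (Equiv.subRight (1 : Fin (n + 1))) _ _ fun i => ?_
  simp

end CutSum

/-! ### Cyclicity and the Ward identity of the one-loop bracket -/

section OneLoop

variable {H : Type*} [NormedAddCommGroup H] [InnerProductSpace ℂ H] [CompleteSpace H]

namespace SpectralTriple.Eigenbasis

variable {T : SpectralTriple H} {d : ℕ∞} (E : T.Eigenbasis d)

theorem propagator_symm (f : ℝ → ℂ) (N : ℕ) (i j k l : Modes d) :
    E.propagator f N i j k l = E.propagator f N k l i j := by
  rw [propagator, propagator]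
  by_cases h : i = l ∧ j = k
  · obtain ⟨rfl, rfl⟩ := h
    simp only [true_and, Multiset.pair_comm (E.val i) (E.val j), and_comm]
  · rw [if_neg (fun h' => h ⟨h'.1, h'.2.1⟩), if_neg (fun h' => h ⟨h'.2.1.symm, h'.1.symm⟩)]

theorem exists_common_cutoff (N : ℕ) {n : ℕ} {V : Fin n → H →L[ℂ] H}
    (hV : ∀ i, ∃ K, V i ∈ E.matrices K) : ∃ K, N ≤ K ∧ ∀ i, V i ∈ E.matrices K := by
  choose K hK using hV
  refine ⟨max N (Finset.univ.sup K), le_max_left _ _, fun i => ?_⟩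
  exact E.matrices_mono ((Finset.le_sup (Finset.mem_univ i)).trans (le_max_right _ _)) (hK i)

theorem amplitude_isomorphic {f : ℝ → ℂ} (hf : ContDiff ℝ ∞ f) {N : ℕ} (hN : E.PositiveBelow f N)
    {n : ℕ} {G G' : NCDiagram n} (h : G.Isomorphic G') {V : Fin n → H →L[ℂ] H}
    (hV : ∀ i, ∃ K, V i ∈ E.matrices K) : E.amplitude f N G V = E.amplitude f N G' V := by
  obtain ⟨K, hNK, hK⟩ := E.exists_common_cutoff N hV
  rw [E.amplitude_eq_indexSum _ hf hNK hN (.inl hK), E.amplitude_eq_indexSum _ hf hNK hN (.inl hK)]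
  exact h.indexSum_eq _ _ (fun _ _ _ _ => E.propagator_symm f N _ _ _ _) _

/-- The contribution of the index `a` of the inner face to the one-loop bracket, as a function of
the indices of the outer face. -/
def loopKernel (f : ℝ → ℂ) (N K : ℕ) {n : ℕ} (a : Modes.below d K)
    (x : Fin (n + 1) → Modes.below d K) : ℂ :=
  cutSum (fun i : Modes.below d K => -E.propagator f N i a a i)
    (fun m => vertexWeight f (fun k : Modes.below d K => E.val k) (a ::ₘ m)) x

/-- Sums over relevant classes become sums over cuts, and the propagators leave the index `a` of the
inner face. One argument may lie outside `M_K` because relevant vertices have degree at least three.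
-/
theorem oneLoopBracket_eq {f : ℝ → ℂ} (hf : ContDiff ℝ ∞ f) {N K : ℕ} (hNK : N ≤ K)
    (hN : E.PositiveBelow f N) {n : ℕ} {V : Fin (n + 1) → H →L[ℂ] H} (i₀ : Fin (n + 1))
    (hV : ∀ i, i ≠ i₀ → V i ∈ E.matrices K) :
    E.oneLoopBracket f N V = ∑ a, traceSum (E.loopKernel f N K a)
      (fun i (k l : Modes.below d K) => E.elt (V i) k l) := by
  have h1 : ∀ G : NCDiagram (n + 1), G.Relevant → E.amplitude f N G V
      = G.indexSum (vertexWeight f fun k : Modes.below d K => E.val k)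
      (fun i j k l : Modes.below d K => E.propagator f N i j k l)
      (fun i (a b : Modes.below d K) => E.elt (V i) a b) := fun G hG =>
    E.amplitude_eq_indexSum G hf hNK hN
      (.inr ⟨fun v => (Nat.le_succ 2).trans (hG.three_le_deg v), i₀, hV⟩)
  rw [oneLoopBracket]
  rw [finsum_congr fun c : NCDiagram.RelevantClass (n + 1) => h1 _ c.out.2]
  rw [NCDiagram.sum_relevantClass (fun G => G.indexSum
      (vertexWeight f fun k : Modes.below d K => E.val k)
      (fun i j k l : Modes.below d K => E.propagator f N i j k l)
      (fun i (a b : Modes.below d K) => E.elt (V i) a b))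
    fun G G' hGG' _ => hGG'.indexSum_eq _ _ (fun _ _ _ _ => E.propagator_symm f N _ _ _ _) _]
  simp only [traceSum, loopKernel, cutSum, Finset.sum_mul]
  rw [Finset.sum_congr rfl fun (S : {S : Finset (Fin (n + 1)) // S.Nonempty}) _ =>
    CyclicBlocks.ofCuts_indexSum S.2 (vertexWeight f fun k : Modes.below d K => E.val k)
      (fun i j k l : Modes.below d K => E.propagator f N i j k l)
      (fun i j => E.propagator f N i j j i) (fun _ _ _ _ => E.propagator_symm f N _ _ _ _)
      (fun i j k l h => if_neg fun h' => h ⟨Subtype.ext h'.1, Subtype.ext h'.2.1⟩)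
      (fun _ _ => rfl) _]
  rw [Finset.sum_comm]
  refine Finset.sum_congr rfl fun a _ => ?_
  rw [Finset.sum_comm]

theorem oneLoopBracket_rotate {f : ℝ → ℂ} (hf : ContDiff ℝ ∞ f) {N : ℕ}
    (hN : E.PositiveBelow f N) {n : ℕ} {V : Fin (n + 1) → H →L[ℂ] H}
    (hV : ∀ i, ∃ K, V i ∈ E.matrices K) :
    E.oneLoopBracket f N V = E.oneLoopBracket f N fun i => V (i - 1) := by
  obtain ⟨K, hNK, hK⟩ := E.exists_common_cutoff N hV
  rw [E.oneLoopBracket_eq hf hNK hN 0 fun i _ => hK i,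
    E.oneLoopBracket_eq hf hNK hN 0 fun i _ => hK _]
  refine Finset.sum_congr rfl fun a _ => Eq.symm ?_
  exact traceSum_rotate (fun x => cutSum_rotate x) fun i (k l : Modes.below d K) => E.elt (V i) k l

theorem elt_mul_left {N : ℕ} {V : H →L[ℂ] H} (hV : V ∈ E.matrices N) (S : H →L[ℂ] H)
    (i j : Modes d) :
    E.elt (S * V) i j = ∑ k : Modes.below d N, E.elt S i k * E.elt V k j := by
  have h := orthonormal_iff_ite.mp E.vec.orthonormal
  induction hV using Submodule.span_induction with
  | mem x hx =>
    obtain ⟨p, hp, q, hq, rfl⟩ := hx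
    rw [Finset.sum_eq_single ⟨p, hp⟩]
    · simp only [elt_rankOne, true_and]
      simp only [elt, mul_apply_eq_comp, InnerProductSpace.rankOne_apply, map_smul,
        inner_smul_right, h]
      split_ifs <;> simp
    · intro k _ hk
      rw [elt_rankOne, if_neg fun h' => hk (Subtype.ext h'.1), mul_zero]
    · simp
  | zero => simp [elt]
  | add x y _ _ hx hy =>
    simp only [← eltₗ_apply, mul_add, map_add, Finset.sum_add_distrib] at *
    rw [hx, hy]
  | smul c x _ hx =>
    simp only [← eltₗ_apply, mul_smul_comm, map_smul, smul_eq_mul] at *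
    rw [hx, Finset.mul_sum]
    refine Finset.sum_congr rfl fun k _ => ?_
    ring

theorem elt_mul_right {N : ℕ} {V : H →L[ℂ] H} (hV : V ∈ E.matrices N) (S : H →L[ℂ] H)
    (i j : Modes d) :
    E.elt (V * S) i j = ∑ k : Modes.below d N, E.elt V i k * E.elt S k j := by
  have h := orthonormal_iff_ite.mp E.vec.orthonormal
  induction hV using Submodule.span_induction with
  | mem x hx =>
    obtain ⟨p, hp, q, hq, rfl⟩ := hx
    rw [Finset.sum_eq_single ⟨q, hq⟩]
    · simp only [elt_rankOne, and_true]
      simp only [elt, mul_apply_eq_comp, InnerProductSpace.rankOne_apply,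
        inner_smul_right, h]
      split_ifs <;> simp
    · intro k _ hk
      rw [elt_rankOne, if_neg fun h' => hk (Subtype.ext h'.2.symm), zero_mul]
    · simp
  | zero => simp [elt]
  | add x y _ _ hx hy =>
    simp only [← eltₗ_apply, add_mul, map_add, Finset.sum_add_distrib] at *
    rw [hx, hy]
  | smul c x _ hx =>
    simp only [← eltₗ_apply, smul_mul_assoc, map_smul, smul_eq_mul] at *
    rw [hx, Finset.mul_sum]
    refine Finset.sum_congr rfl fun k _ => ?_
    ring

/-- Self-adjointness moves `D` to the left eigenvector, so that both vectors contribute their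
eigenvalues. -/
theorem elt_comm (a : T.algebra) (i j : Modes d) :
    E.elt (T.comm a) i j = (E.val i - E.val j) * E.elt a i j := by
  have hD : T.D.adjoint = T.D := T.selfAdjoint
  have h1 := LinearPMap.adjoint_isFormalAdjoint T.selfAdjoint.dense_domain
  rw [hD] at h1
  have h2 := h1 ⟨E.vec i, E.vec_mem i⟩ ⟨_, T.apply_mem a a.2 _ (E.vec_mem j)⟩
  rw [E.apply_vec] at h2
  rw [elt, elt, T.comm_apply a _ (E.vec_mem j), inner_sub_right, ← h2, E.apply_vec, map_smul,
    inner_smul_left, inner_smul_right]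
  simp
  ring

theorem oneLoopBracket_ward {f : ℝ → ℂ} (hf : ContDiff ℝ ∞ f) {N : ℕ}
    (hN : E.PositiveBelow f N) {n : ℕ} {V : Fin (n + 1) → H →L[ℂ] H} (a : T.algebra)
    (hV : ∀ i, V i ∈ E.matrices N) :
    E.oneLoopBracket f N (Function.update V 0 ((a : H →L[ℂ] H) * V 0))
            - E.oneLoopBracket f N
                (Function.update V (Fin.last n) (V (Fin.last n) * (a : H →L[ℂ] H)))
            = E.oneLoopBracket f N (Fin.snoc V (T.comm a) : Fin (n + 2) → H →L[ℂ] H) := by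
  rw [E.oneLoopBracket_eq hf le_rfl hN 0 fun i hi => by rw [Function.update_of_ne hi]; exact hV i,
    E.oneLoopBracket_eq hf le_rfl hN (Fin.last n) fun i hi => by
      rw [Function.update_of_ne hi]; exact hV i,
    E.oneLoopBracket_eq hf le_rfl hN (Fin.last (n + 1)) fun i => by
      induction i using Fin.lastCases with
      | last => exact fun h => absurd rfl h
      | cast i => exact fun _ => by rw [Fin.snoc_castSucc]; exact hV i, ← Finset.sum_sub_distrib]
  refine Finset.sum_congr rfl fun b _ => ?_
  set w : Modes.below d N → ℝ := fun k => E.val k with hw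
  have hh : ∀ (x y : Modes.below d N) s, ((w x : ℂ) - w y) *
      vertexWeight f w (b ::ₘ x ::ₘ y ::ₘ s)
      = vertexWeight f w (b ::ₘ x ::ₘ s) - vertexWeight f w (b ::ₘ y ::ₘ s) := by
    intro x y s
    simp only [vertexWeight, Multiset.map_cons]
    rw [Multiset.cons_swap (w b), Multiset.cons_swap (w b) (w y), Multiset.cons_swap (w b) (w x)]
    exact sub_mul_divDiffMultiset (contDiff_infty_iff_deriv.mp hf).2 (w x) (w y) (w b ::ₘ s.map w)
  -- The propagator is the inverse of the weight of a vertex of degree two. This is false for modes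
  -- that are not below `N`, where the propagator is zero; hence the cutoff of the index set is `N`
  -- itself.
  have hu : ∀ x : Modes.below d N, -E.propagator f N x b b x * vertexWeight f w (b ::ₘ {x}) = -1 := by
    intro x
    have hne : divDiffMultiset (deriv f) {E.val x, E.val b} ≠ 0 := by
      rw [Multiset.insert_eq_cons, ← Multiset.coe_singleton,
        divDiffMultiset_coe_cons (contDiff_infty_iff_deriv.mp hf).2]
      intro h0
      have h1 := (hN b b.2 x x.2).1
      rw [h0] at h1
      exact lt_irrefl _ h1
    have h2 : vertexWeight f w (b ::ₘ {x}) = divDiffMultiset (deriv f) {E.val x, E.val b} := by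
      rw [vertexWeight, Multiset.map_cons, Multiset.map_singleton]
      exact congrArg _ (Multiset.pair_comm _ _)
    rw [h2, propagator, if_pos ⟨rfl, rfl, x.2, b.2⟩, neg_mul, inv_mul_cancel₀ hne]
  have key := traceSum_ward (v := fun k => (w k : ℂ)) (Φ := E.loopKernel f N N b)
    (Φ' := E.loopKernel f N N b) (fun x y r =>
      cutSum_ward (v := fun k => (w k : ℂ)) (u := fun i : Modes.below d N => -E.propagator f N i b b i)
        (h := fun m => vertexWeight f w (b ::ₘ m)) hh hu x y r)
    (fun i (k l : Modes.below d N) => E.elt (V i) k l) fun k l => E.elt a k l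
  convert key using 2
  · congr 1
    funext i k l
    by_cases hi : i = 0
    · subst hi
      simp only [Function.update_self]
      exact E.elt_mul_left (hV 0) _ _ _
    · simp only [Function.update_of_ne hi]
  · congr 1
    funext i k l
    by_cases hi : i = Fin.last n
    · subst hi
      simp only [Function.update_self]
      exact E.elt_mul_right (hV _) _ _ _
    · simp only [Function.update_of_ne hi]
  · funext i k l
    induction i using Fin.lastCases with
    | last =>
      simp only [Fin.snoc_last]
      exact E.elt_comm _ _ _
    | cast i => simp only [Fin.snoc_castSucc]

end SpectralTriple.Eigenbasis

end OneLoop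

/-! ### Universal forms -/

namespace UnivForms

variable {A : Type*} [Ring A] [Algebra ℂ A]

/-- The form `a₀ da₁ ⋯ daₙ`. -/
def monomial (a : A) (l : List A) : UnivForms A := of a * (l.map del).prod

theorem del_one : del (1 : A) = 0 := by simpa using del_mul (1 : A) 1

theorem degree_eq_span (n : ℕ) : degree A n
    = Submodule.span ℂ {η | ∃ (a : A) (l : List A), l.length = n ∧ η = monomial a l} := by
  rw [degree]
  congr 1
  ext η
  constructor
  · rintro ⟨a₀, a, rfl⟩
    exact ⟨a₀, List.ofFn a, by simp, by simp [monomial, List.map_ofFn, Function.comp_def]⟩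
  · rintro ⟨a, l, rfl, rfl⟩
    refine ⟨a, fun i => l.get i, ?_⟩
    rw [monomial]
    congr 2
    conv_lhs => rw [← List.ofFn_get l, List.map_ofFn]
    rfl

theorem monomial_mem (a : A) (l : List A) : monomial a l ∈ degree A l.length := by
  rw [degree_eq_span]
  exact Submodule.subset_span ⟨a, l, rfl, rfl⟩

theorem monomial_nil (a : A) : monomial a [] = of a := by simp [monomial]

theorem monomial_append (a : A) (l : List A) (b : A) :
    monomial a (l ++ [b]) = monomial a l * del b := by simp [monomial, mul_assoc]

theorem of_mem (a : A) : of a ∈ degree A 0 := monomial_nil a ▸ monomial_mem a []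

theorem mul_del_mem {n : ℕ} {θ : UnivForms A} (hθ : θ ∈ degree A n) (b : A) :
    θ * del b ∈ degree A (n + 1) := by
  rw [degree_eq_span] at hθ
  induction hθ using Submodule.span_induction with
  | mem x hx =>
    obtain ⟨a, l, rfl, rfl⟩ := hx
    rw [← monomial_append]
    simpa using monomial_mem a (l ++ [b])
  | zero => simp
  | add x y _ _ hx hy => rw [add_mul]; exact add_mem hx hy
  | smul c x _ hx => rw [smul_mul_assoc]; exact Submodule.smul_mem _ _ hx

/-- Induction on homogeneous forms. -/
@[elab_as_elim]
theorem degree_induction {P : ∀ (n : ℕ) (θ : UnivForms A), θ ∈ degree A n → Prop}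
    (hof : ∀ a, P 0 (of a) (of_mem a))
    (hdel : ∀ n θ hθ, P n θ hθ → ∀ b, P (n + 1) (θ * del b) (mul_del_mem hθ b))
    (hadd : ∀ n x y hx hy, P n x hx → P n y hy → P n (x + y) (add_mem hx hy))
    (hsmul : ∀ n (c : ℂ) x hx, P n x hx → P n (c • x) (Submodule.smul_mem _ c hx))
    {n : ℕ} {θ : UnivForms A} (hθ : θ ∈ degree A n) : P n θ hθ := by
  have hmono : ∀ (a : A) (l : List A), ∃ h, P l.length (monomial a l) h := by
    intro a l
    induction l using List.reverseRecOn with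
    | nil => rw [monomial_nil]; exact ⟨_, hof a⟩
    | append_singleton l b ih =>
      rw [monomial_append, List.length_append]
      exact ⟨_, hdel _ _ (monomial_mem a l) ih.2 b⟩
  suffices h : ∃ h, P n θ h from h.2
  have hθ' := hθ
  rw [degree_eq_span] at hθ'
  induction hθ' using Submodule.span_induction with
  | mem x hx =>
    obtain ⟨a, l, rfl, rfl⟩ := hx
    exact hmono a l
  -- The zero form of degree `n` is a multiple of a monomial of that degree, so no separate
  -- hypothesis on zero is needed.
  | zero =>
    obtain ⟨h, hP⟩ := hmono 0 (List.replicate n 0)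
    rw [List.length_replicate] at h
    have h2 : P n _ h := by
      convert hP
      simp
    have := hsmul n 0 _ h h2
    refine ⟨hθ, ?_⟩
    convert this using 1
    rw [zero_smul]
  | add x y hx' hy' hx hy =>
    rw [← degree_eq_span] at hx' hy'
    exact ⟨_, hadd n x y hx' hy' (hx hx').2 (hy hy').2⟩
  | smul c x hx' hx =>
    rw [← degree_eq_span] at hx'
    exact ⟨_, hsmul n c x hx' (hx hx').2⟩

/-- By the Leibniz rule `db · c = d(bc) - b dc`, so an element of the algebra can be moved to the
left without changing the degree. -/
theorem mul_of_mem {n : ℕ} {θ : UnivForms A} (hθ : θ ∈ degree A n) :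
    ∀ b, θ * of b ∈ degree A n := by
  induction hθ using degree_induction with
  | hof a => intro b; rw [← map_mul]; exact of_mem _
  | hdel n θ hθ ih b =>
    intro c
    have : θ * del b * of c = θ * del (b * c) - θ * of b * del c := by
      rw [del_mul, mul_add, ← mul_assoc, ← mul_assoc, add_sub_cancel_right]
    rw [this]
    exact sub_mem (mul_del_mem hθ _) (mul_del_mem (ih b) c)
  | hadd n x y _ _ hx hy => intro b; rw [add_mul]; exact add_mem (hx b) (hy b)
  | hsmul n c x _ hx => intro b; rw [smul_mul_assoc]; exact Submodule.smul_mem _ _ (hx b)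

theorem mul_mem_degree {m n : ℕ} {θ η : UnivForms A} (hθ : θ ∈ degree A m)
    (hη : η ∈ degree A n) : θ * η ∈ degree A (m + n) := by
  induction hη using degree_induction with
  | hof a => exact mul_of_mem hθ a
  | hdel n η _ ih b => rw [← mul_assoc]; exact mul_del_mem ih b
  | hadd n x y _ _ hx hy => rw [mul_add]; exact add_mem hx hy
  | hsmul n c x _ hx => rw [mul_smul_comm]; exact Submodule.smul_mem _ _ hx

theorem algebraMap_mem (c : ℂ) : algebraMap ℂ (UnivForms A) c ∈ degree A 0 := by
  rw [← of.commutes c]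
  exact of_mem _

theorem one_mem_degree : (1 : UnivForms A) ∈ degree A 0 := map_one (of (A := A)) ▸ of_mem 1

theorem pow_mem_degree {m : ℕ} {θ : UnivForms A} (hθ : θ ∈ degree A m) (k : ℕ) :
    θ ^ k ∈ degree A (m * k) := by
  induction k with
  | zero => simpa using one_mem_degree
  | succ k ih => rw [pow_succ, Nat.mul_succ]; exact mul_mem_degree ih hθ

/-- Every form is a sum of homogeneous ones. -/
theorem induction_on {P : UnivForms A → Prop} (hdeg : ∀ n, ∀ θ ∈ degree A n, P θ)
    (hadd : ∀ x y, P x → P y → P (x + y)) (θ : UnivForms A) : P θ := by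
  have htop : θ ∈ ⨆ n, degree A n := by
    have hmul : ∀ x ∈ ⨆ n, degree A n, ∀ y ∈ ⨆ n, degree A n, x * y ∈ ⨆ n, degree A n := by
      intro x hx y hy
      induction hx using Submodule.iSup_induction' with
      | mem m x hx =>
        induction hy using Submodule.iSup_induction' with
        | mem n y hy => exact Submodule.mem_iSup_of_mem _ (mul_mem_degree hx hy)
        | zero => simp
        | add y z _ _ hy hz => rw [mul_add]; exact add_mem hy hz
      | zero => simp
      | add x z _ _ hx hz => rw [add_mul]; exact add_mem hx hz
    obtain ⟨x, rfl⟩ : ∃ x, mk x = θ := RingQuot.mkAlgHom_surjective ℂ (UnivRel A) θ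
    induction x using FreeAlgebra.induction with
    | grade0 c =>
      rw [AlgHom.commutes]
      exact Submodule.mem_iSup_of_mem 0 (algebraMap_mem c)
    | grade1 s =>
      rcases s with a | a
      · exact Submodule.mem_iSup_of_mem 0 (of_mem a)
      · refine Submodule.mem_iSup_of_mem 1 ?_
        have := mul_del_mem (of_mem (1 : A)) a
        rwa [map_one, one_mul] at this
    | mul x y hx hy => rw [map_mul]; exact hmul _ hx _ hy
    | add x y hx hy => rw [map_add]; exact add_mem hx hy
  induction htop using Submodule.iSup_induction' with
  | mem n x hx => exact hdeg n x hx
  | zero => exact hdeg 0 0 (zero_mem _)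
  | add x y _ _ hx hy => exact hadd x y hx hy

/-- The parity automorphism. -/
def parity : UnivForms A →ₗ[ℂ] UnivForms A where
  toFun η := diffMatrix η 0 0
  map_add' x y := by simp
  map_smul' c x := by simp

/-- Once the lower row is known, multiplicativity of `diffMatrix` says that `parity` is
multiplicative and that `d` satisfies the graded Leibniz rule. -/
theorem diffMatrix_eq (θ : UnivForms A) : diffMatrix θ = !![parity θ, d θ; 0, θ] := by
  have h : diffMatrix θ 1 0 = 0 ∧ diffMatrix θ 1 1 = θ := by
    induction θ using induction_on with
    | hdeg n θ hθ =>
      induction hθ using degree_induction with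
      | hof a => simp [diffMatrix]
      | hdel n θ _ ih b =>
        have hb : diffMatrix (del b) = !![-del b, 0; 0, del b] := by simp [diffMatrix]
        rw [map_mul, hb]
        simp [Matrix.mul_apply, Fin.sum_univ_two, ih]
      | hadd n x y _ _ hx hy => rw [map_add]; simp [hx, hy]
      | hsmul n c x _ hx => rw [map_smul]; simp [hx]
    | hadd x y hx hy => rw [map_add]; simp [hx, hy]
  ext i j
  fin_cases i <;> fin_cases j
  · rfl
  · rfl
  · exact h.1
  · exact h.2

theorem parity_mul (θ η : UnivForms A) : parity (θ * η) = parity θ * parity η := by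
  have h := congrFun (congrFun (map_mul diffMatrix θ η) 0) 0
  rw [diffMatrix_eq, diffMatrix_eq θ, diffMatrix_eq η] at h
  simpa [Matrix.mul_apply, Fin.sum_univ_two] using h

theorem d_mul (θ η : UnivForms A) : d (θ * η) = parity θ * d η + d θ * η := by
  have h := congrFun (congrFun (map_mul diffMatrix θ η) 0) 1
  rw [diffMatrix_eq, diffMatrix_eq θ, diffMatrix_eq η] at h
  simpa [Matrix.mul_apply, Fin.sum_univ_two] using h

@[simp] theorem parity_of (a : A) : parity (of a) = of a := by simp [parity, diffMatrix]

@[simp] theorem parity_del (a : A) : parity (del a) = -del a := by simp [parity, diffMatrix]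

@[simp] theorem parity_one : parity (1 : UnivForms A) = 1 := by
  rw [← map_one (of (A := A)), parity_of]

theorem d_one : d (1 : UnivForms A) = 0 := by
  rw [← map_one (of (A := A)), d_of, del_one]

theorem parity_of_mem {n : ℕ} {θ : UnivForms A} (hθ : θ ∈ degree A n) :
    parity θ = (-1 : ℂ) ^ n • θ := by
  induction hθ using degree_induction with
  | hof a => simp
  | hdel n θ _ ih b => rw [parity_mul, ih, parity_del, pow_succ]; simp
  | hadd n x y _ _ hx hy => rw [map_add, hx, hy, smul_add]
  | hsmul n c x _ hx => rw [map_smul, hx, smul_comm]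

theorem d_mem {n : ℕ} {θ : UnivForms A} (hθ : θ ∈ degree A n) : d θ ∈ degree A (n + 1) := by
  induction hθ using degree_induction with
  | hof a =>
    rw [d_of, ← one_mul (del a), ← map_one (of (A := A))]
    exact mul_del_mem (of_mem 1) a
  | hdel n θ _ ih b =>
    rw [d_mul, d_del, mul_zero, zero_add]
    exact mul_del_mem ih b
  | hadd n x y _ _ hx hy => rw [map_add]; exact add_mem hx hy
  | hsmul n c x _ hx => rw [map_smul]; exact Submodule.smul_mem _ _ hx

theorem d_d (θ : UnivForms A) : d (d θ) = 0 := by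
  induction θ using induction_on with
  | hdeg n θ hθ =>
    induction hθ using degree_induction with
    | hof a => simp
    | hdel n θ _ ih b => simp [d_mul, ih]
    | hadd n x y _ _ hx hy => simp [hx, hy]
    | hsmul n c x _ hx => simp [hx]
  | hadd x y hx hy => simp [hx, hy]

theorem parity_d (θ : UnivForms A) : parity (d θ) = -d (parity θ) := by
  induction θ using induction_on with
  | hdeg n θ hθ =>
    rw [parity_of_mem hθ, parity_of_mem (d_mem hθ), map_smul, pow_succ]
    simp
  | hadd x y hx hy => rw [map_add, map_add, map_add, hx, hy, map_add, neg_add]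

theorem d_monomial (a : A) (l : List A) : d (monomial a l) = monomial 1 (a :: l) := by
  induction l using List.reverseRecOn with
  | nil => simp [monomial]
  | append_singleton l b ih =>
    rw [monomial_append, d_mul, d_del, mul_zero, zero_add, ih, ← monomial_append, List.cons_append]

end UnivForms

/-! ### Integrals over normalised cochains -/

section Integrals

variable {A : Type*} [Ring A] [Algebra ℂ A]

namespace UnivForms

/-- The form `a₀ da₁ ⋯ daₙ` of a tuple. -/
def tupleForm {n : ℕ} (a : Fin (n + 1) → A) : UnivForms A :=
  of (a 0) * (List.ofFn fun i : Fin n => del (a i.succ)).prod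

theorem tupleForm_eq_monomial {n : ℕ} (a : Fin (n + 1) → A) :
    tupleForm a = monomial (a 0) (List.ofFn fun i : Fin n => a i.succ) := by
  simp [tupleForm, monomial, List.map_ofFn, Function.comp_def]

theorem tupleForm_mem {n : ℕ} (a : Fin (n + 1) → A) : tupleForm a ∈ degree A n :=
  Submodule.subset_span ⟨_, _, rfl⟩

theorem tupleForm_zero (a : Fin 1 → A) : tupleForm a = of (a 0) := by simp [tupleForm]

theorem tupleForm_succ {n : ℕ} (a : Fin (n + 2) → A) :
    tupleForm a = tupleForm (fun i : Fin (n + 1) => a i.castSucc) * del (a (Fin.last _)) := by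
  rw [tupleForm, tupleForm, List.ofFn_succ', List.concat_eq_append, List.prod_append,
    List.prod_singleton, ← mul_assoc]
  rfl

theorem degree_eq_span_tupleForm (n : ℕ) :
    degree A n = Submodule.span ℂ (Set.range fun a : Fin (n + 1) → A => tupleForm a) := by
  rw [degree]
  congr 1
  ext η
  constructor
  · rintro ⟨a₀, a, rfl⟩
    exact ⟨Fin.cons a₀ a, by simp [tupleForm]⟩
  · rintro ⟨a, rfl⟩
    exact ⟨a 0, fun i => a i.succ, rfl⟩

theorem tupleForm_cons {n : ℕ} (x : A) (a : Fin n → A) :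
    tupleForm (Fin.cons x a : Fin (n + 1) → A) = of x * (List.ofFn fun i => del (a i)).prod := by
  simp [tupleForm]

theorem d_tupleForm {n : ℕ} (a : Fin (n + 1) → A) :
    d (tupleForm a) = tupleForm (Fin.cons 1 a : Fin (n + 2) → A) := by
  rw [tupleForm_eq_monomial, d_monomial, tupleForm_eq_monomial]
  simp

theorem of_mul_tupleForm {n : ℕ} (x : A) (a : Fin (n + 1) → A) :
    of x * tupleForm a = tupleForm (Fin.cons (x * a 0) fun i : Fin n => a i.succ) := by
  rw [tupleForm, tupleForm_cons, map_mul, mul_assoc]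

/-- The telescoping sum in the Hochschild coboundary. -/
theorem sum_tupleForm_contractNth {n : ℕ} (a : Fin (n + 2) → A) :
    ∑ j : Fin (n + 1), (-1 : ℂ) ^ (j : ℕ) • tupleForm (Fin.contractNth j.castSucc (· * ·) a)
      = (-1 : ℂ) ^ n • (tupleForm (fun i : Fin (n + 1) => a i.castSucc) * of (a (Fin.last _))) := by
  induction n with
  | zero =>
    rw [Fin.sum_univ_one, tupleForm_zero, tupleForm_zero, ← map_mul]
    simp [Fin.contractNth]
  | succ n ih =>
    have h1 : ∀ j : Fin (n + 1), tupleForm (Fin.contractNth j.castSucc.castSucc (· * ·) a)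
        = tupleForm (Fin.contractNth j.castSucc (· * ·) fun i : Fin (n + 2) => a i.castSucc)
          * del (a (Fin.last _)) := by
      intro j
      rw [tupleForm_succ]
      congr 2
      rw [Fin.contractNth_apply_of_gt]
      · rw [Fin.succ_last]
      · simpa using Nat.lt_succ_iff.mp j.2
    have h2 : tupleForm (Fin.contractNth (Fin.last (n + 1)).castSucc (· * ·) a)
        = tupleForm (fun i : Fin (n + 1) => a i.castSucc.castSucc)
          * del (a (Fin.last (n + 1)).castSucc * a (Fin.last _)) := by
      rw [tupleForm_succ]
      congr 2
      · funext i
        rw [Fin.contractNth_apply_of_lt]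
        simpa using i.2
      · rw [Fin.contractNth_apply_of_eq]
        · rw [Fin.succ_last]
        · simp
    rw [Fin.sum_univ_castSucc, h2]
    simp only [Fin.val_castSucc, Fin.val_last]
    simp only [h1, ← smul_mul_assoc, ← Finset.sum_mul]
    -- One half of the Leibniz expansion of the last differential cancels the sum over the earlier
    -- positions, the other half is the claim.
    rw [ih, tupleForm_succ (fun i : Fin (n + 2) => a i.castSucc), del_mul, pow_succ]
    generalize (-1 : ℂ) ^ n = c
    simp only [smul_mul_assoc, mul_neg, mul_one, neg_smul, neg_mul, mul_add, mul_assoc]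
    change _ = -(c • (_ * (_ * of (a (Fin.last (n + 2))))))
    abel

end UnivForms

open UnivForms

variable {n : ℕ} {φ : Cochain A n}

theorem integral_tupleForm (hφ : φ.IsNormalized) (a : Fin (n + 1) → A) :
    integral φ (tupleForm a) = φ a := by
  rw [tupleForm, integral_apply hφ]
  congr 1
  exact Fin.cons_self_tail a

theorem integral_eq_zero (hφ : φ.IsNormalized) {m : ℕ} (hm : m ≠ n) {θ : UnivForms A}
    (hθ : θ ∈ degree A m) : integral φ θ = 0 := by
  rw [degree_eq_span_tupleForm] at hθ
  induction hθ using Submodule.span_induction with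
  | mem x hx =>
    obtain ⟨a, rfl⟩ := hx
    have h := formAction_prod_del m fun i => a i.succ
    have h1 : formAction (UnivForms.of (a 0))
        (formAction (List.ofFn fun i => UnivForms.del (a i.succ)).prod (1 ⊗ₜ[ℂ] 1)
          - 1 ⊗ₜ[ℂ] TensorAlgebra.tprod ℂ A m fun i => a i.succ) ∈ unitSpan A := by
      suffices h : unitSpan A ≤ (unitSpan A).comap (formAction (UnivForms.of (a 0))) from h ‹_›
      conv_lhs => rw [unitSpan]
      rw [Submodule.span_le]
      rintro _ ⟨b, m, c, hc, rfl⟩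
      simp only [SetLike.mem_coe, Submodule.mem_comap, formAction_of_tmul]
      exact Submodule.subset_span ⟨_, _, _, hc, rfl⟩
    have h2 := tensorEval_unitSpan hφ h1
    rw [map_sub, map_sub, formAction_of_tmul, tensorEval_tprod, dif_neg hm, sub_zero] at h2
    simpa [integral, tupleForm] using h2
  | zero => simp
  | add x y _ _ hx hy => rw [map_add, hx, hy, add_zero]
  | smul c x _ hx => rw [map_smul, hx, smul_zero]

theorem Cochain.IsNormalized.connesB₀ {φ : Cochain A (n + 1)} (hφ : φ.IsNormalized) :
    (connesB₀ φ).IsNormalized := by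
  intro a j _ hj
  exact hφ _ j.succ (Fin.succ_ne_zero j) (by simpa using hj)

theorem connesB₀_apply (φ : Cochain A (n + 1)) (a : Fin (n + 1) → A) :
    connesB₀ φ a = φ (Fin.cons 1 a) := rfl

theorem integral_connesB₀ {φ : Cochain A (n + 1)} (hφ : φ.IsNormalized) (θ : UnivForms A) :
    integral (connesB₀ φ) θ = integral φ (d θ) := by
  induction θ using UnivForms.induction_on with
  | hdeg m θ hθ =>
    by_cases hm : m = n
    · subst hm
      rw [degree_eq_span_tupleForm] at hθ
      induction hθ using Submodule.span_induction with
      | mem x hx =>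
        obtain ⟨a, rfl⟩ := hx
        dsimp only
        rw [integral_tupleForm hφ.connesB₀, d_tupleForm, integral_tupleForm hφ, connesB₀_apply]
      | zero => simp
      | add x y _ _ hx hy => simp only [map_add, hx, hy]
      | smul c x _ hx => simp only [map_smul, hx]
    · rw [integral_eq_zero hφ.connesB₀ hm hθ, integral_eq_zero hφ (by omega) (d_mem hθ)]
  | hadd x y hx hy => simp only [map_add, hx, hy]

/-- After telescoping, `bφ` is up to sign the integral of the commutator of `a₀ da₁ ⋯ daₙ` with the
last argument: it measures how far the integral is from a trace. -/
theorem hochschildB_eq (hφ : φ.IsNormalized) (a : Fin (n + 2) → A) :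
    hochschildB φ a = (-1) ^ n *
      (integral φ (tupleForm (fun i : Fin (n + 1) => a i.castSucc) * of (a (Fin.last _)))
        - integral φ (of (a (Fin.last _)) * tupleForm fun i : Fin (n + 1) => a i.castSucc)) := by
  have h := congrArg (integral φ) (sum_tupleForm_contractNth a)
  simp only [map_sum, map_smul, smul_eq_mul, integral_tupleForm hφ] at h
  rw [hochschildB, h, of_mul_tupleForm, integral_tupleForm hφ, pow_succ]
  simp only [Fin.castSucc_zero]
  ring

theorem connesB_eq {φ : Cochain A (n + 1)} (hφ : φ.IsNormalized) (a : Fin (n + 1) → A) :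
    connesB φ a = ∑ j : Fin (n + 1), (-1) ^ (n * (j : ℕ)) *
      integral φ (List.ofFn fun i => del (a (j + i))).prod := by
  refine Finset.sum_congr rfl fun j _ => ?_
  rw [← integral_tupleForm hφ, tupleForm_cons, map_one, one_mul]

end Integrals

/-! ### Cyclic brackets with a Ward identity -/

open UnivForms

/-- A cyclic multilinear bracket that satisfies the Ward identity, for a representation `rep` and a
derivation `der` of `A`, together with the functional `a₀ da₁ ⋯ daₙ ↦ ⟨a₀ δa₁, δa₂, …, δaₙ⟩`. -/
structure CyclicBracket (A S : Type*) [Ring A] [Algebra ℂ A] [Ring S] [Algebra ℂ S] where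
  rep : A →ₐ[ℂ] S
  der : A →ₗ[ℂ] S
  der_mul : ∀ a b, der (a * b) = der a * rep b + rep a * der b
  oneForms : Submodule ℂ S
  mul_mem : ∀ a b, rep a * der b ∈ oneForms
  eval : List S → ℂ
  eval_add : ∀ x y l, eval ((x + y) :: l) = eval (x :: l) + eval (y :: l)
  eval_smul : ∀ (c : ℂ) x l, eval ((c • x) :: l) = c * eval (x :: l)
  eval_concat : ∀ x l, eval (l ++ [x]) = eval (x :: l)
  ward : ∀ x ∈ oneForms, ∀ y ∈ oneForms, ∀ l : List S, (∀ z ∈ l, z ∈ oneForms) → ∀ a,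
    eval (x :: (rep a * y) :: l) = eval ((x * rep a) :: y :: l) + eval (x :: der a :: y :: l)
  ward_singleton : ∀ x ∈ oneForms, ∀ a, eval [rep a * x] = eval [x * rep a] + eval [x, der a]
  eval_der : ∀ a, eval [der a] = 0
  total : UnivForms A →ₗ[ℂ] ℂ
  total_of : ∀ a, total (of a) = 0
  total_monomial : ∀ a b l, total (monomial a (b :: l)) = eval ((rep a * der b) :: l.map der)

namespace CyclicBracket

variable {A S : Type*} [Ring A] [Algebra ℂ A] [Ring S] [Algebra ℂ S] (B : CyclicBracket A S)

theorem der_mem (a : A) : B.der a ∈ B.oneForms := by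
  simpa using B.mul_mem 1 a

theorem eval_append_comm (l l' : List S) : B.eval (l ++ l') = B.eval (l' ++ l) := by
  induction l generalizing l' with
  | nil => simp
  | cons x l ih =>
    rw [List.cons_append, ← B.eval_concat, List.append_assoc, ih, List.append_assoc,
      List.singleton_append]

/-- `g` is the functional `t ↦ ⟨a₀ δa₁, δa₂, …, δaₙ, t⟩` for `θ = a₀ da₁ ⋯ daₙ`, `n ≥ 1`, or a
linear combination of such; `p` says whether `n` is odd. -/
inductive IsTail : Bool → (List S → ℂ) → UnivForms A → Prop
  | base (a b : A) : IsTail true (fun t => B.eval ((B.rep a * B.der b) :: t)) (of a * del b)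
  | step {p : Bool} {g : List S → ℂ} {θ : UnivForms A} (b : A) (h : IsTail p g θ) :
    IsTail (!p) (fun t => g (B.der b :: t)) (θ * del b)
  | add {p : Bool} {g g' : List S → ℂ} {θ θ' : UnivForms A} (h : IsTail p g θ)
    (h' : IsTail p g' θ') : IsTail p (fun t => g t + g' t) (θ + θ')
  | smul {p : Bool} {g : List S → ℂ} {θ : UnivForms A} (c : ℂ) (h : IsTail p g θ) :
    IsTail p (fun t => c * g t) (c • θ)

namespace IsTail

variable {B} {p : Bool} {g g' : List S → ℂ} {θ θ' : UnivForms A}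

theorem sub (h : B.IsTail p g θ) (h' : B.IsTail p g' θ') :
    B.IsTail p (fun t => g t - g' t) (θ - θ') := by
  have := h.add (h'.smul (-1))
  simpa [sub_eq_add_neg] using this

theorem zero (p : Bool) : B.IsTail p (fun _ => 0) 0 := by
  cases p with
  | false => simpa using ((base (B := B) 0 0).step 0).smul 0
  | true => simpa using (base (B := B) 0 0).smul 0

theorem apply_map_der (h : B.IsTail p g θ) :
    ∀ l : List A, g (l.map B.der) = B.total (θ * (l.map del).prod) := by
  induction h with
  | base a b =>
    intro l
    beta_reduce
    rw [← B.total_monomial, monomial, List.map_cons, List.prod_cons, mul_assoc]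
  | step b h ih =>
    intro l
    have := ih (b :: l)
    rwa [List.map_cons, List.map_cons, List.prod_cons, ← mul_assoc] at this
  | add h h' ih ih' => intro l; beta_reduce; rw [ih, ih', add_mul, map_add]
  | smul c h ih => intro l; beta_reduce; rw [ih, smul_mul_assoc, map_smul, smul_eq_mul]

theorem apply_nil (h : B.IsTail p g θ) : g [] = B.total θ := by simpa using h.apply_map_der []

theorem apply_der (h : B.IsTail p g θ) (a : A) : g [B.der a] = B.total (θ * del a) := by
  simpa using h.apply_map_der [a]

theorem apply_der_der (h : B.IsTail p g θ) (a b : A) :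
    g [B.der a, B.der b] = B.total (θ * del a * del b) := by
  simpa [mul_assoc] using h.apply_map_der [a, b]

theorem map_add (h : B.IsTail p g θ) (x y : S) (t : List S) : ∀ l,
    g (l ++ (x + y) :: t) = g (l ++ x :: t) + g (l ++ y :: t) := by
  induction h with
  | base a b =>
    intro l
    beta_reduce
    rw [← List.cons_append, B.eval_append_comm, List.cons_append, B.eval_add, ← List.cons_append,
      ← List.cons_append, B.eval_append_comm, B.eval_append_comm (y :: t)]
    rfl
  | step b h ih => intro l; exact ih (B.der b :: l)
  | add h h' ih ih' => intro l; beta_reduce; rw [ih, ih']; ring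
  | smul c h ih => intro l; beta_reduce; rw [ih, mul_add]

theorem map_smul (h : B.IsTail p g θ) (c : ℂ) (x : S) (t : List S) : ∀ l,
    g (l ++ (c • x) :: t) = c * g (l ++ x :: t) := by
  induction h with
  | base a b =>
    intro l
    beta_reduce
    rw [← List.cons_append, B.eval_append_comm, List.cons_append, B.eval_smul, ← List.cons_append,
      B.eval_append_comm]
    rfl
  | step b h ih => intro l; exact ih (B.der b :: l)
  | add h h' ih ih' => intro l; beta_reduce; rw [ih, ih']; ring
  | smul c h ih => intro l; beta_reduce; rw [ih]; ring

/-- Cyclicity of the bracket brings any two neighbouring arguments to the front. -/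
theorem ward (h : B.IsTail p g θ) {x y : S} (hx : x ∈ B.oneForms) (hy : y ∈ B.oneForms)
    {t : List S} (ht : ∀ z ∈ t, z ∈ B.oneForms) (a : A) : ∀ l, (∀ z ∈ l, z ∈ B.oneForms) →
    g (l ++ x :: (B.rep a * y) :: t)
      = g (l ++ (x * B.rep a) :: y :: t) + g (l ++ x :: B.der a :: y :: t) := by
  induction h with
  | base c b =>
    intro l hl
    have := B.ward x hx y hy (t ++ (B.rep c * B.der b) :: l) (by
      intro z hz
      rcases List.mem_append.mp hz with hz | hz
      · exact ht z hz
      · rcases List.mem_cons.mp hz with rfl | hz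
        · exact B.mul_mem _ _
        · exact hl z hz) a
    beta_reduce
    simp only [← List.cons_append] at this ⊢
    rw [B.eval_append_comm, this, B.eval_append_comm, B.eval_append_comm (x :: _ :: _)]
  | step b h ih =>
    intro l hl
    exact ih (B.der b :: l) (by
      intro z hz
      rcases List.mem_cons.mp hz with rfl | hz
      · exact B.der_mem _
      · exact hl z hz)
  | add h h' ih ih' => intro l hl; beta_reduce; rw [ih l hl, ih' l hl]; ring
  | smul c h ih => intro l hl; beta_reduce; rw [ih l hl]; ring

/-- Moving an element of `A` to the left past the differentials. -/
theorem mul_of (h : B.IsTail p g θ) : ∀ a, ∃ g', B.IsTail p g' (θ * of a) ∧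
    ∀ y ∈ B.oneForms, ∀ t : List S, (∀ z ∈ t, z ∈ B.oneForms) →
      g ((B.rep a * y) :: t) = g' (y :: t) + if p then g (B.der a :: y :: t) else 0 := by
  induction h with
  | base c b =>
    intro a
    refine ⟨_, by
      have := (base (B := B) c (b * a)).sub (base (B := B) (c * b) a)
      have e : of c * del b * of a = of c * del (b * a) - of (c * b) * del a := by
        rw [del_mul, mul_add, map_mul]
        simp only [mul_assoc, add_sub_cancel_right]
      rw [e]
      exact this, fun y hy t ht => ?_⟩
    have e2 : B.rep c * B.der (b * a) = B.rep c * B.der b * B.rep a + B.rep (c * b) * B.der a := by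
      rw [B.der_mul, _root_.map_mul, mul_add]
      simp only [mul_assoc]
    beta_reduce
    rw [B.ward _ (B.mul_mem c b) y hy t ht, if_pos rfl, e2, B.eval_add, add_sub_cancel_right]
  | @step p g θ b h ih =>
    intro a
    obtain ⟨g', hg', h1⟩ := ih b
    refine ⟨_, by
      have := (h.step (b * a)).sub (hg'.step a)
      have e : θ * del b * of a = θ * del (b * a) - θ * of b * del a := by
        rw [del_mul, mul_add]
        simp only [mul_assoc, add_sub_cancel_right]
      rw [e]
      exact this, fun y hy t ht => ?_⟩
    have hyt : ∀ z ∈ y :: t, z ∈ B.oneForms := by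
      intro z hz
      rcases List.mem_cons.mp hz with rfl | hz
      · exact hy
      · exact ht z hz
    -- Each further differential produces the extra term once by the Ward identity, and the term
    -- inherited from `θ`, if there is one, cancels it. This is why it is present exactly in odd
    -- degree.
    have h2 := h1 _ (B.der_mem a) (y :: t) hyt
    have h3 := h.ward (B.der_mem b) hy ht a [] (by simp)
    have h4 := h.map_add (B.der b * B.rep a) (B.rep b * B.der a) (y :: t) []
    rw [← B.der_mul] at h4
    simp only [List.nil_append] at h3 h4
    beta_reduce
    rw [h3, h4, h2]
    cases p <;> simp; ring
  | add h h' ih ih' =>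
    intro a
    obtain ⟨k, hk, h1⟩ := ih a
    obtain ⟨k', hk', h1'⟩ := ih' a
    refine ⟨_, by rw [add_mul]; exact hk.add hk', fun y hy t ht => ?_⟩
    beta_reduce
    rw [h1 y hy t ht, h1' y hy t ht]
    split_ifs <;> ring
  | smul c h ih =>
    intro a
    obtain ⟨k, hk, h1⟩ := ih a
    refine ⟨_, by rw [smul_mul_assoc]; exact hk.smul c, fun y hy t ht => ?_⟩
    beta_reduce
    rw [h1 y hy t ht]
    split_ifs <;> ring

/-- Cyclically, the last argument precedes the first, so a factor `a` in front of the form comes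
from the last argument by the Ward identity. -/
theorem of_mul (h : B.IsTail p g θ) (a : A) : ∃ g', B.IsTail p g' (of a * θ) ∧
    ∀ y ∈ B.oneForms, ∀ t : List S, (∀ z ∈ t, z ∈ B.oneForms) →
      g' (t ++ [y]) = g (t ++ [y * B.rep a]) + g (t ++ [y, B.der a]) := by
  induction h with
  | base c b =>
    refine ⟨_, by rw [← mul_assoc, ← map_mul]; exact base (a * c) b, fun y hy t ht => ?_⟩
    beta_reduce
    have h2 : t ++ [y, B.der a] = t ++ [y] ++ [B.der a] := by simp
    rw [h2, ← List.cons_append, ← List.cons_append, ← List.cons_append, ← List.cons_append,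
      B.eval_concat, B.eval_concat, B.eval_concat, ← List.cons_append, B.eval_concat,
      _root_.map_mul, mul_assoc]
    exact B.ward y hy _ (B.mul_mem c b) t ht a
  | step b h ih =>
    obtain ⟨g', hg', h1⟩ := ih
    refine ⟨_, by rw [← mul_assoc]; exact hg'.step b, fun y hy t ht => ?_⟩
    exact h1 y hy (B.der b :: t) (by
      intro z hz
      rcases List.mem_cons.mp hz with rfl | hz
      · exact B.der_mem _
      · exact ht z hz)
  | add h h' ih ih' =>
    obtain ⟨k, hk, h1⟩ := ih
    obtain ⟨k', hk', h1'⟩ := ih'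
    refine ⟨_, by rw [mul_add]; exact hk.add hk', fun y hy t ht => ?_⟩
    beta_reduce
    rw [h1 y hy t ht, h1' y hy t ht]
    ring
  | smul c h ih =>
    obtain ⟨k, hk, h1⟩ := ih
    refine ⟨_, by rw [mul_smul_comm]; exact hk.smul c, fun y hy t ht => ?_⟩
    beta_reduce
    rw [h1 y hy t ht]
    ring

/-- The last argument `δa` is rotated to the front and the coefficient of `θ` is moved into it. By
the Leibniz rule the main term is `da θ`; the additional term of the Ward identity is `dθ` followed
by `da`. -/
theorem del_mul (h : B.IsTail p g θ) (a : A) : ∃ g' g'', B.IsTail (!p) g' (del a * θ) ∧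
    B.IsTail (!p) g'' (d θ) ∧ ∀ t : List S, (∀ z ∈ t, z ∈ B.oneForms) →
      g (t ++ [B.der a]) = g' t + g'' (t ++ [B.der a]) := by
  induction h with
  | base c b =>
    have h1 := ((base (B := B) 1 (a * c)).step b).sub ((base (B := B) a c).step b)
    have h2 := (base (B := B) 1 c).step b
    have e1 : of (1 : A) * del (a * c) * del b - of a * del c * del b = del a * (of c * del b) := by
      rw [UnivForms.del_mul, map_one, one_mul, add_mul, add_sub_cancel_right, mul_assoc]
    have e2 : of (1 : A) * del c * del b = d (of c * del b) := by
      rw [d_of_mul_del, map_one, one_mul]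
    rw [e1] at h1
    rw [e2] at h2
    refine ⟨_, _, h1, h2, fun t ht => ?_⟩
    have h3 := B.ward _ (B.der_mem a) _ (B.der_mem b) t ht c
    have h4 := B.eval_add (B.der a * B.rep c) (B.rep a * B.der c) (B.der b :: t)
    rw [← B.der_mul] at h4
    beta_reduce
    rw [← List.cons_append, ← List.cons_append, ← List.cons_append, B.eval_concat, B.eval_concat,
      h3, _root_.map_one, one_mul, one_mul, h4]
    ring
  | step b h ih =>
    obtain ⟨g', g'', h1, h2, h3⟩ := ih
    have e2 := h2.step b
    have e : d ‹UnivForms A› * del b = d (‹UnivForms A› * del b) := by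
      rw [d_mul, d_del, mul_zero, zero_add]
    rw [e] at e2
    refine ⟨_, _, by rw [← mul_assoc]; exact h1.step b, e2, fun t ht => ?_⟩
    exact h3 (B.der b :: t) (by
      intro z hz
      rcases List.mem_cons.mp hz with rfl | hz
      · exact B.der_mem _
      · exact ht z hz)
  | add h h' ih ih' =>
    obtain ⟨g', g'', h1, h2, h3⟩ := ih
    obtain ⟨k', k'', h1', h2', h3'⟩ := ih'
    refine ⟨_, _, by rw [mul_add]; exact h1.add h1', by rw [_root_.map_add]; exact h2.add h2',
      fun t ht => ?_⟩
    beta_reduce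
    rw [h3 t ht, h3' t ht]
    ring
  | smul c h ih =>
    obtain ⟨g', g'', h1, h2, h3⟩ := ih
    refine ⟨_, _, by rw [mul_smul_comm]; exact h1.smul c, by rw [_root_.map_smul]; exact h2.smul c,
      fun t ht => ?_⟩
    beta_reduce
    rw [h3 t ht]
    ring

theorem parity_eq (h : B.IsTail p g θ) : parity θ = if p then -θ else θ := by
  induction h with
  | base a b => simp [parity_mul]
  | @step p g θ b h ih => rw [parity_mul, ih]; cases p <;> simp
  | @add p _ _ _ _ h h' ih ih' => rw [_root_.map_add, ih, ih']; cases p <;> simp [add_comm]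
  | @smul p _ _ c h ih => rw [_root_.map_smul, ih]; cases p <;> simp

theorem total_mul_of (h : B.IsTail p g θ) (a : A) : B.total (θ * of a)
    = B.total (of a * θ) - if p then B.total (θ * del a) else 0 := by
  induction h with
  | base c b =>
    have e : of c * del b * of a = of c * del (b * a) - of (c * b) * del a := by
      rw [UnivForms.del_mul, mul_add, map_mul]
      simp only [mul_assoc, add_sub_cancel_right]
    have e2 : B.rep c * B.der (b * a) = B.rep c * B.der b * B.rep a + B.rep (c * b) * B.der a := by
      rw [B.der_mul, _root_.map_mul, mul_add]
      simp only [mul_assoc]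
    have h1 := B.ward_singleton _ (B.mul_mem c b) a
    have h2 := (base (B := B) c b).apply_der a
    rw [e, map_sub, ← (base (B := B) c (b * a)).apply_nil, ← (base (B := B) (c * b) a).apply_nil,
      e2, B.eval_add, if_pos rfl, ← h2, ← mul_assoc, ← map_mul,
      ← (base (B := B) (a * c) b).apply_nil, _root_.map_mul B.rep a, mul_assoc (B.rep a), h1]
    ring
  | @step p g θ b h ih =>
    obtain ⟨g', hg', h1⟩ := h.mul_of b
    obtain ⟨k, hk, h2⟩ := h.of_mul a
    have e : θ * del b * of a = θ * del (b * a) - θ * of b * del a := by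
      rw [UnivForms.del_mul, mul_add]
      simp only [mul_assoc, add_sub_cancel_right]
    have h3 := h1 _ (B.der_mem a) [] (by simp)
    have h4 := h2 _ (B.der_mem b) [] (by simp)
    have h5 := h.map_add (B.der b * B.rep a) (B.rep b * B.der a) [] []
    rw [← B.der_mul] at h5
    simp only [List.nil_append] at h4 h5
    rw [e, map_sub, ← h.apply_der, ← hg'.apply_der, ← mul_assoc, ← hk.apply_der, ← h.apply_der_der,
      h4, h5, h3]
    cases p <;> simp; ring
  | @add p _ _ _ _ h h' ih ih' =>
    simp only [add_mul, mul_add, _root_.map_add, ih, ih']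
    split_ifs <;> ring
  | @smul p _ _ c h ih =>
    simp only [smul_mul_assoc, mul_smul_comm, _root_.map_smul, ih, smul_eq_mul]
    split_ifs <;> ring

end IsTail

end CyclicBracket

namespace UnivForms

variable {A : Type*} [Ring A] [Algebra ℂ A]

theorem degree_one_induction {P : ∀ α : UnivForms A, α ∈ degree A 1 → Prop}
    (hmul : ∀ a b, P (of a * del b) (mul_del_mem (of_mem a) b))
    (hadd : ∀ x y hx hy, P x hx → P y hy → P (x + y) (add_mem hx hy))
    (hsmul : ∀ (c : ℂ) x hx, P x hx → P (c • x) (Submodule.smul_mem _ c hx))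
    {α : UnivForms A} (hα : α ∈ degree A 1) : P α hα := by
  have h : ∀ n (θ : UnivForms A) (hθ : θ ∈ degree A n),
      (∀ h : n = 0, ∃ a, θ = of a) ∧ ∀ h : n = 1, P θ (h ▸ hθ) := by
    intro n θ hθ
    induction hθ using degree_induction with
    | hof a => exact ⟨fun _ => ⟨a, rfl⟩, fun h => by simp at h⟩
    | hdel n θ hθ ih b =>
      refine ⟨fun h => by simp at h, fun h => ?_⟩
      obtain ⟨a, rfl⟩ := ih.1 (by omega)
      exact hmul a b
    | hadd n x y _ _ hx hy =>
      refine ⟨fun h => ?_, fun h => hadd _ _ _ _ (hx.2 h) (hy.2 h)⟩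
      obtain ⟨a, rfl⟩ := hx.1 h
      obtain ⟨b, rfl⟩ := hy.1 h
      exact ⟨a + b, by rw [map_add]⟩
    | hsmul n c x _ hx =>
      refine ⟨fun h => ?_, fun h => hsmul _ _ _ (hx.2 h)⟩
      obtain ⟨a, rfl⟩ := hx.1 h
      exact ⟨c • a, by rw [map_smul]⟩
  exact (h 1 α hα).2 rfl

end UnivForms

/-! ### How far the functional on universal forms is from a trace. -/

namespace CyclicBracket

open UnivForms

variable {A S : Type*} [Ring A] [Algebra ℂ A] [Ring S] [Algebra ℂ S] (B : CyclicBracket A S)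

theorem exists_isTail {n : ℕ} {θ : UnivForms A} (hθ : θ ∈ degree A n) :
    (n = 0 → ∃ a, θ = of a) ∧ (n ≠ 0 → ∃ g, B.IsTail (Nat.bodd n) g θ) := by
  induction hθ using degree_induction with
  | hof a => exact ⟨fun _ => ⟨a, rfl⟩, fun h => absurd rfl h⟩
  | hdel n θ hθ ih b =>
    refine ⟨fun h => by simp at h, fun _ => ?_⟩
    rcases eq_or_ne n 0 with rfl | hn
    · obtain ⟨a, rfl⟩ := ih.1 rfl
      exact ⟨_, .base a b⟩
    · obtain ⟨g, hg⟩ := ih.2 hn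
      rw [Nat.bodd_succ]
      exact ⟨_, hg.step b⟩
  | hadd n x y _ _ hx hy =>
    refine ⟨fun h => ?_, fun h => ?_⟩
    · obtain ⟨a, rfl⟩ := hx.1 h
      obtain ⟨b, rfl⟩ := hy.1 h
      exact ⟨a + b, by rw [map_add]⟩
    · obtain ⟨g, hg⟩ := hx.2 h
      obtain ⟨k, hk⟩ := hy.2 h
      exact ⟨_, hg.add hk⟩
  | hsmul n c x _ hx =>
    refine ⟨fun h => ?_, fun h => ?_⟩
    · obtain ⟨a, rfl⟩ := hx.1 h
      exact ⟨c • a, by rw [map_smul]⟩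
    · obtain ⟨g, hg⟩ := hx.2 h
      exact ⟨_, hg.smul c⟩

/-- The combination `(θ - parity θ) / 2` is the odd part of `θ`, so the defect is seen by odd forms
only. -/
theorem total_mul_of (θ : UnivForms A) (a : A) : B.total (θ * of a)
    = B.total (of a * θ) - 1 / 2 * B.total ((θ - parity θ) * del a) := by
  induction θ using UnivForms.induction_on with
  | hdeg n θ hθ =>
    have h := B.exists_isTail hθ
    rcases eq_or_ne n 0 with rfl | hn
    · obtain ⟨b, rfl⟩ := h.1 rfl
      rw [parity_of, sub_self, zero_mul, map_zero, ← map_mul, ← map_mul, B.total_of, B.total_of]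
      ring
    · obtain ⟨g, hg⟩ := h.2 hn
      rw [hg.total_mul_of, hg.parity_eq]
      split_ifs
      · rw [sub_neg_eq_add, add_mul, map_add]
        ring
      · simp
  | hadd x y hx hy =>
    simp only [add_mul, mul_add, map_add, hx, hy, sub_mul, map_sub]
    ring

theorem total_mul_del (θ : UnivForms A) (a : A) :
    B.total (θ * del a) = B.total (del a * θ) + B.total (d θ * del a) := by
  induction θ using UnivForms.induction_on with
  | hdeg n θ hθ =>
    have h := B.exists_isTail hθ
    rcases eq_or_ne n 0 with rfl | hn
    · obtain ⟨b, rfl⟩ := h.1 rfl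
      have h1 := (IsTail.base (B := B) b a).apply_nil
      have h2 := (IsTail.base (B := B) a b).apply_nil
      have h3 := (IsTail.base (B := B) 1 b).apply_der a
      have h4 := (IsTail.base (B := B) 1 (a * b)).apply_nil
      have h5 := B.ward_singleton _ (B.der_mem b) a
      have h6 := B.eval_add (B.der b * B.rep a) (B.rep b * B.der a) []
      have e : del a * of b = of (1 : A) * del (a * b) - of a * del b := by
        rw [UnivForms.del_mul, map_one, one_mul, add_sub_cancel_right]
      rw [← B.der_mul, B.eval_der] at h6
      simp only [map_one, one_mul, B.eval_der] at h1 h2 h3 h4 h5 h6 e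
      rw [d_of, e, map_sub, ← h1, ← h2, ← h3, ← h4]
      linear_combination h5 - h6
    · obtain ⟨g, hg⟩ := h.2 hn
      obtain ⟨g', g'', h1, h2, h3⟩ := hg.del_mul a
      have h4 := h3 [] (by simp)
      rwa [List.nil_append, hg.apply_der, h1.apply_nil, h2.apply_der] at h4
  | hadd x y hx hy =>
    simp only [add_mul, mul_add, map_add, hx, hy]
    ring

/-- For `α = a db` the two differentials are moved one after the other, and the correction terms of
the two moves cancel each other. -/
theorem total_mul_d {α : UnivForms A} (hα : α ∈ degree A 1) (η : UnivForms A) :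
    B.total (η * d α) = B.total (d α * η) := by
  induction hα using degree_one_induction with
  | hmul a b =>
    have h1 := B.total_mul_del (η * del a) b
    have h2 := B.total_mul_del (del b * η) a
    have h3 := B.total_mul_del (d η * del a) b
    simp only [d_mul, d_del, d_d, parity_del, mul_zero, zero_mul, zero_add, add_zero, map_zero,
      neg_mul, map_neg, ← mul_assoc] at h1 h2 h3
    rw [d_of_mul_del]
    simp only [← mul_assoc]
    linear_combination h1 + h2 + h3
  | hadd x y _ _ hx hy => rw [map_add, mul_add, add_mul, map_add, map_add, hx, hy]
  | hsmul c x _ hx => rw [map_smul, mul_smul_comm, smul_mul_assoc, map_smul, map_smul, hx]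

/-- For `α = a db`, first `db` is moved around and then `a`; the resulting defects assemble into `dθ
α` and `θ dα`. -/
theorem total_mul_oneForm_of_odd {α : UnivForms A} (hα : α ∈ degree A 1) {θ : UnivForms A}
    (hθ : parity θ = -θ) :
    B.total (θ * α) = B.total (α * θ) + B.total (d θ * α) - B.total (θ * d α) := by
  induction hα using degree_one_induction with
  | hmul a b =>
    have h1 := B.total_mul_del (θ * of a) b
    have h2 := B.total_mul_of (del b * θ) a
    simp only [d_mul, d_of, parity_mul, parity_del, hθ, add_mul, map_add, neg_mul, mul_neg,
      neg_neg, sub_self, zero_mul, map_zero, map_neg] at h1 h2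
    rw [d_of_mul_del]
    simp only [← mul_assoc] at h1 h2 ⊢
    linear_combination h1 + h2
  | hadd x y _ _ hx hy => simp only [map_add, mul_add, add_mul, hx, hy]; ring
  | hsmul c x _ hx => simp only [map_smul, mul_smul_comm, smul_mul_assoc, smul_eq_mul, hx]; ring

theorem total_mul_oneForm_of_even {α : UnivForms A} (hα : α ∈ degree A 1) {θ : UnivForms A}
    (hθ : parity θ = θ) :
    B.total (θ * α) = B.total (α * θ) + B.total (d θ * α) + B.total (d θ * d α) := by
  induction hα using degree_one_induction with
  | hmul a b =>
    have h1 := B.total_mul_del (θ * of a) b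
    have h2 := B.total_mul_of (del b * θ) a
    have h3 := B.total_mul_del (θ * del a) b
    simp only [d_mul, d_of, d_del, parity_mul, parity_del, hθ, add_mul, map_add, neg_mul, mul_zero,
      sub_neg_eq_add, zero_add] at h1 h2 h3
    rw [d_of_mul_del]
    simp only [← mul_assoc] at h1 h2 h3 ⊢
    linear_combination h1 + h2 + h3
  | hadd x y _ _ hx hy => simp only [map_add, mul_add, add_mul, hx, hy]; ring
  | hsmul c x _ hx => simp only [map_smul, mul_smul_comm, smul_mul_assoc, smul_eq_mul, hx]; ring

/-- The two factors `α` are moved around separately. The corrections are themselves products with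
`α` or `dα`, and they cancel after these have been moved as well. -/
theorem total_mul_oneForm_sq {α : UnivForms A} (hα : α ∈ degree A 1) {η : UnivForms A}
    (hη : parity η = η) : B.total (η * α ^ 2) = B.total (α ^ 2 * η) := by
  have ha : parity α = -α := by simpa using parity_of_mem hα
  have hd : parity (d η) = -d η := by rw [parity_d, hη]
  have hX : parity (d α) = d α := by rw [parity_d, ha, map_neg, neg_neg]
  have h1 := B.total_mul_oneForm_of_odd hα (θ := η * α) (by rw [parity_mul, hη, ha, mul_neg])
  have h2 := B.total_mul_oneForm_of_odd hα (θ := α * η) (by rw [parity_mul, hη, ha, neg_mul])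
  have h3 := B.total_mul_oneForm_of_even hα (θ := d η * α) (by
    rw [parity_mul, hd, ha, neg_mul_neg])
  have h4 := B.total_mul_oneForm_of_even hα (θ := η * d α) (by rw [parity_mul, hη, hX])
  have h5 := B.total_mul_d hα (η * α)
  simp only [d_mul, d_d, hη, ha, hd, add_mul, map_add, neg_mul, map_neg, mul_zero, zero_mul,
    zero_add, add_zero] at h1 h2 h3 h4 h5
  simp only [← mul_assoc, pow_two] at h1 h2 h3 h4 h5 ⊢
  linear_combination h1 + h2 + h3 + h4 - h5

/-- The representation `a₀ da₁ ⋯ daₙ ↦ a₀ δa₁ ⋯ δaₙ` of universal forms. -/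
def repForm : UnivForms A →ₐ[ℂ] S := UnivForms.lift B.rep B.der B.der_mul

theorem repForm_mem {α : UnivForms A} (hα : α ∈ degree A 1) : B.repForm α ∈ B.oneForms := by
  induction hα using degree_one_induction with
  | hmul a b => simpa [repForm] using B.mul_mem a b
  | hadd x y _ _ hx hy => rw [map_add]; exact add_mem hx hy
  | hsmul c x _ hx => rw [map_smul]; exact B.oneForms.smul_mem c hx

theorem isTail_eval_repForm {α : UnivForms A} (hα : α ∈ degree A 1) :
    B.IsTail true (fun t => B.eval (B.repForm α :: t)) α := by
  induction hα using degree_one_induction with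
  | hmul a b => simpa [repForm] using IsTail.base (B := B) a b
  | hadd x y _ _ hx hy =>
    simp only [map_add, B.eval_add]
    exact hx.add hy
  | hsmul c x _ hx =>
    simp only [map_smul, B.eval_smul]
    exact hx.smul c

/-- For `α = a db` the element `a` is moved left by `mul_of`. After an odd prefix this also inserts
`da`, which together with `db` is `dα`. -/
theorem IsTail.apply_repForm {B : CyclicBracket A S} {p : Bool} {g : List S → ℂ}
    {θ α : UnivForms A} (h : B.IsTail p g θ) (hα : α ∈ degree A 1) :
    ∃ g₁ g₂, B.IsTail (!p) g₁ (θ * α) ∧ B.IsTail p g₂ (θ * d α) ∧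
      ∀ t : List S, (∀ z ∈ t, z ∈ B.oneForms) →
        g (B.repForm α :: t) = g₁ t + if p then g₂ t else 0 := by
  induction hα using degree_one_induction with
  | hmul a b =>
    obtain ⟨g', h1, h2⟩ := h.mul_of a
    refine ⟨_, _, by rw [← mul_assoc]; exact h1.step b, by
      rw [d_of_mul_del, ← mul_assoc]
      simpa using (h.step a).step b, fun t ht => ?_⟩
    simpa [repForm] using h2 _ (B.der_mem b) t ht
  | hadd x y _ _ hx hy =>
    obtain ⟨g₁, g₂, h1, h2, h3⟩ := hx
    obtain ⟨k₁, k₂, h1', h2', h3'⟩ := hy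
    refine ⟨_, _, by rw [mul_add]; exact h1.add h1', by rw [_root_.map_add, mul_add]; exact h2.add h2',
      fun t ht => ?_⟩
    have h4 := h.map_add (B.repForm x) (B.repForm y) t []
    simp only [List.nil_append] at h4
    rw [_root_.map_add, h4, h3 t ht, h3' t ht]
    split_ifs <;> ring
  | hsmul c x _ hx =>
    obtain ⟨g₁, g₂, h1, h2, h3⟩ := hx
    refine ⟨_, _, by rw [mul_smul_comm]; exact h1.smul c, by
      rw [_root_.map_smul, mul_smul_comm]; exact h2.smul c, fun t ht => ?_⟩
    have h4 := h.map_smul c (B.repForm x) t []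
    simp only [List.nil_append] at h4
    rw [_root_.map_smul, h4, h3 t ht]
    split_ifs <;> ring

end CyclicBracket

/-! ### Universal forms for the powers of a one-form. -/

namespace UnivForms

variable {A : Type*} [Ring A] [Algebra ℂ A]

/-- The odd and the even universal form that represent the bracket of `n + 1` copies of a one-form. -/
def powerForms (α : UnivForms A) : ℕ → UnivForms A × UnivForms A
  | 0 => (α, 0)
  | n + 1 => ((powerForms α n).1 * d α + (powerForms α n).2 * α, (powerForms α n).1 * α)

end UnivForms

namespace CyclicBracket

open UnivForms

variable {A S : Type*} [Ring A] [Algebra ℂ A] [Ring S] [Algebra ℂ S] (B : CyclicBracket A S)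

/-- The copies are absorbed one at a time by `IsTail.apply_repForm`. An odd prefix yields an even
and an odd form, an even prefix only an odd one, which is the recursion of `powerForms`. -/
theorem eval_replicate {α : UnivForms A} (hα : α ∈ degree A 1) (n : ℕ) :
    B.eval (List.replicate (n + 1) (B.repForm α))
      = B.total ((powerForms α n).1 + (powerForms α n).2) := by
  have h : ∀ n, ∃ g g', B.IsTail true g (powerForms α n).1 ∧ B.IsTail false g' (powerForms α n).2 ∧
      ∀ t : List S, (∀ z ∈ t, z ∈ B.oneForms) →
        B.eval (List.replicate (n + 1) (B.repForm α) ++ t) = g t + g' t := by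
    intro n
    induction n with
    | zero => exact ⟨_, _, B.isTail_eval_repForm hα, IsTail.zero false, fun t _ => by simp [powerForms]⟩
    | succ n ih =>
      obtain ⟨g, g', h1, h2, h3⟩ := ih
      obtain ⟨k₁, k₂, h4, h5, h6⟩ := h1.apply_repForm hα
      obtain ⟨l₁, l₂, h7, -, h9⟩ := h2.apply_repForm hα
      refine ⟨_, _, h5.add h7, h4, fun t ht => ?_⟩
      have hV := B.repForm_mem hα
      rw [List.replicate_succ', List.append_assoc, List.singleton_append,
        h3 _ (by simpa using ⟨hV, ht⟩), h6 t ht, h9 t ht]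
      simp
      ring
  obtain ⟨g, g', h1, h2, h3⟩ := h n
  have h4 := h3 [] (by simp)
  rwa [List.append_nil, h1.apply_nil, h2.apply_nil, ← map_add] at h4

end CyclicBracket

/-! ### Transgression -/

namespace UnivForms

variable {A : Type*} [Ring A] [Algebra ℂ A]

/-- The curvature `t dα + t² α²` of the one-form `t α`. -/
def curvaturePath (α : UnivForms A) (t : ℂ) : UnivForms A := t • d α + t ^ 2 • α ^ 2

section Path

variable {α : UnivForms A} (hα : α ∈ degree A 1) (t : ℂ)

include hα

theorem parity_curvaturePath : parity (curvaturePath α t) = curvaturePath α t := by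
  have ha : parity α = -α := by simpa using parity_of_mem hα
  rw [curvaturePath, map_add, map_smul, map_smul, parity_d, ha, pow_two α, parity_mul, ha, map_neg,
    neg_neg, neg_mul_neg]

theorem parity_curvaturePath_pow (k : ℕ) :
    parity (curvaturePath α t ^ k) = curvaturePath α t ^ k := by
  induction k with
  | zero => rw [pow_zero, parity_one]
  | succ k ih => rw [pow_succ, parity_mul, ih, parity_curvaturePath hα]

/-- The Bianchi identity for the connection `t α`. -/
theorem d_curvaturePath :
    d (curvaturePath α t) = t • (curvaturePath α t * α - α * curvaturePath α t) := by
  have ha : parity α = -α := by simpa using parity_of_mem hα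
  rw [curvaturePath, map_add, map_smul, map_smul, d_d, pow_two α, d_mul, ha]
  simp only [add_mul, mul_add, smul_mul_assoc, mul_smul_comm, mul_assoc, smul_sub, smul_add]
  rw [smul_zero, zero_add, neg_mul]
  module

theorem d_curvaturePath_pow (k : ℕ) :
    d (curvaturePath α t ^ k) = t • (curvaturePath α t ^ k * α - α * curvaturePath α t ^ k) := by
  induction k with
  | zero => simp [d_one]
  | succ k ih =>
    rw [pow_succ, d_mul, parity_curvaturePath_pow hα, ih, d_curvaturePath hα]
    simp only [smul_mul_assoc, mul_smul_comm, sub_mul, mul_sub, smul_sub, mul_assoc]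
    abel

theorem d_mul_curvaturePath_pow (k : ℕ) :
    d (α * curvaturePath α t ^ k) = d α * curvaturePath α t ^ k
      - t • (α * curvaturePath α t ^ k * α) + t • (α ^ 2 * curvaturePath α t ^ k) := by
  have ha : parity α = -α := by simpa using parity_of_mem hα
  rw [d_mul, ha, d_curvaturePath_pow hα]
  simp only [neg_mul, mul_smul_comm, mul_sub, smul_sub, pow_two, mul_assoc]
  module

end Path

end UnivForms

namespace CyclicBracket

open UnivForms

variable {A S : Type*} [Ring A] [Algebra ℂ A] [Ring S] [Algebra ℂ S] (B : CyclicBracket A S)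
  {α : UnivForms A} (hα : α ∈ degree A 1) (t : ℂ)

include hα

/-- Moving `α` past the even form `F_tᵏ` leaves the defect `∫ α d(F_tᵏ)`, which the Bianchi identity
evaluates. -/
theorem total_pow_mul_oneForm_sub (k : ℕ) :
    B.total (curvaturePath α t ^ k * α) - B.total (α * curvaturePath α t ^ k)
      = t * (B.total (α * curvaturePath α t ^ k * α) - B.total (α ^ 2 * curvaturePath α t ^ k)) := by
  have hG := parity_curvaturePath_pow hα t k
  have h1 := B.total_mul_oneForm_of_even hα hG
  have h2 := B.total_mul_oneForm_of_odd hα (θ := d (curvaturePath α t ^ k)) (by rw [parity_d, hG])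
  have h3 : B.total (α * d (curvaturePath α t ^ k)) = t * (B.total (α * curvaturePath α t ^ k * α)
      - B.total (α ^ 2 * curvaturePath α t ^ k)) := by
    rw [d_curvaturePath_pow hα, mul_smul_comm, map_smul, mul_sub, map_sub, pow_two, mul_assoc,
      mul_assoc, smul_eq_mul]
  rw [d_d, zero_mul, map_zero] at h2
  linear_combination h1 + h2 + h3

/-- Expanding one factor `F_t` gives for the exponent `k + 1` the same defect as for `k`. The defect
is thus independent of `k`, and zero since it vanishes for `k = 0`. -/
theorem total_pow_succ_mul_oneForm_sub (k : ℕ) :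
    B.total (curvaturePath α t ^ (k + 1) * α) - B.total (α * curvaturePath α t ^ (k + 1))
      = t * (B.total (α * curvaturePath α t ^ k * α) - B.total (α ^ 2 * curvaturePath α t ^ k)) := by
  have ha : parity α = -α := by simpa using parity_of_mem hα
  have hG := parity_curvaturePath_pow hα t k
  have h1 := B.total_mul_oneForm_of_odd hα (θ := α * curvaturePath α t ^ k) (by
    rw [parity_mul, hG, ha, neg_mul])
  have h2 : B.total (curvaturePath α t ^ (k + 1) * α)
      = t * B.total (d α * curvaturePath α t ^ k * α)
        + t ^ 2 * B.total (α ^ 2 * curvaturePath α t ^ k * α) := by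
    rw [pow_succ']
    generalize curvaturePath α t ^ k = G
    rw [curvaturePath]
    simp only [add_mul, smul_mul_assoc, map_add, map_smul, smul_eq_mul]
  have h3 : B.total (α * curvaturePath α t ^ (k + 1))
      = t * B.total (α * curvaturePath α t ^ k * d α)
        + t ^ 2 * B.total (α * curvaturePath α t ^ k * α ^ 2) := by
    rw [pow_succ, ← mul_assoc]
    generalize curvaturePath α t ^ k = G
    rw [curvaturePath]
    simp only [mul_add, mul_smul_comm, map_add, map_smul, smul_eq_mul]
  have h4 := B.total_mul_d hα (curvaturePath α t ^ k * α)
  rw [d_mul_curvaturePath_pow hα] at h1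
  simp only [add_mul, sub_mul, smul_mul_assoc, map_add, map_sub, map_smul, smul_eq_mul] at h1
  simp only [pow_two α, ← mul_assoc] at h1 h2 h3 h4 ⊢
  linear_combination h2 - h3 - t * h1

theorem total_pow_mul_oneForm (k : ℕ) :
    B.total (curvaturePath α t ^ k * α) = B.total (α * curvaturePath α t ^ k) := by
  induction k with
  | zero => simp
  | succ k ih =>
    rw [← sub_eq_zero, B.total_pow_succ_mul_oneForm_sub hα, ← B.total_pow_mul_oneForm_sub hα, ih,
      sub_self]

/-- The defect computed in `total_pow_mul_oneForm_sub` is zero. -/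
theorem total_transgression (k : ℕ) :
    t * B.total (α * curvaturePath α t ^ k * α) = t * B.total (α ^ 2 * curvaturePath α t ^ k) := by
  have h := B.total_pow_mul_oneForm_sub hα t k
  rw [B.total_pow_mul_oneForm hα] at h
  linear_combination -h

theorem total_mul_curvaturePath {η : UnivForms A} (hη : parity η = η) :
    B.total (η * curvaturePath α t) = B.total (curvaturePath α t * η) := by
  simp only [curvaturePath, mul_add, add_mul, mul_smul_comm, smul_mul_assoc, map_add, map_smul,
    B.total_mul_d hα, B.total_mul_oneForm_sq hα hη]

theorem total_mul_curvaturePath_pow (j : ℕ) {η : UnivForms A} (hη : parity η = η) :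
    B.total (η * curvaturePath α t ^ j) = B.total (curvaturePath α t ^ j * η) := by
  induction j generalizing η with
  | zero => simp
  | succ j ih =>
    have hF := parity_curvaturePath hα t
    rw [pow_succ, ← mul_assoc, B.total_mul_curvaturePath hα t (by
      rw [parity_mul, hη, parity_curvaturePath_pow hα]), ← mul_assoc, ih (by
      rw [parity_mul, hη, hF]), mul_assoc]

end CyclicBracket

/-! ### Polynomials with coefficients in the universal forms -/

namespace UnivForms

open Polynomial

variable {A : Type*} [Ring A] [Algebra ℂ A]

/-- Evaluation of polynomials with coefficients in `Ω(A)` at a scalar. -/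
def evalScalar (t : ℂ) : (UnivForms A)[X] →+* UnivForms A :=
  eval₂RingHom' (RingHom.id _) (algebraMap ℂ _ t) fun a => (Algebra.commutes t a).symm

@[simp] theorem evalScalar_C (t : ℂ) (θ : UnivForms A) : evalScalar t (C θ) = θ :=
  eval₂_C _ _

@[simp] theorem evalScalar_X (t : ℂ) : evalScalar t (X : (UnivForms A)[X]) = algebraMap ℂ _ t :=
  eval₂_X _ _

theorem evalScalar_eq_sum (t : ℂ) (p : (UnivForms A)[X]) :
    evalScalar t p = p.sum fun n c => t ^ n • c := by
  change eval₂ _ _ p = _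
  rw [eval₂_eq_sum]
  simp only [RingHom.id_apply, ← map_pow, ← Algebra.commutes, Algebra.smul_def]

/-- A linear functional applied to the coefficients of a polynomial. -/
def mapCoeff (L : UnivForms A →ₗ[ℂ] ℂ) (p : (UnivForms A)[X]) : ℂ[X] :=
  p.sum fun n c => Polynomial.monomial n (L c)

theorem eval_mapCoeff (L : UnivForms A →ₗ[ℂ] ℂ) (p : (UnivForms A)[X]) (t : ℂ) :
    (mapCoeff L p).eval t = L (evalScalar t p) := by
  rw [mapCoeff, evalScalar_eq_sum, sum_def, sum_def, eval_finsetSum, map_sum]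
  simp [mul_comm]

/-- Integration from `0` to `1` of complex polynomials. -/
def integrate : ℂ[X] →ₗ[ℂ] ℂ := lsum fun n => ((n : ℂ) + 1)⁻¹ • LinearMap.id

theorem integrate_mapCoeff (L : UnivForms A →ₗ[ℂ] ℂ) (p : (UnivForms A)[X]) :
    integrate (mapCoeff L p) = L (intPoly p) := by
  rw [mapCoeff, intPoly, sum_def, sum_def, map_sum, map_sum]
  refine Finset.sum_congr rfl fun n _ => ?_
  rw [integrate, lsum_apply, sum_monomial_index _ _ (by simp)]
  simp

/-- A complex polynomial that vanishes at every `t` has zero coefficients, so a pointwise identity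
between polynomials of forms may be integrated. -/
theorem sum_intPoly_eq_zero {ι : Type*} (s : Finset ι) (L : ι → UnivForms A →ₗ[ℂ] ℂ)
    (p : ι → (UnivForms A)[X]) (h : ∀ t, ∑ i ∈ s, L i (evalScalar t (p i)) = 0) :
    ∑ i ∈ s, L i (intPoly (p i)) = 0 := by
  have h0 : ∑ i ∈ s, mapCoeff (L i) (p i) = 0 := Polynomial.funext fun t => by
    rw [eval_finsetSum, eval_zero, ← h t]
    exact Finset.sum_congr rfl fun i _ => eval_mapCoeff _ _ _
  rw [← map_zero integrate, ← h0, map_sum]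
  exact Finset.sum_congr rfl fun i _ => (integrate_mapCoeff _ _).symm

theorem intPoly_derivative (p : (UnivForms A)[X]) :
    intPoly (derivative p) = evalScalar 1 p - evalScalar 0 p := by
  have hadd : ∀ p q : (UnivForms A)[X], intPoly (p + q) = intPoly p + intPoly q := fun p q =>
    sum_add_index _ _ _ (by simp) (by simp)
  induction p using Polynomial.induction_on' with
  | add p q hp hq => rw [derivative_add, hadd, hp, hq, map_add, map_add]; abel
  | monomial n c =>
    rw [derivative_monomial, intPoly, sum_monomial_index _ _ (by simp), evalScalar_eq_sum,
      evalScalar_eq_sum, sum_monomial_index _ _ (by simp), sum_monomial_index _ _ (by simp)]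
    cases n with
    | zero => simp
    | succ n =>
      have h : (c * ((n + 1 : ℕ) : UnivForms A)) = ((n : ℂ) + 1) • c := by
        rw [← Nat.cast_comm, ← nsmul_eq_mul, ← Nat.cast_smul_eq_nsmul ℂ]
        push_cast
        rfl
      rw [h, Nat.add_sub_cancel, smul_smul, inv_mul_cancel₀ (Nat.cast_add_one_ne_zero n)]
      simp

/-- The polynomial `t ↦ t dα + t² α²`. -/
def curvaturePoly (α : UnivForms A) : (UnivForms A)[X] := X * C (d α) + X ^ 2 * C (α ^ 2)

theorem evalScalar_curvaturePoly (α : UnivForms A) (t : ℂ) :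
    evalScalar t (curvaturePoly α) = curvaturePath α t := by
  rw [curvaturePoly, map_add, map_mul, map_mul, map_pow, evalScalar_X, evalScalar_C, evalScalar_C,
    ← map_pow, ← Algebra.smul_def, ← Algebra.smul_def, curvaturePath]

theorem evalScalar_derivative_curvaturePoly (α : UnivForms A) (t : ℂ) :
    evalScalar t (derivative (curvaturePoly α)) = d α + (2 * t) • α ^ 2 := by
  have h : derivative (curvaturePoly α) = C (d α) + (X + X) * C (α ^ 2) := by
    rw [curvaturePoly, derivative_add, derivative_mul, derivative_mul, derivative_C, derivative_C,
      pow_two X, derivative_mul, derivative_X]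
    simp
  rw [h, map_add, map_mul, map_add, evalScalar_C, evalScalar_C, evalScalar_X, ← map_add,
    ← Algebra.smul_def, two_mul]

end UnivForms

/-! ### Integration of the transgression formula. -/

namespace CyclicBracket

open UnivForms Polynomial

variable {A S : Type*} [Ring A] [Algebra ℂ A] [Ring S] [Algebra ℂ S] (B : CyclicBracket A S)
  {α : UnivForms A} (hα : α ∈ degree A 1) (t : ℂ)

include hα

/-- The Leibniz rule yields `k + 1` terms with the derivative in different positions. Even forms may
be moved past powers of `F_t` under the functional, so all terms are equal. The outer exponents `i`,
`j` are there for the induction. -/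
theorem total_pow_mul_derivative_mul_pow (k i j : ℕ) :
    B.total (curvaturePath α t ^ i * evalScalar t (derivative (curvaturePoly α ^ (k + 1)))
      * curvaturePath α t ^ j) = (k + 1) * B.total (curvaturePath α t ^ (i + j + k)
        * evalScalar t (derivative (curvaturePoly α))) := by
  have hF : parity (evalScalar t (derivative (curvaturePoly α)))
      = evalScalar t (derivative (curvaturePoly α)) := by
    have ha : parity α = -α := by simpa using parity_of_mem hα
    rw [evalScalar_derivative_curvaturePoly, map_add, map_smul, parity_d, pow_two, parity_mul, ha,
      map_neg, neg_neg, neg_mul_neg]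
  have hG := parity_curvaturePath_pow hα t
  have h : ∀ i j, B.total (curvaturePath α t ^ i * evalScalar t (derivative (curvaturePoly α))
      * curvaturePath α t ^ j) = B.total (curvaturePath α t ^ (i + j)
        * evalScalar t (derivative (curvaturePoly α))) := fun i j => by
    rw [B.total_mul_curvaturePath_pow hα t j (by rw [parity_mul, hG, hF]), ← mul_assoc, ← pow_add,
      add_comm]
  induction k generalizing i j with
  | zero => simpa using h i j
  | succ k ih =>
    rw [pow_succ, derivative_mul, map_add (evalScalar t), map_mul (evalScalar t), map_mul (evalScalar t),
      map_pow (evalScalar t), evalScalar_curvaturePoly,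
      mul_add, add_mul, map_add]
    have h1 := ih i (j + 1)
    have h2 := h (i + (k + 1)) j
    rw [pow_succ' _ j] at h1
    rw [pow_add _ i] at h2
    simp only [← mul_assoc] at h1 h2 ⊢
    rw [h1, h2, show i + (j + 1) + k = i + j + (k + 1) by ring,
      show i + (k + 1) + j = i + j + (k + 1) by ring]
    push_cast
    ring

theorem total_intPoly (k : ℕ) :
    B.total (chernSimons k α) + B.total (intPoly (X * C α * curvaturePoly α ^ k * C α))
      = B.total (chernSimons k α) - 1 / 2 * B.total (d (chernSimons k α))
        + 1 / (2 * ((k : ℂ) + 1)) * B.total (curvature α ^ (k + 1)) := by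
  -- For every `t`, `∫ t α F_tᵏ α + ½ ∫ d(α F_tᵏ) = (2(k+1))⁻¹ (d/dt) ∫ F_t^{k+1}`. Integration
  -- turns the right-hand side into the integral of the curvature at `t = 1`, as `F_0 = 0`.
  have h := sum_intPoly_eq_zero (A := A) Finset.univ
    ![B.total, (1 / 2 : ℂ) • B.total ∘ₗ d, -(1 / (2 * ((k : ℂ) + 1))) • B.total]
    ![X * C α * curvaturePoly α ^ k * C α, C α * curvaturePoly α ^ k,
      derivative (curvaturePoly α ^ (k + 1))] (fun t => by
      have hk : (k : ℂ) + 1 ≠ 0 := Nat.cast_add_one_ne_zero k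
      have h1 := B.total_pow_mul_derivative_mul_pow hα t k 0 0
      have h2 := B.total_transgression hα t k
      have h3 := B.total_mul_d hα (curvaturePath α t ^ k)
      have h4 := B.total_mul_oneForm_sq hα (parity_curvaturePath_pow hα t k)
      simp only [pow_zero, one_mul, mul_one, zero_add, evalScalar_derivative_curvaturePoly,
        mul_add, mul_smul_comm, map_add, map_smul, smul_eq_mul] at h1
      simp only [Fin.sum_univ_three, Matrix.cons_val, map_mul, map_pow, evalScalar_C, evalScalar_X,
        evalScalar_curvaturePoly, LinearMap.smul_apply, LinearMap.comp_apply, h1,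
        d_mul_curvaturePath_pow hα, ← Algebra.smul_def, smul_mul_assoc, map_smul, map_add, map_sub,
        smul_eq_mul]
      rw [h3, h4]
      field_simp
      linear_combination h2)
  rw [Fin.sum_univ_three] at h
  simp only [Matrix.cons_val, LinearMap.smul_apply, LinearMap.comp_apply, intPoly_derivative,
    map_pow, evalScalar_curvaturePoly, smul_eq_mul] at h
  have h0 : curvaturePath α 0 = 0 := by simp [curvaturePath]
  have h1 : curvaturePath α 1 = curvature α := by simp [curvaturePath, curvature]
  rw [h0, h1, zero_pow (Nat.succ_ne_zero k), sub_zero] at h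
  change _ + 1 / 2 * B.total (d (chernSimons k α)) + _ = 0 at h
  linear_combination h

end CyclicBracket

/-! ### The generating polynomials and the remainder forms. -/

namespace UnivForms

open Polynomial

variable {A : Type*} [Ring A] [Algebra ℂ A]

/-- The polynomials `α (t dα + t² α²)ᵏ` in degree `2k + 1` and `t α (t dα + t² α²)ᵏ α` in degree
`2k + 2`. -/
def transgressionPoly (α : UnivForms A) (l : ℕ) : (UnivForms A)[X] :=
  if Odd l then C α * curvaturePoly α ^ (l / 2)
  else X * C α * curvaturePoly α ^ (l / 2 - 1) * C α

theorem transgressionPoly_odd (α : UnivForms A) (k : ℕ) :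
    transgressionPoly α (2 * k + 1) = C α * curvaturePoly α ^ k := by
  rw [transgressionPoly, if_pos (by simp), show (2 * k + 1) / 2 = k by omega]

theorem transgressionPoly_even (α : UnivForms A) (k : ℕ) :
    transgressionPoly α (2 * k + 2) = X * C α * curvaturePoly α ^ k * C α := by
  rw [transgressionPoly, if_neg (by simp [Nat.odd_add]), show (2 * k + 2) / 2 - 1 = k by omega]

theorem coeff_mul_mem {p q : (UnivForms A)[X]} {m n : ℕ} (hp : ∀ i, p.coeff i ∈ degree A m)
    (hq : ∀ i, q.coeff i ∈ degree A n) (i : ℕ) : (p * q).coeff i ∈ degree A (m + n) := by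
  rw [coeff_mul]
  exact Submodule.sum_mem _ fun x _ => mul_mem_degree (hp _) (hq _)

theorem coeff_C_mem {θ : UnivForms A} {m : ℕ} (hθ : θ ∈ degree A m) (i : ℕ) :
    (C θ).coeff i ∈ degree A m := by
  rw [coeff_C]
  split_ifs
  · exact hθ
  · exact zero_mem _

theorem coeff_X_mem (i : ℕ) : (X : (UnivForms A)[X]).coeff i ∈ degree A 0 := by
  rw [coeff_X]
  split_ifs
  · exact one_mem_degree
  · exact zero_mem _

theorem coeff_curvaturePoly_pow_mem {α : UnivForms A} (hα : α ∈ degree A 1) (k i : ℕ) :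
    (curvaturePoly α ^ k).coeff i ∈ degree A (2 * k) := by
  induction k generalizing i with
  | zero => exact coeff_C_mem one_mem_degree i
  | succ k ih =>
    rw [pow_succ]
    refine coeff_mul_mem ih (fun j => ?_) i
    rw [curvaturePoly, coeff_add]
    refine add_mem ?_ ?_
    · simpa using coeff_mul_mem coeff_X_mem (coeff_C_mem (d_mem hα)) j
    · have h := coeff_mul_mem (coeff_mul_mem coeff_X_mem coeff_X_mem)
        (coeff_C_mem (pow_mem_degree hα 2)) j
      simpa [pow_two X] using h

theorem coeff_transgressionPoly_mem {α : UnivForms A} (hα : α ∈ degree A 1) {l : ℕ} (hl : 1 ≤ l)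
    (i : ℕ) : (transgressionPoly α l).coeff i ∈ degree A l := by
  have hC := coeff_C_mem hα
  obtain ⟨k, rfl⟩ | ⟨k, rfl⟩ : (∃ k, l = 2 * k + 1) ∨ ∃ k, l = 2 * k + 2 := by
    rcases Nat.even_or_odd' l with ⟨k, h | h⟩
    · exact .inr ⟨k - 1, by omega⟩
    · exact .inl ⟨k, h⟩
  · rw [transgressionPoly_odd, add_comm]
    exact coeff_mul_mem hC (coeff_curvaturePoly_pow_mem hα k) i
  · rw [transgressionPoly_even, show 2 * k + 2 = 0 + 1 + 2 * k + 1 by ring]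
    exact coeff_mul_mem (coeff_mul_mem (coeff_mul_mem coeff_X_mem hC)
      (coeff_curvaturePoly_pow_mem hα k)) hC i

theorem natDegree_curvaturePoly_pow_le (α : UnivForms A) (k : ℕ) :
    (curvaturePoly α ^ k).natDegree ≤ 2 * k := by
  have h : (curvaturePoly α).natDegree ≤ 2 := by
    refine natDegree_add_le_of_degree_le ?_ ?_
    · exact (natDegree_mul_C_le _ _).trans (natDegree_X_le.trans one_le_two)
    · exact (natDegree_mul_C_le _ _).trans (natDegree_X_pow_le 2)
  exact natDegree_pow_le.trans (by rw [mul_comm]; exact Nat.mul_le_mul_right k h)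

/-- This bound excludes remainder forms of degree at most `K`: they could only consist of
coefficients of `tⁿ` with `n ≥ K`. -/
theorem natDegree_transgressionPoly_lt (α : UnivForms A) {l : ℕ} (hl : 1 ≤ l) :
    (transgressionPoly α l).natDegree < l := by
  obtain ⟨k, rfl⟩ | ⟨k, rfl⟩ : (∃ k, l = 2 * k + 1) ∨ ∃ k, l = 2 * k + 2 := by
    rcases Nat.even_or_odd' l with ⟨k, h | h⟩
    · exact .inr ⟨k - 1, by omega⟩
    · exact .inl ⟨k, h⟩
  · have h1 := natDegree_C_mul_le α (curvaturePoly α ^ k)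
    have h2 := natDegree_curvaturePoly_pow_le α k
    rw [transgressionPoly_odd]
    omega
  · have h1 := natDegree_mul_C_le (X * C α * curvaturePoly α ^ k) α
    have h2 := natDegree_curvaturePoly_pow_le α k
    have h3 := natDegree_mul_le (p := X * C α) (q := curvaturePoly α ^ k)
    have h4 := natDegree_mul_C_le X α
    have h5 := natDegree_X_le (R := UnivForms A)
    rw [transgressionPoly_even]
    omega

/-- The coefficients of the two generating series satisfy the recursion of `powerForms`. The
finitely many `k < K` suffice, because the `k`-th term is divisible by `tᵏ` and `n < K`. -/
theorem sum_coeff_transgressionPoly (α : UnivForms A) {n K : ℕ} (h : n < K) :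
    ∑ k ∈ Finset.range K, (transgressionPoly α (2 * k + 1)).coeff n = (powerForms α n).1 ∧
    ∑ k ∈ Finset.range K, (transgressionPoly α (2 * k + 2)).coeff n = (powerForms α n).2 := by
  have hs : ∀ k, transgressionPoly α (2 * k + 2) = X * (transgressionPoly α (2 * k + 1) * C α) := by
    intro k
    rw [transgressionPoly_even, transgressionPoly_odd]
    simp only [mul_assoc]
  have ho : ∀ k, transgressionPoly α (2 * (k + 1) + 1)
      = X * (transgressionPoly α (2 * k + 1) * C (d α) + transgressionPoly α (2 * k + 2) * C α) := by
    intro k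
    rw [hs, transgressionPoly_odd, transgressionPoly_odd, pow_succ, ← mul_assoc]
    generalize C α * curvaturePoly α ^ k = Q
    have hX : ∀ q : (UnivForms A)[X], Q * (X * q) = X * (Q * q) := fun q => by
      rw [← mul_assoc, ← X_mul, mul_assoc]
    rw [curvaturePoly, mul_add, mul_add, pow_two, pow_two, C_mul]
    simp only [mul_assoc]
    rw [hX, hX, hX]
  induction n generalizing K with
  | zero =>
    obtain ⟨K, rfl⟩ : ∃ K', K = K' + 1 := ⟨K - 1, by omega⟩
    refine ⟨?_, Finset.sum_eq_zero fun k _ => by rw [hs, coeff_X_mul_zero]⟩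
    rw [Finset.sum_range_succ', Finset.sum_eq_zero fun k _ => by rw [ho, coeff_X_mul_zero],
      transgressionPoly_odd, zero_add, pow_zero, mul_one, coeff_C_zero]
    rfl
  | succ n ih =>
    obtain ⟨K, rfl⟩ : ∃ K', K = K' + 1 := ⟨K - 1, by omega⟩
    refine ⟨?_, ?_⟩
    · rw [Finset.sum_range_succ', transgressionPoly_odd, pow_zero, mul_one, coeff_C_succ, add_zero]
      simp only [ho, coeff_X_mul, coeff_add, coeff_mul_C]
      rw [Finset.sum_add_distrib, ← Finset.sum_mul, ← Finset.sum_mul, (ih (by omega)).1,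
        (ih (by omega)).2]
      rfl
    · simp only [hs, coeff_X_mul, coeff_mul_C]
      rw [← Finset.sum_mul, (ih (by omega)).1]
      rfl

/-- The remainder forms in the expansion of the sum of the brackets of the powers of a one-form up
to order `K`. -/
def remainder (α : UnivForms A) (K l : ℕ) : UnivForms A :=
  if 1 ≤ l ∧ l ≤ 2 * K then
    -∑ n ∈ Finset.Ico K (2 * K), ((n : ℂ) + 1)⁻¹ • (transgressionPoly α l).coeff n
  else 0

theorem remainder_mem {α : UnivForms A} (hα : α ∈ degree A 1) (K l : ℕ) :
    remainder α K l ∈ degree A l := by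
  rw [remainder]
  split_ifs with h
  · exact neg_mem (Submodule.sum_mem _ fun n _ =>
      Submodule.smul_mem _ _ (coeff_transgressionPoly_mem hα h.1 n))
  · exact zero_mem _

theorem remainder_eq_zero (α : UnivForms A) {K l : ℕ} (h : l ≤ K) : remainder α K l = 0 := by
  rw [remainder]
  split_ifs with h1
  · rw [Finset.sum_eq_zero, neg_zero]
    intro n hn
    rw [Finset.mem_Ico] at hn
    rw [coeff_eq_zero_of_natDegree_lt, smul_zero]
    have := natDegree_transgressionPoly_lt α h1.1
    omega
  · rfl

theorem intPoly_transgressionPoly (α : UnivForms A) {K l : ℕ} (h : 1 ≤ l) (h' : l ≤ 2 * K) :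
    intPoly (transgressionPoly α l) = (∑ n ∈ Finset.range K,
      ((n : ℂ) + 1)⁻¹ • (transgressionPoly α l).coeff n) - remainder α K l := by
  rw [intPoly, sum_over_range' _ (by simp) (2 * K)
    ((natDegree_transgressionPoly_lt α h).trans_le h'), remainder, if_pos ⟨h, h'⟩, sub_neg_eq_add,
    Finset.sum_range_add_sum_Ico _ (by omega)]

theorem sum_remainder {M : Type*} [AddCommMonoid M] (f : ℕ → UnivForms A → M)
    (hf : ∀ l, f l 0 = 0) (α : UnivForms A) (K : ℕ) :
    ∑ l ∈ Finset.Icc (K + 1) (2 * K + 1), f l (remainder α K l)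
      = ∑ k ∈ Finset.range K, (f (2 * k + 1) (remainder α K (2 * k + 1))
        + f (2 * k + 2) (remainder α K (2 * k + 2))) := by
  have h : ∀ (g : ℕ → M) (K : ℕ), ∑ l ∈ Finset.range (2 * K), g (l + 1)
      = ∑ k ∈ Finset.range K, (g (2 * k + 1) + g (2 * k + 2)) := by
    intro g K
    induction K with
    | zero => simp
    | succ K ih =>
      rw [show 2 * (K + 1) = 2 * K + 1 + 1 by ring, Finset.sum_range_succ, Finset.sum_range_succ,
        ih, Finset.sum_range_succ, add_assoc]
  have h2 : remainder α K (2 * K + 1) = 0 := by rw [remainder, if_neg (by omega)]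
  rw [← h fun l => f l (remainder α K l), ← add_zero (∑ l ∈ Finset.range (2 * K), _), ← hf (2 * K + 1),
    ← h2, ← Finset.sum_range_succ fun l => f (l + 1) (remainder α K (l + 1)),
    ← add_zero (∑ l ∈ Finset.range (2 * K + 1), _), ← hf 0,
    ← remainder_eq_zero α (Nat.zero_le K),
    ← Finset.sum_range_succ' fun l => f l (remainder α K l)]
  refine Finset.sum_subset (fun l hl => ?_) fun l _ hl => ?_
  · rw [Finset.mem_Icc] at hl
    rw [Finset.mem_range]
    omega
  · rw [remainder_eq_zero, hf]
    simp only [Finset.mem_Icc, Finset.mem_range] at *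
    omega

end UnivForms

namespace CyclicBracket

open UnivForms Polynomial

variable {A S : Type*} [Ring A] [Algebra ℂ A] [Ring S] [Algebra ℂ S] (B : CyclicBracket A S)

/-- The first sum keeps the coefficients of `tⁿ` with `n < K`, the second all coefficients in form
degree at most `2 * K`. The remainder is their difference; the factor `1 / (n + 1)` is the integral
of `tⁿ`. -/
theorem sum_eval_replicate_sub {α : UnivForms A} (hα : α ∈ degree A 1) (K : ℕ) :
    ∑ n ∈ Finset.range K, ((n : ℂ) + 1)⁻¹ * B.eval (List.replicate (n + 1) (B.repForm α))
      - ∑ k ∈ Finset.range K, (B.total (chernSimons k α) - 1 / 2 * B.total (d (chernSimons k α))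
        + 1 / (2 * ((k : ℂ) + 1)) * B.total (curvature α ^ (k + 1)))
      = ∑ l ∈ Finset.Icc (K + 1) (2 * K + 1), B.total (remainder α K l) := by
  rw [sum_remainder (fun _ => B.total) (fun _ => map_zero _), sub_eq_iff_eq_add,
    ← Finset.sum_add_distrib]
  have h : ∀ k ∈ Finset.range K, B.total (remainder α K (2 * k + 1))
      + B.total (remainder α K (2 * k + 2)) + (B.total (chernSimons k α)
        - 1 / 2 * B.total (d (chernSimons k α))
        + 1 / (2 * ((k : ℂ) + 1)) * B.total (curvature α ^ (k + 1)))
      = ∑ n ∈ Finset.range K, ((n : ℂ) + 1)⁻¹ * B.total ((transgressionPoly α (2 * k + 1)).coeff n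
        + (transgressionPoly α (2 * k + 2)).coeff n) := by
    intro k hk
    rw [Finset.mem_range] at hk
    have h1 := congrArg B.total
      (intPoly_transgressionPoly α (K := K) (l := 2 * k + 1) (by omega) (by omega))
    have h2 := congrArg B.total
      (intPoly_transgressionPoly α (K := K) (l := 2 * k + 2) (by omega) (by omega))
    rw [transgressionPoly_odd] at h1
    rw [transgressionPoly_even] at h2
    rw [← B.total_intPoly hα k]
    simp only [map_add, mul_add, Finset.sum_add_distrib, map_sub, map_sum, map_smul, smul_eq_mul,
      ← transgressionPoly_odd, ← transgressionPoly_even] at h1 h2 ⊢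
    rw [chernSimons, ← curvaturePoly, ← transgressionPoly_odd]
    linear_combination h1 + h2
  rw [Finset.sum_congr rfl h, Finset.sum_comm]
  refine Finset.sum_congr rfl fun n hn => ?_
  rw [Finset.mem_range] at hn
  obtain ⟨h1, h2⟩ := sum_coeff_transgressionPoly α hn
  rw [B.eval_replicate hα, ← h1, ← h2, ← Finset.mul_sum, ← map_sum, Finset.sum_add_distrib]

end CyclicBracket

/-! ### The cocycles of a cyclic bracket -/

theorem hochschildB_smul {A : Type*} [Ring A] [Algebra ℂ A] {n : ℕ} (c : ℂ) (φ : Cochain A n)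
    (a : Fin (n + 2) → A) : hochschildB (c • φ) a = c * hochschildB φ a := by
  simp only [hochschildB, smul_apply, smul_eq_mul, mul_add, Finset.mul_sum]
  congr 1
  · exact Finset.sum_congr rfl fun _ _ => by ring
  · ring

theorem connesB_smul {A : Type*} [Ring A] [Algebra ℂ A] {n : ℕ} (c : ℂ) (φ : Cochain A (n + 1))
    (a : Fin (n + 1) → A) : connesB (c • φ) a = c * connesB φ a := by
  simp only [connesB, smul_apply, smul_eq_mul, Finset.mul_sum]
  exact Finset.sum_congr rfl fun _ _ => by ring

theorem Cochain.IsNormalized.smul {A : Type*} [Ring A] [Algebra ℂ A] {n : ℕ} {φ : Cochain A n}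
    (hφ : φ.IsNormalized) (c : ℂ) : Cochain.IsNormalized (c • φ) := fun a j hj h => by
  rw [smul_apply, hφ a j hj h, smul_zero]

theorem isNormalized_psi {A : Type*} [Ring A] [Algebra ℂ A] {φ : (n : ℕ) → Cochain A n}
    (hφ : ∀ n, (φ n).IsNormalized) (k : ℕ) : (psi φ k).IsNormalized := fun a j hj h => by
  have h1 := ((hφ (2 * k + 2)).connesB₀.smul (1 / 2)) a j hj h
  rw [psi, sub_apply, hφ _ a j hj h, h1, sub_zero]

namespace CyclicBracket

open UnivForms

variable {A S : Type*} [Ring A] [Algebra ℂ A] [Ring S] [Algebra ℂ S] (B : CyclicBracket A S)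

/-- A product of differentials is closed, so the correction in `total_mul_del` vanishes when a
differential is moved around. -/
theorem total_prod_del_shift {n : ℕ} (a : Fin (n + 1) → A) (j : Fin (n + 1)) :
    B.total (List.ofFn fun i => del (a (j + i))).prod = B.total (List.ofFn fun i => del (a i)).prod := by
  have hd : ∀ (n : ℕ) (b : Fin n → A), d (List.ofFn fun i => del (b i)).prod = 0 := by
    intro n b
    have h := d_tupleForm (Fin.cons 1 b : Fin (n + 1) → A)
    rw [tupleForm_cons, map_one, one_mul] at h
    rw [h, tupleForm_cons, List.ofFn_succ, List.prod_cons, Fin.cons_zero, del_one, zero_mul, mul_zero]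
  induction j using Fin.induction with
  | zero => simp
  | succ j ih =>
    rw [← ih]
    have hs : ∀ i : Fin (n + 1), j.succ + i = j.castSucc + (i + 1) := by
      intro i
      rw [← Fin.coeSucc_eq_succ, add_assoc, add_comm 1]
    simp only [hs]
    generalize hb : (fun i => a (j.castSucc + i)) = b
    have h1 : ∀ i, a (j.castSucc + i) = b i := fun i => by rw [← hb]
    simp only [h1]
    rw [List.ofFn_succ', List.concat_eq_append, List.prod_append, List.prod_singleton,
      List.ofFn_succ, List.prod_cons, Fin.last_add_one]
    simp only [Fin.coeSucc_eq_succ]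
    rw [B.total_mul_del, hd, zero_mul, map_zero, add_zero]

variable {φ : (n : ℕ) → Cochain A n} (hφ : ∀ n, (φ n).IsNormalized)
  (hI : ∀ n, ∀ θ ∈ degree A n, integral (φ n) θ = B.total θ)

include hφ hI

theorem integral_psi {k : ℕ} {θ : UnivForms A} (hθ : θ ∈ degree A (2 * k + 1)) :
    integral (psi φ k) θ = B.total θ - 1 / 2 * B.total (d θ) := by
  rw [degree_eq_span_tupleForm] at hθ
  induction hθ using Submodule.span_induction with
  | mem x hx =>
    obtain ⟨a, rfl⟩ := hx
    dsimp only
    rw [integral_tupleForm (isNormalized_psi hφ k), psi, sub_apply,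
      smul_apply, ← integral_tupleForm (hφ _),
      ← integral_tupleForm (hφ (2 * k + 2)).connesB₀, integral_connesB₀ (hφ _),
      hI _ _ (tupleForm_mem a), hI _ _ (d_mem (tupleForm_mem a)), smul_eq_mul]
  | zero => simp
  | add x y _ _ hx hy => simp only [map_add, hx, hy]; ring
  | smul c x _ hx => simp only [map_smul, hx, smul_eq_mul]; ring

/-- Even forms commute with elements of the algebra under the functional. -/
theorem hochschildB_even (k : ℕ) (a : Fin (2 * k + 2) → A) : hochschildB (φ (2 * k)) a = 0 := by
  have hθ := tupleForm_mem fun i : Fin (2 * k + 1) => a i.castSucc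
  have hz := of_mem (a (Fin.last (2 * k + 1)))
  rw [hochschildB_eq (hφ _), hI (2 * k) _ (by simpa using mul_mem_degree hθ hz),
    hI (2 * k) _ (by simpa using mul_mem_degree hz hθ), B.total_mul_of, parity_of_mem hθ]
  simp

theorem connesB_even (k : ℕ) (a : Fin (2 * k + 2) → A) : connesB (φ (2 * k + 2)) a = 0 := by
  have hmem : ∀ b : Fin (2 * k + 2) → A,
      (List.ofFn fun i => del (b i)).prod ∈ degree A (2 * k + 2) := fun b => by
    simpa [tupleForm_cons] using tupleForm_mem (Fin.cons 1 b : Fin (2 * k + 3) → A)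
  rw [connesB_eq (hφ _)]
  simp only [hI _ _ (hmem _)]
  simp only [B.total_prod_del_shift]
  rw [← Finset.sum_mul]
  -- All summands agree up to alternating signs, and their number `2 * k + 2` is even.
  simp only [pow_mul, (show Odd (2 * k + 1) by simp).neg_one_pow]
  rw [Fin.sum_univ_eq_sum_range fun j => (-1 : ℂ) ^ j, neg_one_geom_sum,
    if_pos (by simp [Nat.even_add]), zero_mul]

theorem isEvenCocycle : IsEvenCocycle fun k => φ (2 * k) := by
  refine ⟨fun k => hφ _, fun k a => ?_⟩
  have h1 := B.hochschildB_even hφ hI k a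
  have h2 := B.connesB_even hφ hI k a
  exact (congrArg₂ (· + ·) h1 h2).trans (add_zero 0)

/-- The defect `∫ θ da` of odd forms would not be expressed through differentials alone. Subtracting
`½ B₀ φ` cancels the rest and leaves half of `∫ da₀ ⋯ da_{2k+2}`, a quantity that `connesB_psi` also
produces. -/
theorem hochschildB_psi (k : ℕ) (a : Fin (2 * k + 3) → A) : hochschildB (psi φ k) a
    = 1 / 2 * B.total (List.ofFn fun i => del (a i)).prod := by
  have hθ := tupleForm_mem fun i : Fin (2 * k + 2) => a i.castSucc
  have hz := of_mem (a (Fin.last (2 * k + 2)))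
  have hp := parity_of_mem hθ
  rw [(show Odd (2 * k + 1) by simp).neg_one_pow, neg_one_smul] at hp
  have h := d_tupleForm a
  rw [tupleForm_cons, map_one, one_mul, tupleForm_succ, d_mul, d_del, mul_zero, zero_add] at h
  rw [hochschildB_eq (isNormalized_psi hφ k), B.integral_psi hφ hI (k := k) (mul_of_mem hθ _),
    B.integral_psi hφ hI (k := k) (by simpa using mul_mem_degree hz hθ), ← h,
    (show Odd (2 * k + 1) by simp).neg_one_pow]
  generalize tupleForm (fun i : Fin (2 * k + 2) => a i.castSucc) = θ at *
  generalize a (Fin.last (2 * k + 2)) = z at *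
  have h1 := B.total_mul_of θ z
  have h2 := B.total_mul_of (d θ) z
  have h3 := B.total_mul_del θ z
  rw [hp] at h1
  rw [parity_d, hp, map_neg, neg_neg, sub_self, zero_mul, map_zero] at h2
  simp only [sub_neg_eq_add, add_mul, map_add] at h1
  rw [d_mul, d_mul, hp, d_of, parity_of, map_add, map_add, neg_mul θ, map_neg]
  linear_combination (-1 : ℂ) * h1 + 1 / 2 * h2 + 1 / 2 * h3

theorem connesB_psi (k : ℕ) (a : Fin (2 * k + 1) → A) : connesB (psi φ k) a
    = (2 * k + 1) * B.total (List.ofFn fun i => del (a i)).prod := by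
  have hmem : ∀ b : Fin (2 * k + 1) → A,
      (List.ofFn fun i => del (b i)).prod ∈ degree A (2 * k + 1) := fun b => by
    simpa [tupleForm_cons] using tupleForm_mem (Fin.cons 1 b : Fin (2 * k + 2) → A)
  have hd : ∀ b : Fin (2 * k + 1) → A, d (List.ofFn fun i => del (b i)).prod = 0 := by
    intro b
    have h := d_tupleForm (Fin.cons 1 b : Fin (2 * k + 2) → A)
    rw [tupleForm_cons, map_one, one_mul] at h
    rw [h, tupleForm_cons, List.ofFn_succ, List.prod_cons, Fin.cons_zero, del_one, zero_mul, mul_zero]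
  rw [connesB_eq (isNormalized_psi hφ k)]
  simp only [B.integral_psi hφ hI (hmem _), hd, map_zero, mul_zero, sub_zero]
  simp only [B.total_prod_del_shift]
  rw [← Finset.sum_mul]
  simp [pow_mul]

theorem isOddCocycle : IsOddCocycle (psiTilde φ) := by
  refine ⟨fun k => (isNormalized_psi hφ k).smul _, fun a => ?_, fun k a => ?_⟩
  · have h1 : B.total (del (a 0)) = 0 := by
      rw [← one_mul (del (a 0)), ← map_one of, ← (IsTail.base (B := B) 1 (a 0)).apply_nil,
        map_one, one_mul, B.eval_der]
    refine (connesB_smul _ (psi φ 0) a).trans ?_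
    rw [B.connesB_psi hφ hI 0 a]
    have h2 : (List.ofFn fun i : Fin (2 * 0 + 1) => del (a i)).prod = del (a 0) := by
      simp [List.ofFn_succ]
    rw [h2, h1]
    simp
  · have h1 := (hochschildB_smul ((-1) ^ k * (k.factorial / (2 * k + 1).factorial : ℂ))
      (psi φ k) a).trans (congrArg _ (B.hochschildB_psi hφ hI k a))
    have h2 := (connesB_smul ((-1) ^ (k + 1) * ((k + 1).factorial /
      (2 * (k + 1) + 1).factorial : ℂ)) (psi φ (k + 1)) a).trans
      (congrArg _ (B.connesB_psi hφ hI (k + 1) a))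
    -- The normalising constants `c_k = (-1)ᵏ k! / (2k+1)!` are those with `c_k / 2 + (2k + 3)
    -- c_{k+1} = 0`.
    refine (congrArg₂ (· + ·) h1 h2).trans ?_
    have hf : ((2 * (k + 1) + 1).factorial : ℂ)
        = (2 * k + 3) * ((2 * k + 2) * (2 * k + 1).factorial) := by
      rw [show 2 * (k + 1) + 1 = 2 * k + 1 + 1 + 1 by ring, Nat.factorial_succ, Nat.factorial_succ]
      push_cast
      ring
    have hk : ((k + 1).factorial : ℂ) = (k + 1) * k.factorial := by
      rw [Nat.factorial_succ]
      push_cast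
      ring
    have h3 : (2 * (k : ℂ) + 3) ≠ 0 := by exact_mod_cast Nat.succ_ne_zero (2 * k + 2)
    have h4 : ((k : ℂ) + 1) ≠ 0 := Nat.cast_add_one_ne_zero k
    have h5 : ((2 * k + 1).factorial : ℂ) ≠ 0 := Nat.cast_ne_zero.mpr (Nat.factorial_ne_zero _)
    change _ * (1 / 2 * B.total _) + _ * (_ * B.total (List.ofFn fun i : Fin (2 * k + 3) =>
      del (a i)).prod) = 0
    rw [hf, hk]
    push_cast
    field_simp
    ring

theorem expansion {α : UnivForms A} (hα : α ∈ degree A 1) (K : ℕ) :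
    ∑ n ∈ Finset.range K, ((n : ℂ) + 1)⁻¹ * B.eval (List.replicate (n + 1) (B.repForm α))
      - ∑ k ∈ Finset.range K, (integral (psi φ k) (chernSimons k α)
        + (1 / (2 * ((k : ℂ) + 1))) * integral (φ (2 * k + 2)) (curvature α ^ (k + 1)))
      = ∑ l ∈ Finset.Icc (K + 1) (2 * K + 1), integral (φ l) (remainder α K l) := by
  have hcs : ∀ k, chernSimons k α ∈ degree A (2 * k + 1) := by
    intro k
    rw [chernSimons, ← curvaturePoly, ← transgressionPoly_odd, intPoly, Polynomial.sum_def]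
    exact Submodule.sum_mem _ fun n _ => Submodule.smul_mem _ _
      (coeff_transgressionPoly_mem hα (by omega) n)
  have hF : ∀ k, curvature α ^ (k + 1) ∈ degree A (2 * k + 2) := fun k =>
    pow_mem_degree (add_mem (d_mem hα) (pow_mem_degree hα 2)) (k + 1)
  rw [Finset.sum_congr rfl fun l _ => hI l _ (remainder_mem hα K l), ← B.sum_eval_replicate_sub hα K]
  congr 1
  refine Finset.sum_congr rfl fun k _ => ?_
  rw [B.integral_psi hφ hI (hcs k), hI _ _ (hF k)]

end CyclicBracket

/-! ### The cyclic bracket of a spectral triple -/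

section Total

variable {A : Type*} [Ring A] [Algebra ℂ A]

open UnivForms

/-- The sum of the integrals over normalised cochains of all degrees. -/
def totalIntegral (φ : (n : ℕ) → Cochain A n) (hφ : ∀ n, (φ n).IsNormalized) :
    UnivForms A →ₗ[ℂ] ℂ :=
  have h : ∀ θ : UnivForms A, (Function.support fun n => integral (φ n) θ).Finite := fun θ => by
    induction θ using UnivForms.induction_on with
    | hdeg m θ hθ =>
      refine (Set.finite_singleton m).subset fun n hn => ?_
      by_contra hm
      exact hn (integral_eq_zero (hφ n) (fun h => hm h.symm) hθ)
    | hadd x y hx hy =>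
      refine (hx.union hy).subset fun n hn => ?_
      simp only [map_add, Function.mem_support, Set.mem_union] at hn ⊢
      by_contra! h
      exact hn (by rw [h.1, h.2, add_zero])
  { toFun := fun θ => ∑ᶠ n, integral (φ n) θ
    map_add' := fun x y => by
      simp only [map_add]
      exact finsum_add_distrib (h x) (h y)
    map_smul' := fun c x => by
      simp only [map_smul, smul_eq_mul, RingHom.id_apply]
      exact (mul_finsum' _ _ (h x)).symm }

theorem totalIntegral_eq (φ : (n : ℕ) → Cochain A n) (hφ : ∀ n, (φ n).IsNormalized) {n : ℕ}
    {θ : UnivForms A} (hθ : θ ∈ degree A n) : totalIntegral φ hφ θ = integral (φ n) θ :=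
  finsum_eq_single _ n fun m hm => integral_eq_zero (hφ m) hm.symm hθ

end Total

namespace SpectralTriple.Eigenbasis

variable {H : Type*} [NormedAddCommGroup H] [InnerProductSpace ℂ H] [CompleteSpace H]
  {T : SpectralTriple H} {d : ℕ∞} (E : T.Eigenbasis d) (f : ℝ → ℂ) (N : ℕ)

/-- The one-loop bracket of the compressions of bounded operators to the first `N` modes. -/
def loopMap (n : ℕ) : MultilinearMap ℂ (fun _ : Fin (n + 1) => H →L[ℂ] H) ℂ :=
  ∑ a, ∑ x : Fin (n + 1) → Modes.below d N, E.loopKernel f N N a x •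
    (MultilinearMap.mkPiAlgebra ℂ (Fin (n + 1)) ℂ).compLinearMap
      fun i => E.eltₗ (x i) (x (i + 1))

theorem loopMap_apply {n : ℕ} (V : Fin (n + 1) → H →L[ℂ] H) :
    E.loopMap f N n V = ∑ a, traceSum (E.loopKernel f N N a)
      (fun i (k l : Modes.below d N) => E.elt (V i) k l) := by
  simp [loopMap, traceSum]
  rfl

theorem loopMap_rotate {n : ℕ} (V : Fin (n + 1) → H →L[ℂ] H) :
    E.loopMap f N n (fun i => V (i - 1)) = E.loopMap f N n V := by
  rw [loopMap_apply, loopMap_apply]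
  refine Finset.sum_congr rfl fun a _ => ?_
  exact traceSum_rotate (fun x => cutSum_rotate x) fun i (k l : Modes.below d N) => E.elt (V i) k l

/-- With one argument only diagonal matrix elements occur, and those of `[D, a]` are zero. -/
theorem loopMap_comm (a : T.algebra) : E.loopMap f N 0 (fun _ => T.comm a) = 0 := by
  rw [loopMap_apply]
  refine Finset.sum_eq_zero fun b _ => Finset.sum_eq_zero fun x _ => ?_
  rw [Finset.prod_eq_zero (Finset.mem_univ 0), mul_zero]
  exact (E.elt_comm a _ _).trans (by
    rw [show (0 + 1 : Fin 1) = 0 from rfl, sub_self, zero_mul])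

/-- The bracket of a list of operators. -/
def listBracket (l : List (H →L[ℂ] H)) : ℂ :=
  match List.equivSigmaTuple l with
  | ⟨0, _⟩ => 0
  | ⟨n + 1, V⟩ => E.loopMap f N n V

theorem listBracket_ofFn {n : ℕ} (V : Fin (n + 1) → H →L[ℂ] H) :
    E.listBracket f N (List.ofFn V) = E.loopMap f N n V := by
  have h : List.equivSigmaTuple (List.ofFn V) = ⟨n + 1, V⟩ :=
    List.equivSigmaTuple.apply_symm_apply ⟨n + 1, V⟩
  rw [listBracket, h]

theorem listBracket_cons {n : ℕ} (x : H →L[ℂ] H) (V : Fin n → H →L[ℂ] H) :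
    E.listBracket f N (x :: List.ofFn V) = E.loopMap f N n (Fin.cons x V) := by
  rw [← listBracket_ofFn, List.ofFn_cons]

theorem ofFn_snoc {α : Type*} {n : ℕ} (V : Fin n → α) (x : α) :
    List.ofFn (Fin.snoc V x : Fin (n + 1) → α) = List.ofFn V ++ [x] := by
  rw [List.ofFn_succ', List.concat_eq_append]
  simp

theorem listBracket_concat (x : H →L[ℂ] H) (l : List (H →L[ℂ] H)) :
    E.listBracket f N (l ++ [x]) = E.listBracket f N (x :: l) := by
  obtain ⟨n, V, rfl⟩ : ∃ (n : ℕ) (V : Fin n → H →L[ℂ] H), l = List.ofFn V :=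
    ⟨_, l.get, (List.ofFn_get l).symm⟩
  rw [listBracket_cons, ← ofFn_snoc, listBracket_ofFn, ← loopMap_rotate]
  congr 1
  funext i
  induction i using Fin.cases with
  | zero =>
    have h : (0 : Fin (n + 1)) - 1 = Fin.last n := by rw [sub_eq_iff_eq_add, Fin.last_add_one]
    rw [Fin.cons_zero, h, Fin.snoc_last]
  | succ j =>
    rw [Fin.cons_succ, ← Fin.coeSucc_eq_succ, add_sub_cancel_right, Fin.snoc_castSucc]

theorem loopMap_compLinearMap_apply {n : ℕ} (a : T.algebra) (m : Fin (n + 1) → T.algebra) :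
    (E.loopMap f N n).compLinearMap
      (Fin.cons (LinearMap.mulLeft ℂ (a : H →L[ℂ] H) ∘ₗ T.comm) fun _ => T.comm) m
      = E.loopMap f N n
        (Fin.cons ((a : H →L[ℂ] H) * T.comm (m 0)) fun i : Fin n => T.comm (m i.succ)) := by
  rw [MultilinearMap.compLinearMap_apply]
  congr 1
  funext i
  induction i using Fin.cases with
  | zero => rfl
  | succ j => rfl

/-- The cochains `φₙ(a₀, …, aₙ) = ⟨⟨a₀[D, a₁], [D, a₂], …, [D, aₙ]⟩⟩`. -/
def loopCochain : (n : ℕ) → Cochain T.algebra n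
  | 0 => 0
  | n + 1 => LinearMap.uncurryLeft
    { toFun := fun a => (E.loopMap f N n).compLinearMap
        (Fin.cons (LinearMap.mulLeft ℂ (a : H →L[ℂ] H) ∘ₗ T.comm) fun _ => T.comm)
      map_add' := fun a b => by
        ext m
        rw [add_apply, loopMap_compLinearMap_apply, loopMap_compLinearMap_apply,
          loopMap_compLinearMap_apply, AddMemClass.coe_add, add_mul, MultilinearMap.cons_add]
      map_smul' := fun c a => by
        ext m
        rw [smul_apply, loopMap_compLinearMap_apply, loopMap_compLinearMap_apply,
          SetLike.val_smul, smul_mul_assoc, MultilinearMap.cons_smul, RingHom.id_apply] }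

theorem loopCochain_apply {n : ℕ} (a : Fin (n + 2) → T.algebra) :
    E.loopCochain f N (n + 1) a = E.loopMap f N n
      (Fin.cons ((a 0 : H →L[ℂ] H) * T.comm (a 1)) fun i : Fin n => T.comm (a i.succ.succ)) :=
  E.loopMap_compLinearMap_apply f N (a 0) (Fin.tail a)

theorem comm_one : T.comm 1 = 0 := by simpa using T.comm_mul 1 1

theorem loopCochain_isNormalized (n : ℕ) : (E.loopCochain f N n).IsNormalized := by
  intro a j hj h
  cases n with
  | zero => rfl
  | succ n =>
    rw [loopCochain_apply]
    obtain ⟨j, rfl⟩ := Fin.exists_succ_eq.mpr hj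
    refine MultilinearMap.map_coord_zero _ j ?_
    induction j using Fin.cases with
    | zero =>
      rw [Fin.succ_zero_eq_one] at h
      rw [Fin.cons_zero, h, comm_one, mul_zero]
    | succ j => rw [Fin.cons_succ, h, comm_one]

variable {f N}

/-- `loopMap` is multilinear and cyclic on all bounded operators, because it only sees compressions.
Nothing is lost by compressing as long as at most one argument lies outside `M_N`. -/
theorem listBracket_ofFn_eq (hf : ContDiff ℝ ∞ f) (hN : E.PositiveBelow f N) {n : ℕ}
    {V : Fin (n + 1) → H →L[ℂ] H} (i₀ : Fin (n + 1)) (hV : ∀ i, i ≠ i₀ → V i ∈ E.matrices N) :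
    E.listBracket f N (List.ofFn V) = E.oneLoopBracket f N V := by
  rw [listBracket_ofFn, loopMap_apply, E.oneLoopBracket_eq hf le_rfl hN i₀ hV]

theorem listBracket_ward (hf : ContDiff ℝ ∞ f) (hN : E.PositiveBelow f N) {n : ℕ}
    {V : Fin (n + 1) → H →L[ℂ] H} (hV : ∀ i, V i ∈ E.matrices N) (a : T.algebra) :
    E.listBracket f N (List.ofFn (Function.update V 0 ((a : H →L[ℂ] H) * V 0)))
      = E.listBracket f N (List.ofFn
          (Function.update V (Fin.last n) (V (Fin.last n) * (a : H →L[ℂ] H))))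
        + E.listBracket f N (List.ofFn V ++ [T.comm a]) := by
  have h := E.oneLoopBracket_ward hf hN a hV
  rw [← ofFn_snoc, E.listBracket_ofFn_eq hf hN 0 fun i hi => by
      rw [Function.update_of_ne hi]; exact hV i,
    E.listBracket_ofFn_eq hf hN (Fin.last n) fun i hi => by
      rw [Function.update_of_ne hi]; exact hV i,
    E.listBracket_ofFn_eq hf hN (Fin.last (n + 1)) fun i => by
      induction i using Fin.lastCases with
      | last => exact fun h => absurd rfl h
      | cast i => exact fun _ => by rw [Fin.snoc_castSucc]; exact hV i, ← h]
  ring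

/-- The one-loop bracket as a cyclic bracket. -/
def cyclicBracket (hf : ContDiff ℝ ∞ f) (hN : E.PositiveBelow f N)
    (hM : ∀ a b : T.algebra, (a : H →L[ℂ] H) * T.comm b ∈ E.matrices N) :
    CyclicBracket T.algebra (H →L[ℂ] H) where
  rep := T.algebra.subtype.toAlgHom
  der := T.comm
  der_mul := T.comm_mul
  oneForms := E.matrices N
  mul_mem := hM
  eval := E.listBracket f N
  eval_add x y l := by
    obtain ⟨n, V, rfl⟩ : ∃ (n : ℕ) (V : Fin n → H →L[ℂ] H), l = List.ofFn V :=
      ⟨_, l.get, (List.ofFn_get l).symm⟩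
    simp only [listBracket_cons, MultilinearMap.cons_add]
  eval_smul c x l := by
    obtain ⟨n, V, rfl⟩ : ∃ (n : ℕ) (V : Fin n → H →L[ℂ] H), l = List.ofFn V :=
      ⟨_, l.get, (List.ofFn_get l).symm⟩
    simp only [listBracket_cons, MultilinearMap.cons_smul, smul_eq_mul]
  eval_concat := E.listBracket_concat f N
  ward x hx y hy l hl a := by
    obtain ⟨n, V, rfl⟩ : ∃ (n : ℕ) (V : Fin n → H →L[ℂ] H), l = List.ofFn V :=
      ⟨_, l.get, (List.ofFn_get l).symm⟩
    -- The Ward identity is applied to `y, V, x`, so that `y` and `x` are the first and the last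
    -- argument; cyclicity then brings `x` to the front.
    have hW : ∀ i, (Fin.snoc (Fin.cons y V : Fin (n + 1) → H →L[ℂ] H) x :
        Fin (n + 2) → H →L[ℂ] H) i ∈ E.matrices N := by
      intro i
      induction i using Fin.lastCases with
      | last => rwa [Fin.snoc_last]
      | cast i =>
        rw [Fin.snoc_castSucc]
        induction i using Fin.cases with
        | zero => exact hy
        | succ i => exact hl _ (by simp)
    have h := E.listBracket_ward hf hN hW a
    rw [Fin.update_snoc_last, Fin.snoc_last, ofFn_snoc, listBracket_concat, ofFn_snoc,
      listBracket_concat, ← List.cons_append, listBracket_concat, ← Fin.cons_snoc_eq_snoc_cons,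
      Fin.update_cons_zero, Fin.cons_zero, List.ofFn_cons, ofFn_snoc, ← List.cons_append,
      listBracket_concat, List.ofFn_cons] at h
    exact h
  ward_singleton x hx a := by
    have h := E.listBracket_ward hf hN (V := fun _ : Fin 1 => x) (fun _ => hx) a
    simpa [listBracket_concat] using h
  eval_der a := (E.listBracket_ofFn f N fun _ : Fin 1 => T.comm a).trans (E.loopMap_comm f N a)
  total := totalIntegral (E.loopCochain f N) (E.loopCochain_isNormalized f N)
  total_of a := by
    rw [totalIntegral_eq _ _ (UnivForms.of_mem a), ← UnivForms.tupleForm_zero fun _ => a,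
      integral_tupleForm (E.loopCochain_isNormalized f N 0)]
    rfl
  total_monomial a b l := by
    obtain ⟨n, V, rfl⟩ : ∃ (n : ℕ) (V : Fin n → T.algebra), l = List.ofFn V :=
      ⟨_, l.get, (List.ofFn_get l).symm⟩
    have h := UnivForms.tupleForm_eq_monomial
      (Fin.cons a (Fin.cons b V : Fin (n + 1) → T.algebra) : Fin (n + 2) → T.algebra)
    simp only [Fin.cons_zero, Fin.cons_succ, List.ofFn_cons] at h
    rw [← h, totalIntegral_eq _ _ (UnivForms.tupleForm_mem _),
      integral_tupleForm (E.loopCochain_isNormalized f N _), loopCochain_apply, List.map_ofFn,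
      listBracket_cons]
    rfl

end SpectralTriple.Eigenbasis

end NCG

end

theorem mainTheorem9 {H : Type*} [NormedAddCommGroup H] [InnerProductSpace ℂ H] [CompleteSpace H]
    (T : NCG.SpectralTriple H) {d : ℕ∞} (E : T.Eigenbasis d) :
    -- the remainder forms depend on the one-form `A` and the order `K` only
    ∃ rem : NCG.UnivForms T.algebra → ℕ → ℕ → NCG.UnivForms T.algebra,
      (∀ A ∈ NCG.UnivForms.degree T.algebra 1, ∀ K l : ℕ,
        rem A K l ∈ NCG.UnivForms.degree T.algebra l) ∧
      ∀ (f : ℝ → ℂ) (N : ℕ), ContDiff ℝ ∞ f →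
        (∀ i ∈ NCG.Modes.below d N, ∀ j ∈ NCG.Modes.below d N,
          0 < (NCG.divDiff (deriv f) [E.val i] (E.val j)).re ∧
            (NCG.divDiff (deriv f) [E.val i] (E.val j)).im = 0) →
        -- the sum that defines the one-loop bracket is finite, and isomorphic diagrams have the
        -- same amplitude
        (∀ n : ℕ, 1 ≤ n → Finite (NCG.NCDiagram.RelevantClass n)) ∧
        (∀ (n : ℕ) (G G' : NCG.NCDiagram n), NCG.NCDiagram.Isomorphic G G' →
          ∀ V : Fin n → H →L[ℂ] H, (∀ i, ∃ K, V i ∈ E.matrices K) →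
            E.amplitude f N G V = E.amplitude f N G' V) ∧
        -- cyclicity
        (∀ (n : ℕ) (V : Fin (n + 1) → H →L[ℂ] H), (∀ i, ∃ K, V i ∈ E.matrices K) →
          E.oneLoopBracket f N V = E.oneLoopBracket f N fun i => V (i - 1)) ∧
        -- the quantum Ward identity
        (∀ (n : ℕ) (V : Fin (n + 1) → H →L[ℂ] H) (a : T.algebra), (∀ i, V i ∈ E.matrices N) →
          E.oneLoopBracket f N (Function.update V 0 ((a : H →L[ℂ] H) * V 0))
            - E.oneLoopBracket f N
                (Function.update V (Fin.last n) (V (Fin.last n) * (a : H →L[ℂ] H)))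
            = E.oneLoopBracket f N (Fin.snoc V (T.comm a) : Fin (n + 2) → H →L[ℂ] H)) ∧
        -- the cocycles and the expansion
        ((∀ a b : T.algebra, (a : H →L[ℂ] H) * T.comm b ∈ E.matrices N) →
          ∃ φ : (n : ℕ) → NCG.Cochain T.algebra n,
            φ 0 = 0 ∧
            (∀ (n : ℕ) (a : Fin (n + 2) → T.algebra),
              φ (n + 1) a = E.oneLoopBracket f N
                (Fin.cons ((a 0 : H →L[ℂ] H) * T.comm (a 1)) fun i : Fin n =>
                  T.comm (a i.succ.succ) : Fin (n + 1) → H →L[ℂ] H)) ∧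
            NCG.IsEvenCocycle (fun k => φ (2 * k)) ∧
            NCG.IsOddCocycle (NCG.psiTilde φ) ∧
            ∀ A ∈ NCG.UnivForms.degree T.algebra 1, ∀ K : ℕ,
              ∑ n ∈ Finset.range K,
                  (1 / ((n : ℂ) + 1)) * E.oneLoopBracket f N (fun _ : Fin (n + 1) => T.rep A)
                - ∑ k ∈ Finset.range K,
                  (NCG.integral (NCG.psi φ k) (NCG.UnivForms.chernSimons k A)
                    + (1 / (2 * ((k : ℂ) + 1))) *
                      NCG.integral (φ (2 * k + 2)) (NCG.UnivForms.curvature A ^ (k + 1)))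
                = ∑ l ∈ Finset.Icc (K + 1) (2 * K + 1), NCG.integral (φ l) (rem A K l)) := by
  
  refine ⟨NCG.UnivForms.remainder, fun A hA K l => NCG.UnivForms.remainder_mem hA K l,
    fun f N hf hN => ⟨fun n _ => inferInstance, fun n G G' h V hV =>
      E.amplitude_isomorphic hf hN h hV, fun n V hV => E.oneLoopBracket_rotate hf hN hV,
      fun n V a hV => E.oneLoopBracket_ward hf hN a hV, fun hM => ?_⟩⟩
  have hφ := E.loopCochain_isNormalized f N
  have hI : ∀ n, ∀ θ ∈ NCG.UnivForms.degree T.algebra n,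
      NCG.integral (E.loopCochain f N n) θ = (E.cyclicBracket hf hN hM).total θ :=
    fun n θ hθ => (NCG.totalIntegral_eq _ hφ hθ).symm
  refine ⟨E.loopCochain f N, rfl, fun n a => ?_, (E.cyclicBracket hf hN hM).isEvenCocycle hφ hI,
    (E.cyclicBracket hf hN hM).isOddCocycle hφ hI, fun A hA K => ?_⟩
  · rw [E.loopCochain_apply, ← E.listBracket_ofFn, E.listBracket_ofFn_eq hf hN 0]
    intro i hi
    obtain ⟨j, rfl⟩ := Fin.exists_succ_eq.mpr hi
    rw [Fin.cons_succ]
    exact (E.cyclicBracket hf hN hM).der_mem _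
  · rw [← (E.cyclicBracket hf hN hM).expansion hφ hI hA K]
    congr 1
    refine Finset.sum_congr rfl fun n _ => ?_
    have hV : T.rep A ∈ E.matrices N := (E.cyclicBracket hf hN hM).repForm_mem hA
    rw [one_div, ← E.listBracket_ofFn_eq hf hN 0 fun _ _ => hV, List.ofFn_const]
    rfl
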